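/- **Setting.** Let $d\ge 1$, $n\ge 2$, $K\ge 2$ be integers, $\tau\ge 0$, $\sigma>0$, and let $p^\star$ be a $\sigma$-subgaussian probability distribution on $\mathbb{R}^d$, i.e. $\mathbb{E}_{X\sim p^\star}\exp\big((X^\top\theta/\sigma)^2\big)\le 2$ for every unit vector $\theta\in\mathbb{R}^d$. Let $c_0>0$ and $c_1\ge 5c_0$, and define $$\overline\alpha_0=1,\qquad \overline\alpha_1=1-K^{-c_0},\qquad \overline\alpha_k=\overline\alpha_{k-1}-\frac{c_1\log K}{K}\,\overline\alpha_{k-1}(1-\overline\alpha_{k-1})\quad(2\le k\le K),\qquad \alpha_k=\overline\alpha_k/\overline\alpha_{k-1},$$ where $K$ is such that $\alpha_1,\dots,\alpha_K\in(0,1)$ (for $K\ge2$ this holds for instance if $K\ge c_1\log K$). The forward process is $X_0\sim p^\star\ast\mathcal N(0,\tau I_d)$ and $X_k=\sqrt{\alpha_k}\,X_{k-1}+\sqrt{1-\alpha_k}\,W_k$ for $1\le k\le K$, with $W_1,\dots,W_K$ i.i.d. $\mathcal N(0,I_d)$ independent of $X_0$. For $k\ge1$, $X_k$ has a positive smooth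 density $p_{X_k}$; put $s_{X_k}=\nabla\log p_{X_k}$. Let $X^{(1)},\dots,X^{(n)}$ be i.i.d. from $p^\star$, independent of the forward process. For $t>0$ let $\varphi_t$ be the density of $\mathcal N(0,tI_d)$ and $$\widehat p_t(x)=\frac1n\sum_{i=1}^n\varphi_t(X^{(i)}-x),\qquad \eta_t=\frac{\log n}{n(2\pi t)^{d/2}},\qquad \widehat s_t(x)=\frac{\nabla\widehat p_t(x)}{\widehat p_t(x)}\,\psi\big(\widehat p_t(x);\eta_t\big),$$ where $\psi(x;\eta)=1$ for $x\ge\eta$, $\psi(x;\eta)=0$ for $x\le\eta/2$, and $\psi(x;\eta)=\big[1+\exp\big(\frac{1-2y}{y(1-y)}\big)\big]^{-1}$ with $y=2x/\eta-1$ for $\eta/2<x<\eta$. The estimator of $s_{X_k}$ is $$\widehat s_{X_k}(x)=\frac1{\sqrt{\overline\alpha_k}}\,\widehat s_{t_k}\big(x/\sqrt{\overline\alpha_k}\big),\qquad t_k=\frac{1-\overline\alpha_k}{\overline\alpha_k}+\tau .$$ Write $J_f$ for the Jacobian of $f$ and $\|\cdot\|$ for the spectral norm, and set $$\varepsilon_{\mathsf{sc}}=\sqrt{\frac1K\sum_{k=1}^K(1-\overline\alpha_k)\,\mathbb{E}\big\|\widehat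 s_{X_k}(X_k)-s_{X_k}(X_k)\big\|_2^2},\qquad \varepsilon_{\mathsf{jcb}}=\frac1K\sum_{k=1}^K(1-\overline\alpha_k)\,\mathbb{E}\big\|J_{\widehat s_{X_k}}(X_k)-J_{s_{X_k}}(X_k)\big\|,$$ the expectations being over the training data and $X_k$. Finally let $C_d'=(4\sqrt2/\sqrt\pi)^d$, $a\wedge b=\min\{a,b\}$, and read $\tau^{-a}=\infty$ when $\tau=0$. **Theorem.** For every $c_\ast>0$ there is a constant $C>0$ depending only on $c_\ast$ (hence an absolute constant once $c_0$ is bounded below by an absolute constant) such that, in the above setting with any $c_0\ge c_\ast$: 1. $\displaystyle \varepsilon_{\mathsf{sc}}^2\le C\,\frac{C_d'}{n}\bigg\{1+\sigma^d\bigg(\tau^{-d/2}\wedge\frac{K^{c_0d/2}}{d\log K}\bigg)\bigg\}(\log n)^{d/2+1}$; 2. $\displaystyle \varepsilon_{\mathsf{jcb}}\le C\,\Bigg[\sqrt{\frac{C_d'}{n}}\bigg\{1+\sigma^{d/2}\bigg(\tau^{-d/4}\wedge\frac{K^{c_0d/4}}{d\log K}\bigg)\bigg\}(\log n)^{d/4+1}+\frac{C_d'\sigma^d}{n}\bigg(\tau^{-d/2}\wedge\frac{K^{c_0d/2}}{d\log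 K}\bigg)(\log n)^{d/2+1}\Bigg]$; 3. for every realization of the training data, every $x\in\mathbb{R}^d$ and every $k\in\{1,\dots,K\}$, $\displaystyle J_{\widehat s_{X_k}}(x)+\frac{1}{1-\overline\alpha_k}I_d\succcurlyeq0$. In particular, for $k\in\{1,\dots,K\}$ the functions $s_{X_k}$ and $\widehat s_{X_k}$ are differentiable on all of $\mathbb{R}^d$, so that the Jacobians exist. -/

import Mathlib

open MeasureTheory ProbabilityTheory
open scoped ENNReal

noncomputable section

namespace ScoreEst

/-- `ℝ^d` with the Euclidean norm. -/
abbrev Vec (d : ℕ) : Type := EuclideanSpace ℝ (Fin d)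

/-- `μ` is `σ`-subgaussian: `E exp((⟨X, θ⟩ / σ)²) ≤ 2` for every unit vector `θ`, where `X ∼ μ`. -/
def IsSubgaussian {d : ℕ} (σ : ℝ) (μ : Measure (Vec d)) : Prop :=
  ∀ θ : Vec d, ‖θ‖ = 1 →
    ∫⁻ x, ENNReal.ofReal (Real.exp ((inner ℝ x θ / σ) ^ 2)) ∂μ ≤ 2

/-! ### Learning rates -/

/-- The cumulative noise parameters `ᾱ_k`. -/
def alphaBar (K : ℕ) (c₀ c₁ : ℝ) : ℕ → ℝ
  | 0 => 1
  | 1 => 1 - 1 / (K : ℝ) ^ c₀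
  | k + 2 => alphaBar K c₀ c₁ (k + 1)
      - c₁ * Real.log K / K * alphaBar K c₀ c₁ (k + 1) * (1 - alphaBar K c₀ c₁ (k + 1))

/-- The learning rates `α_k = ᾱ_k / ᾱ_{k-1}` (used for `k ≥ 1`). -/
def alpha (K : ℕ) (c₀ c₁ : ℝ) (k : ℕ) : ℝ :=
  alphaBar K c₀ c₁ k / alphaBar K c₀ c₁ (k - 1)

/-! ### The forward process -/

/-- The law of `X_k` in the Markov chain `X_k = √α_k X_{k-1} + √(1 - α_k) W_k` with
`W_k ∼ N(0, I)` independent of `X_{k-1}`, started from `X_0 ∼ p ∗ N(0, τ I)`. -/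
def forwardLaw {d : ℕ} (p : Measure (Vec d)) (τ : ℝ) (K : ℕ) (c₀ c₁ : ℝ) : ℕ → Measure (Vec d)
  | 0 => p.conv ((stdGaussian (Vec d)).map (fun w => √τ • w))
  | k + 1 =>
      ((forwardLaw p τ K c₀ c₁ k).prod (stdGaussian (Vec d))).map
        (fun z => √(alpha K c₀ c₁ (k + 1)) • z.1 + √(1 - alpha K c₀ c₁ (k + 1)) • z.2)

/-- `q` is a continuous probability density of `μ` with respect to Lebesgue measure. There is at
most one such function. -/
def IsContDensity {d : ℕ} (μ : Measure (Vec d)) (q : Vec d → ℝ) : Prop :=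
  Continuous q ∧ (∀ x, 0 ≤ q x) ∧ μ = volume.withDensity (fun x => ENNReal.ofReal (q x))

/-- The continuous density of `μ` (meaningful when there is one). -/
def density {d : ℕ} (μ : Measure (Vec d)) : Vec d → ℝ :=
  Classical.epsilon (IsContDensity μ)

/-- The score function `∇ log p_μ`. -/
def score {d : ℕ} (μ : Measure (Vec d)) (x : Vec d) : Vec d :=
  gradient (fun y => Real.log (density μ y)) x

/-! ### The score estimator -/

/-- The density `φ_t` of `N(0, t I)`. -/
def gaussKernel {d : ℕ} (t : ℝ) (x : Vec d) : ℝ :=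
  1 / (2 * Real.pi * t) ^ ((d : ℝ) / 2) * Real.exp (-‖x‖ ^ 2 / (2 * t))

/-- The kernel density estimator built from the training data. -/
def kde {d n : ℕ} (data : Fin n → Vec d) (t : ℝ) (x : Vec d) : ℝ :=
  1 / (n : ℝ) * ∑ i, gaussKernel t (data i - x)

/-- The threshold `η_t`. -/
def threshold (d n : ℕ) (t : ℝ) : ℝ :=
  Real.log n / (n * (2 * Real.pi * t) ^ ((d : ℝ) / 2))

/-- The soft-thresholding function `ψ(x; η)`. -/
def softThreshold (η x : ℝ) : ℝ :=
  if η ≤ x then 1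
  else if x ≤ η / 2 then 0
  else (1 + Real.exp
    ((1 - 2 * (2 * x / η - 1)) / ((2 * x / η - 1) * (2 - 2 * x / η))))⁻¹

/-- The regularized score estimator `ŝ_t`. -/
def scoreHat {d n : ℕ} (data : Fin n → Vec d) (t : ℝ) (x : Vec d) : Vec d :=
  (softThreshold (threshold d n t) (kde data t x) / kde data t x) • gradient (kde data t) x

/-- The times `t_k = (1 - ᾱ_k) / ᾱ_k + τ`. -/
def time (τ : ℝ) (K : ℕ) (c₀ c₁ : ℝ) (k : ℕ) : ℝ :=
  (1 - alphaBar K c₀ c₁ k) / alphaBar K c₀ c₁ k + τ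

/-- The score estimator `ŝ_{X_k}` for the forward process. -/
def scoreHatX {d n : ℕ} (data : Fin n → Vec d) (τ : ℝ) (K : ℕ) (c₀ c₁ : ℝ) (k : ℕ)
    (x : Vec d) : Vec d :=
  (1 / √(alphaBar K c₀ c₁ k)) •
    scoreHat data (time τ K c₀ c₁ k) ((1 / √(alphaBar K c₀ c₁ k)) • x)

/-! ### The errors

Expectations are over the training data `X⁽¹⁾, …, X⁽ⁿ⁾` i.i.d. from `p` and over `X_k`, which is
independent of the training data. They take values in `[0, ∞]`. -/

/-- The squared `L²` score error at step `k`. -/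
def scErrSq {d : ℕ} (p : Measure (Vec d)) (n : ℕ) (τ : ℝ) (K : ℕ) (c₀ c₁ : ℝ) (k : ℕ) : ℝ≥0∞ :=
  ∫⁻ z, ‖scoreHatX z.1 τ K c₀ c₁ k z.2 - score (forwardLaw p τ K c₀ c₁ k) z.2‖ₑ ^ 2
    ∂((Measure.pi (fun _ : Fin n => p)).prod (forwardLaw p τ K c₀ c₁ k))

/-- The mean Jacobian error at step `k`, in the spectral (operator) norm. -/
def jcbErr {d : ℕ} (p : Measure (Vec d)) (n : ℕ) (τ : ℝ) (K : ℕ) (c₀ c₁ : ℝ) (k : ℕ) : ℝ≥0∞ :=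
  ∫⁻ z, ‖fderiv ℝ (scoreHatX z.1 τ K c₀ c₁ k) z.2
      - fderiv ℝ (score (forwardLaw p τ K c₀ c₁ k)) z.2‖ₑ
    ∂((Measure.pi (fun _ : Fin n => p)).prod (forwardLaw p τ K c₀ c₁ k))

/-- The average score error `ε_sc`. -/
def epsSc {d : ℕ} (p : Measure (Vec d)) (n : ℕ) (τ : ℝ) (K : ℕ) (c₀ c₁ : ℝ) : ℝ≥0∞ :=
  ((K : ℝ≥0∞)⁻¹ * ∑ k ∈ Finset.Icc 1 K,
    ENNReal.ofReal (1 - alphaBar K c₀ c₁ k) * scErrSq p n τ K c₀ c₁ k) ^ (1 / 2 : ℝ)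

/-- The average mean Jacobian error `ε_jcb`. -/
def epsJcb {d : ℕ} (p : Measure (Vec d)) (n : ℕ) (τ : ℝ) (K : ℕ) (c₀ c₁ : ℝ) : ℝ≥0∞ :=
  (K : ℝ≥0∞)⁻¹ * ∑ k ∈ Finset.Icc 1 K,
    ENNReal.ofReal (1 - alphaBar K c₀ c₁ k) * jcbErr p n τ K c₀ c₁ k

/-! ### Quantities in the bounds -/

/-- `C'_d = (4√2 / √π)^d`. -/
def Cd' (d : ℕ) : ℝ := (4 * √2 / √Real.pi) ^ d

/-- `τ^{-a} ∧ K^{c₀ a} / (d log K)`, where `τ^{-a} = ∞` for `τ = 0`. -/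
def capRate (d K : ℕ) (c₀ τ a : ℝ) : ℝ :=
  if τ = 0 then (K : ℝ) ^ (c₀ * a) / (d * Real.log K)
  else min (τ ^ (-a)) ((K : ℝ) ^ (c₀ * a) / (d * Real.log K))

end ScoreEst

end

noncomputable section

namespace ScoreEst

/-! ### Gaussian smoothing of a measure at unit time -/

/-! Everything is reduced to smoothing by a standard Gaussian. The law of `X_k` is the image under a
dilation of `μ ∗ N(0, I)`, where `μ` is the target scaled by `1/√t_k` (`forwardLaw_eq_map`). The
estimator is the same dilation of the regularized score of the empirical measure of the scaled data,
with threshold `log n / n` at every step (`scoreHatX_eq`). Both errors pick up the factor `scale⁻²`,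
and `scale² = 1 - ᾱ_k + ᾱ_k τ`, so the weight `1 - ᾱ_k` cancels it (`one_sub_alphaBar_mul_le`). What
remains is a bound at unit time for a `σ/√t_k`-subgaussian measure.

At unit time let `q` be the unnormalized density. The score is `∇q / q`, and its Jacobian is the
posterior covariance of the noise minus the identity. Nonnegativity of covariances and monotonicity
of the soft threshold give the lower bound on the Jacobian of the estimator
(`isPositive_fderiv_regScore`). Nonnegativity of relative entropy bounds the posterior second moment
by `2 log (1/q)` (`energy_le`). The empirical versions of `q`, `∇q` and the second moment have
variance at most a dimension-free multiple of `q / n`, because the squares of the kernels are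
dominated by the Gaussian kernel itself.

Space is split at `q = 2η`, with `η = log n / n`. Where `q ≥ 2η`, the mean squared score error
weighted by `q` is of order `log n / n`, so the contribution is that times the volume of the region.
The volume is bounded by the integral of `(q/η)^θ`; with `θ = 1/(1 + log n)` the factor `(2/η)^θ`
stays bounded, and the Gaussian tail of `q` gives a volume of order `2^d (1 + σ^d)(log n)^(d/2)`
after normalization (`effective_volume_le`). Where `q < 2η`, the error is controlled by the
posterior second moment plus a multiple of `q`. There the entropy bound would leave an unbounded
logarithm, so an integration by parts against a smooth version of `min(q, η)` is used instead: it
gives `d` times the integral of that truncation, of order `d η` times the volume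
(`integral_cappedEnergy`). The Jacobian error is treated in the same way, but it is a first moment,
so the upper region contributes the square root of the volume over `n`.

Finally the rates are averaged over `k`. The ratio `(1 - ᾱ_k)/ᾱ_k` starts above `K^(-c₀)` and grows
at least geometrically with ratio `1 + c₁ log K / K`, so the average of `t_k^(-a)` is a geometric
series of size `K^(c₀ a) / log K` (`average_time_rpow_neg_le`). Two factors `d` have accumulated,
one from the integration by parts and one from the `d log K` of `capRate`; since `4√2/√π > 3 > 2`,
they are absorbed in passing from `2^d` to `Cd' d`. -/

/-- The unnormalized standard Gaussian density. -/
def bump {d : ℕ} (z : Vec d) : ℝ := Real.exp (-‖z‖ ^ 2 / 2)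

/-- The rank one operator `v ↦ ⟨z, v⟩ z`. -/
def outer {d : ℕ} (z : Vec d) : Vec d →L[ℝ] Vec d := (innerSL ℝ z).smulRight z

/-- The convolution of a measure with a function. -/
def blur {d : ℕ} {F : Type*} [NormedAddCommGroup F] [NormedSpace ℝ F] (μ : Measure (Vec d))
    (f : Vec d → F) (x : Vec d) : F := ∫ y, f (x - y) ∂μ

/-- The unnormalized density of `μ ∗ N(0, I)`. -/
def mass {d : ℕ} (μ : Measure (Vec d)) : Vec d → ℝ := blur μ bump

/-- The gradient of `mass μ`. -/
def drift {d : ℕ} (μ : Measure (Vec d)) : Vec d → Vec d := blur μ fun z => -(bump z • z)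

/-- The unnormalized second moment operator of the posterior of the noise. -/
def secondMoment {d : ℕ} (μ : Measure (Vec d)) : Vec d → (Vec d →L[ℝ] Vec d) :=
  blur μ fun z => bump z • outer z

/-- The trace of `secondMoment μ`. -/
def energy {d : ℕ} (μ : Measure (Vec d)) : Vec d → ℝ := blur μ fun z => bump z * ‖z‖ ^ 2

/-! ### Pointwise bounds on the Gaussian kernel and its derivatives. -/

section bump

variable {d : ℕ} (z : Vec d)

lemma bump_pos : 0 < bump z := Real.exp_pos _

lemma bump_le_one : bump z ≤ 1 := by
  unfold bump
  rw [Real.exp_le_one_iff]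
  nlinarith [sq_nonneg ‖z‖]

lemma continuous_bump : Continuous (bump (d := d)) := by
  unfold bump; fun_prop

/-- Multiplied by one more `bump`, this and the next bound say that the squares of the kernels are
at most a constant times `bump`. This is what makes the sampling variances proportional to `mass`,
with no dimension factor. -/
lemma bump_mul_sq_le_one : bump z * ‖z‖ ^ 2 ≤ 1 := by
  have h := Real.quadratic_le_exp_of_nonneg (x := ‖z‖ ^ 2 / 2) (by positivity)
  have h2 : ‖z‖ ^ 2 ≤ Real.exp (‖z‖ ^ 2 / 2) := by nlinarith [sq_nonneg (‖z‖ ^ 2 / 2 - 1)]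
  calc bump z * ‖z‖ ^ 2 ≤ bump z * Real.exp (‖z‖ ^ 2 / 2) :=
        mul_le_mul_of_nonneg_left h2 (bump_pos z).le
    _ = 1 := by rw [bump, ← Real.exp_add, neg_div, neg_add_cancel, Real.exp_zero]

lemma bump_mul_pow_four_le : bump z * ‖z‖ ^ 4 ≤ 4 := by
  have h := Real.quadratic_le_exp_of_nonneg (x := ‖z‖ ^ 2 / 4) (by positivity)
  have h2 : ‖z‖ ^ 2 / 2 ≤ Real.exp (‖z‖ ^ 2 / 4) := by nlinarith [sq_nonneg (‖z‖ ^ 2 / 4 - 1)]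
  have h3 : ‖z‖ ^ 4 ≤ 4 * Real.exp (‖z‖ ^ 2 / 2) := by
    have h4 : (‖z‖ ^ 2 / 2) ^ 2 ≤ Real.exp (‖z‖ ^ 2 / 4) ^ 2 :=
      pow_le_pow_left₀ (by positivity) h2 2
    rw [← Real.exp_nat_mul] at h4
    have h5 : ((2 : ℕ) : ℝ) * (‖z‖ ^ 2 / 4) = ‖z‖ ^ 2 / 2 := by push_cast; ring
    rw [h5] at h4
    nlinarith
  calc bump z * ‖z‖ ^ 4 ≤ bump z * (4 * Real.exp (‖z‖ ^ 2 / 2)) :=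
        mul_le_mul_of_nonneg_left h3 (bump_pos z).le
    _ = 4 * Real.exp (-‖z‖ ^ 2 / 2 + ‖z‖ ^ 2 / 2) := by rw [bump, Real.exp_add]; ring
    _ = 4 := by rw [neg_div, neg_add_cancel, Real.exp_zero, mul_one]

lemma bump_mul_norm_le_one : bump z * ‖z‖ ≤ 1 := by
  nlinarith [bump_mul_sq_le_one z, bump_le_one z, bump_pos z, sq_nonneg (‖z‖ - 1),
    mul_nonneg (bump_pos z).le (sq_nonneg (‖z‖ - 1))]

lemma norm_outer : ‖outer z‖ = ‖z‖ ^ 2 := by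
  rw [outer, ContinuousLinearMap.norm_smulRight_apply, innerSL_apply_norm, sq]

lemma outer_apply (v : Vec d) : outer z v = inner ℝ z v • z := by
  simp [outer]

lemma continuous_outer : Continuous (outer (d := d)) := by
  unfold outer
  exact ((ContinuousLinearMap.smulRightL ℝ (Vec d) (Vec d)).continuous₂).comp
    (((innerSL ℝ).continuous).prodMk continuous_id)

lemma hasFDerivAt_bump : HasFDerivAt bump (innerSL ℝ (-(bump z • z))) z := by
  have h1 : HasFDerivAt (fun z : Vec d => ‖z‖ ^ 2) (2 • innerSL ℝ z) z :=
    (hasStrictFDerivAt_norm_sq z).hasFDerivAt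
  have h2 := ((h1.neg.mul_const (1 / 2 : ℝ))).exp
  have : (fun z : Vec d => Real.exp (-‖z‖ ^ 2 * (1 / 2))) = bump := by
    ext z; simp [bump, div_eq_mul_inv]
  refine (this ▸ h2).congr_fderiv ?_
  ext v
  simp [bump, div_eq_mul_inv]

lemma hasFDerivAt_bump_smul : HasFDerivAt (fun z : Vec d => -(bump z • z))
    (bump z • outer z - bump z • ContinuousLinearMap.id ℝ (Vec d)) z := by
  have h := ((hasFDerivAt_bump z).smul (hasFDerivAt_id z)).neg
  refine h.congr_fderiv ?_
  ext1 v
  simp [outer_apply, smul_smul, sub_eq_add_neg, add_comm]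

end bump

lemma integrable_comp_sub {d : ℕ} {F : Type*} [NormedAddCommGroup F] {μ : Measure (Vec d)}
    [IsFiniteMeasure μ] {f : Vec d → F} (hf : Continuous f) {C : ℝ} (hC : ∀ z, ‖f z‖ ≤ C)
    (x : Vec d) : Integrable (fun y => f (x - y)) μ := by
  refine Integrable.of_bound (C := C) ?_ (.of_forall fun y => hC _)
  exact (hf.comp (by fun_prop)).aestronglyMeasurable

/-! ### Differentiation under a convolution with a bounded kernel. -/

section blur

variable {d : ℕ} {F : Type*} [NormedAddCommGroup F] [NormedSpace ℝ F] {μ : Measure (Vec d)}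
  [IsFiniteMeasure μ]

lemma continuous_blur {f : Vec d → F} (hf : Continuous f) {C : ℝ} (hC : ∀ z, ‖f z‖ ≤ C) :
    Continuous (blur μ f) := by
  refine continuous_of_dominated (bound := fun _ => C) (fun x => ?_) (fun x => .of_forall ?_)
    (integrable_const C) (.of_forall fun y => hf.comp (by fun_prop))
  · exact (hf.comp (by fun_prop)).aestronglyMeasurable
  · exact fun y => hC _

lemma hasFDerivAt_blur {f : Vec d → F} {f' : Vec d → Vec d →L[ℝ] F}
    (hf : ∀ z, HasFDerivAt f (f' z) z) (hf' : Continuous f') {C : ℝ} (hC : ∀ z, ‖f z‖ ≤ C)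
    (hC' : ∀ z, ‖f' z‖ ≤ C) (x : Vec d) : HasFDerivAt (blur μ f) (blur μ f' x) x := by
  have hc : Continuous f := continuous_iff_continuousAt.2 fun z => (hf z).continuousAt
  refine hasFDerivAt_integral_of_dominated_of_fderiv_le (bound := fun _ => C)
    (F' := fun x y => f' (x - y)) Filter.univ_mem (.of_forall fun x => ?_)
    (integrable_comp_sub hc hC x) ?_ (.of_forall fun y x _ => hC' _)
    (integrable_const C) (.of_forall fun y x _ => ?_)
  · exact (hc.comp (by fun_prop)).aestronglyMeasurable
  · exact (hf'.comp (by fun_prop)).aestronglyMeasurable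
  · have := (hf (x - y)).comp x ((hasFDerivAt_id x).sub_const y)
    simpa [Function.comp_def] using this

end blur

lemma energy_nonneg {d : ℕ} (μ : Measure (Vec d)) (x : Vec d) : 0 ≤ energy μ x :=
  integral_nonneg fun _ => mul_nonneg (bump_pos _).le (sq_nonneg _)

/-- Each rank one term has operator norm equal to its trace, so the triangle inequality already
gives the trace. -/
lemma norm_secondMoment_le {d : ℕ} (μ : Measure (Vec d)) (x : Vec d) :
    ‖secondMoment μ x‖ ≤ energy μ x := by
  refine (norm_integral_le_integral_norm _).trans_eq (integral_congr_ae (.of_forall fun y => ?_))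
  simp only [norm_smul, norm_outer, Real.norm_of_nonneg (bump_pos (x - y)).le]

/-! ### Moments of the posterior of the noise. -/

section moments

variable {d : ℕ} (μ : Measure (Vec d)) [IsProbabilityMeasure μ] (x : Vec d)

lemma norm_bump_le (z : Vec d) : ‖bump z‖ ≤ 1 := by
  rw [Real.norm_of_nonneg (bump_pos z).le]; exact bump_le_one z

lemma norm_bump_smul_le (z : Vec d) : ‖-(bump z • z)‖ ≤ 1 := by
  rw [norm_neg, norm_smul, Real.norm_of_nonneg (bump_pos z).le]; exact bump_mul_norm_le_one z

lemma norm_bump_smul_outer_le (z : Vec d) : ‖bump z • outer z‖ ≤ 1 := by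
  rw [norm_smul, Real.norm_of_nonneg (bump_pos z).le, norm_outer]; exact bump_mul_sq_le_one z

lemma norm_bump_mul_sq_le (z : Vec d) : ‖bump z * ‖z‖ ^ 2‖ ≤ 1 := by
  rw [Real.norm_of_nonneg (mul_nonneg (bump_pos z).le (sq_nonneg _))]; exact bump_mul_sq_le_one z

lemma continuous_bump_smul : Continuous fun z : Vec d => -(bump z • z) :=
  (continuous_bump.smul continuous_id).neg

lemma continuous_bump_smul_outer : Continuous fun z : Vec d => bump z • outer z :=
  continuous_bump.smul continuous_outer

lemma continuous_bump_mul_sq : Continuous fun z : Vec d => bump z * ‖z‖ ^ 2 :=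
  continuous_bump.mul (by fun_prop)

lemma continuous_mass : Continuous (mass μ) := continuous_blur continuous_bump norm_bump_le
lemma continuous_drift : Continuous (drift μ) :=
  continuous_blur continuous_bump_smul norm_bump_smul_le
lemma continuous_secondMoment : Continuous (secondMoment μ) :=
  continuous_blur continuous_bump_smul_outer norm_bump_smul_outer_le
lemma hasFDerivAt_mass : HasFDerivAt (mass μ) (innerSL ℝ (drift μ x)) x := by
  have h := hasFDerivAt_blur (μ := μ) (f := bump) (f' := fun z => innerSL ℝ (-(bump z • z)))
    hasFDerivAt_bump ((innerSL ℝ).continuous.comp continuous_bump_smul) norm_bump_le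
    (fun z => by rw [innerSL_apply_norm]; exact norm_bump_smul_le z) x
  refine h.congr_fderiv ?_
  exact (innerSL ℝ (E := Vec d)).integral_comp_comm
    (integrable_comp_sub continuous_bump_smul norm_bump_smul_le x)

lemma hasFDerivAt_drift : HasFDerivAt (drift μ)
    (secondMoment μ x - mass μ x • ContinuousLinearMap.id ℝ (Vec d)) x := by
  have hb : ∀ z : Vec d, ‖bump z • ContinuousLinearMap.id ℝ (Vec d)‖ ≤ 1 := fun z => by
    rw [norm_smul]
    exact mul_le_one₀ (norm_bump_le z) (norm_nonneg _) ContinuousLinearMap.norm_id_le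
  have hcb : Continuous fun z : Vec d => bump z • ContinuousLinearMap.id ℝ (Vec d) :=
    continuous_bump.smul continuous_const
  have h := hasFDerivAt_blur (μ := μ) hasFDerivAt_bump_smul
    (continuous_bump_smul_outer.sub hcb)
    (C := 2) (fun z => (norm_bump_smul_le z).trans one_le_two)
    (fun z => (norm_sub_le _ _).trans
      (by linarith [norm_bump_smul_outer_le z, hb z])) x
  refine h.congr_fderiv ?_
  unfold blur secondMoment mass blur
  rw [integral_sub (integrable_comp_sub continuous_bump_smul_outer norm_bump_smul_outer_le x)
    (integrable_comp_sub hcb hb x), integral_smul_const]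

lemma mass_pos : 0 < mass μ x := by
  have hi := integrable_comp_sub (μ := μ) continuous_bump norm_bump_le x
  refine (integral_pos_iff_support_of_nonneg (fun y => (bump_pos _).le) hi).2 ?_
  have : Function.support (fun y => bump (x - y)) = Set.univ := by
    ext y; simp [(bump_pos (x - y)).ne']
  rw [this]; simp

lemma mass_le_one : mass μ x ≤ 1 := by
  have := integral_mono (μ := μ) (integrable_comp_sub continuous_bump norm_bump_le x)
    (integrable_const 1) (fun y => bump_le_one (x - y))
  simpa [mass, blur] using this

lemma inner_drift (v : Vec d) :
    inner ℝ v (drift μ x) = -∫ y, bump (x - y) * inner ℝ v (x - y) ∂μ := by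
  have h := (innerSL ℝ v).integral_comp_comm
    (integrable_comp_sub (μ := μ) continuous_bump_smul norm_bump_smul_le x)
  rw [← integral_neg]
  simp only [innerSL_apply_apply, inner_neg_right, inner_smul_right] at h
  rw [h]; rfl

lemma inner_secondMoment (v : Vec d) :
    inner ℝ (secondMoment μ x v) v = ∫ y, bump (x - y) * inner ℝ v (x - y) ^ 2 ∂μ := by
  have h := ((innerSL ℝ v).comp (ContinuousLinearMap.apply ℝ (Vec d) v)).integral_comp_comm
    (integrable_comp_sub (μ := μ) continuous_bump_smul_outer norm_bump_smul_outer_le x)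
  rw [real_inner_comm]
  refine Eq.trans h.symm (integral_congr_ae (.of_forall fun y => ?_))
  simp [outer_apply, real_inner_comm, sq]

lemma secondMoment_isSymmetric :
    (secondMoment μ x : Vec d →ₗ[ℝ] Vec d).IsSymmetric := by
  intro v w
  have h : ∀ a b : Vec d, inner ℝ a (secondMoment μ x b)
      = ∫ y, bump (x - y) * (inner ℝ (x - y) b * inner ℝ (x - y) a) ∂μ := fun a b => by
    have h := ((innerSL ℝ a).comp (ContinuousLinearMap.apply ℝ (Vec d) b)).integral_comp_comm
      (integrable_comp_sub (μ := μ) continuous_bump_smul_outer norm_bump_smul_outer_le x)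
    refine Eq.trans h.symm (integral_congr_ae (.of_forall fun y => ?_))
    simp [outer_apply, real_inner_comm]
  simp only [ContinuousLinearMap.coe_coe]
  rw [real_inner_comm, h, h]
  simp only [mul_comm (inner ℝ _ v)]

/-- Cauchy–Schwarz under the posterior. -/
lemma inner_drift_sq_le (v : Vec d) :
    inner ℝ v (drift μ x) ^ 2 ≤ mass μ x * inner ℝ (secondMoment μ x v) v := by
  have hq := mass_pos μ x
  -- `-c` is the posterior mean of `⟨v, x - y⟩`; the integral of `bump * (⟨v, x - y⟩ + c)²` is a
  -- nonnegative multiple of its posterior variance.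
  set c := inner ℝ v (drift μ x) / mass μ x with hc
  have hi1 := integrable_comp_sub (μ := μ) continuous_bump norm_bump_le x
  have hi2 : Integrable (fun y => bump (x - y) * inner ℝ v (x - y)) μ := by
    refine integrable_comp_sub (f := fun z => bump z * inner ℝ v z) (C := ‖v‖)
      (continuous_bump.mul (by fun_prop)) (fun z => ?_) x
    rw [norm_mul, Real.norm_of_nonneg (bump_pos z).le]
    calc bump z * ‖inner ℝ v z‖ ≤ bump z * (‖v‖ * ‖z‖) :=
          mul_le_mul_of_nonneg_left (norm_inner_le_norm v z) (bump_pos z).le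
      _ = ‖v‖ * (bump z * ‖z‖) := by ring
      _ ≤ ‖v‖ := mul_le_of_le_one_right (norm_nonneg v) (bump_mul_norm_le_one z)
  have hi3 : Integrable (fun y => bump (x - y) * inner ℝ v (x - y) ^ 2) μ := by
    refine integrable_comp_sub (f := fun z => bump z * inner ℝ v z ^ 2) (C := ‖v‖ ^ 2)
      (continuous_bump.mul (by fun_prop)) (fun z => ?_) x
    rw [norm_mul, Real.norm_of_nonneg (bump_pos z).le, norm_pow]
    calc bump z * ‖inner ℝ v z‖ ^ 2 ≤ bump z * (‖v‖ * ‖z‖) ^ 2 :=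
          mul_le_mul_of_nonneg_left (pow_le_pow_left₀ (norm_nonneg _) (norm_inner_le_norm v z) 2)
            (bump_pos z).le
      _ = ‖v‖ ^ 2 * (bump z * ‖z‖ ^ 2) := by ring
      _ ≤ ‖v‖ ^ 2 := mul_le_of_le_one_right (by positivity) (bump_mul_sq_le_one z)
  have h0 : 0 ≤ ∫ y, (bump (x - y) * inner ℝ v (x - y) ^ 2
      + 2 * c * (bump (x - y) * inner ℝ v (x - y)) + c ^ 2 * bump (x - y)) ∂μ := by
    refine integral_nonneg fun y => ?_
    have := mul_nonneg (bump_pos (x - y)).le (sq_nonneg (inner ℝ v (x - y) + c))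
    simp only [Pi.zero_apply]
    linarith
  rw [integral_add (f := fun y => bump (x - y) * inner ℝ v (x - y) ^ 2
      + 2 * c * (bump (x - y) * inner ℝ v (x - y))) (hi3.add (hi2.const_mul _)) (hi1.const_mul _),
    integral_add hi3 (hi2.const_mul _), integral_const_mul, integral_const_mul,
    ← inner_secondMoment] at h0
  have h1 := inner_drift μ x v
  have h2 : ∫ y, bump (x - y) ∂μ = mass μ x := rfl
  rw [h2] at h0
  have h3 : inner ℝ v (drift μ x) = c * mass μ x := by rw [hc]; field_simp
  have h4 : ∫ y, bump (x - y) * inner ℝ v (x - y) ∂μ = -(c * mass μ x) := by linarith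
  rw [h4] at h0
  rw [h3]
  nlinarith

/-- Cauchy–Schwarz is applied in the direction of the drift itself, and one factor `‖drift μ x‖ ^ 2`
is cancelled. -/
lemma norm_drift_sq_le : ‖drift μ x‖ ^ 2 ≤ mass μ x * energy μ x := by
  have h := inner_drift_sq_le μ x (drift μ x)
  rw [real_inner_self_eq_norm_sq] at h
  have h2 : inner ℝ (secondMoment μ x (drift μ x)) (drift μ x) ≤ energy μ x * ‖drift μ x‖ ^ 2 := by
    refine (real_inner_le_norm _ _).trans ?_
    rw [sq, ← mul_assoc]
    exact mul_le_mul_of_nonneg_right (((secondMoment μ x).le_opNorm _).trans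
      (mul_le_mul_of_nonneg_right (norm_secondMoment_le μ x) (norm_nonneg _))) (norm_nonneg _)
  by_cases h0 : ‖drift μ x‖ = 0
  · rw [h0]; simpa using mul_nonneg (mass_pos μ x).le (energy_nonneg μ x)
  · have hp : 0 < ‖drift μ x‖ ^ 2 := by positivity
    have := h.trans (mul_le_mul_of_nonneg_left h2 (mass_pos μ x).le)
    nlinarith

/-- The nonnegativity of relative entropy. -/
lemma energy_le : energy μ x ≤ 2 * (mass μ x * Real.log (1 / mass μ x)) := by
  have hq := mass_pos μ x
  have hi1 := integrable_comp_sub (μ := μ) continuous_bump norm_bump_le x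
  have hi2 := integrable_comp_sub (μ := μ) continuous_bump_mul_sq norm_bump_mul_sq_le x
  have h : ∫ y, bump (x - y) * ‖x - y‖ ^ 2 ∂μ
      ≤ ∫ y, ((2 * Real.log (1 / mass μ x) - 2) * bump (x - y) + 2 * mass μ x) ∂μ := by
    refine integral_mono hi2 ((hi1.const_mul _).add (integrable_const _)) fun y => ?_
    have hb := bump_pos (x - y)
    -- The ratio `bump / mass` is the density of the posterior with respect to `μ`. After
    -- multiplication by `bump` the left side becomes `bump - mass`, whose integral against the
    -- probability measure `μ` is zero, while `log bump` is `-‖x - y‖² / 2`.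
    have h1 := Real.one_sub_inv_le_log_of_pos (div_pos hb hq)
    rw [Real.log_div hb.ne' hq.ne', inv_div, bump, Real.log_exp] at h1
    have h2 := mul_le_mul_of_nonneg_left h1 hb.le
    have h3 : bump (x - y) * (1 - mass μ x / Real.exp (-‖x - y‖ ^ 2 / 2))
        = bump (x - y) - mass μ x := by
      change bump (x - y) * (1 - mass μ x / bump (x - y)) = _
      field_simp
    rw [h3] at h2
    simp only
    rw [one_div, Real.log_inv]
    linarith
  have h2 : ∫ y, bump (x - y) ∂μ = mass μ x := rfl
  rw [integral_add (hi1.const_mul _) (integrable_const _), integral_const_mul, h2] at h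
  simp only [integral_const, probReal_univ, one_smul] at h
  have : energy μ x = ∫ y, bump (x - y) * ‖x - y‖ ^ 2 ∂μ := rfl
  rw [this]; linarith

/-- The Gaussian tail of the smoothed density of a subgaussian measure. -/
lemma mass_le_of_isSubgaussian {σ : ℝ} (hσ : 0 < σ) (hμ : IsSubgaussian σ μ) :
    mass μ x ≤ 2 * Real.exp (-‖x‖ ^ 2 / (2 + σ ^ 2)) := by
  rcases eq_or_ne x 0 with rfl | hx
  · have := mass_le_one μ 0
    simp; linarith
  set θ : Vec d := ‖x‖⁻¹ • x with hθ
  have hxn : 0 < ‖x‖ := norm_pos_iff.2 hx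
  have hθ1 : ‖θ‖ = 1 := by rw [hθ, norm_smul, norm_inv, norm_norm, inv_mul_cancel₀ hxn.ne']
  have h := hμ θ hθ1
  have hcont : Continuous fun y : Vec d => Real.exp ((inner ℝ y θ / σ) ^ 2) := by fun_prop
  have hexp_int : Integrable (fun y : Vec d => Real.exp ((inner ℝ y θ / σ) ^ 2)) μ := by
    refine ⟨hcont.aestronglyMeasurable, ?_⟩
    rw [hasFiniteIntegral_iff_ofReal (.of_forall fun y => (Real.exp_pos _).le)]
    exact h.trans_lt (by simp)
  have h2 : ∫ y, Real.exp ((inner ℝ y θ / σ) ^ 2) ∂μ ≤ 2 := by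
    rw [← ofReal_integral_eq_lintegral_ofReal hexp_int (.of_forall fun y => (Real.exp_pos _).le)] at h
    have := (ENNReal.ofReal_le_iff_le_toReal (by simp)).1 h
    simpa using this
  have hpt : ∀ y, bump (x - y) ≤ Real.exp (-‖x‖ ^ 2 / (2 + σ ^ 2))
      * Real.exp ((inner ℝ y θ / σ) ^ 2) := fun y => by
    rw [bump, ← Real.exp_add, Real.exp_le_exp]
    have h3 : ‖x‖ - inner ℝ y θ = inner ℝ (x - y) θ := by
      rw [inner_sub_left]
      congr 1
      rw [hθ, inner_smul_right, real_inner_self_eq_norm_sq]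
      field_simp
    have h4 : (‖x‖ - inner ℝ y θ) ^ 2 ≤ ‖x - y‖ ^ 2 := by
      rw [h3]
      have := abs_real_inner_le_norm (x - y) θ
      rw [hθ1, mul_one] at this
      exact sq_le_sq' (by linarith [neg_abs_le (inner ℝ (x - y) θ : ℝ)])
        ((le_abs_self _).trans this)
    set r := ‖x‖
    set w : ℝ := inner ℝ y θ
    have hs : 0 < 2 + σ ^ 2 := by positivity
    -- `r² / (2 + σ²)` is the minimum over `w` of `(r - w)² / 2 + (w / σ)²`; the gap is a perfect
    -- square.
    have h5 : -(r - w) ^ 2 / 2 ≤ -r ^ 2 / (2 + σ ^ 2) + (w / σ) ^ 2 := by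
      have : -r ^ 2 / (2 + σ ^ 2) + (w / σ) ^ 2 - -(r - w) ^ 2 / 2
          = (σ ^ 2 * r - (2 + σ ^ 2) * w) ^ 2 / (2 * σ ^ 2 * (2 + σ ^ 2)) := by
        field_simp; ring
      have h6 : 0 ≤ (σ ^ 2 * r - (2 + σ ^ 2) * w) ^ 2 / (2 * σ ^ 2 * (2 + σ ^ 2)) := by positivity
      linarith
    linarith
  calc mass μ x ≤ ∫ y, Real.exp (-‖x‖ ^ 2 / (2 + σ ^ 2)) * Real.exp ((inner ℝ y θ / σ) ^ 2) ∂μ :=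
        integral_mono (integrable_comp_sub continuous_bump norm_bump_le x) (hexp_int.const_mul _) hpt
    _ = Real.exp (-‖x‖ ^ 2 / (2 + σ ^ 2)) * ∫ y, Real.exp ((inner ℝ y θ / σ) ^ 2) ∂μ :=
        integral_const_mul _ _
    _ ≤ 2 * Real.exp (-‖x‖ ^ 2 / (2 + σ ^ 2)) := by
        nlinarith [Real.exp_pos (-‖x‖ ^ 2 / (2 + σ ^ 2))]

end moments

/-! ### Soft thresholding -/

section softThreshold

variable {η u : ℝ}

/-- Since `(1 - 2y) / (y (1 - y)) = 1/y - 1/(1 - y)`, the logistic expression is `e^(-1/y) /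
(e^(-1/y) + e^(-1/(1-y)))`. Smoothness, monotonicity and the range then come from
`Real.smoothTransition`. -/
lemma softThreshold_eq_smoothTransition (hη : 0 < η) (u : ℝ) :
    softThreshold η u = Real.smoothTransition (2 * u / η - 1) := by
  unfold softThreshold
  split_ifs with h1 h2
  · rw [Real.smoothTransition.one_of_one_le]
    have : 1 ≤ u / η := (one_le_div hη).2 h1
    rw [mul_div_assoc]; linarith
  · rw [Real.smoothTransition.zero_of_nonpos]
    have : u / η ≤ 1 / 2 := (div_le_iff₀ hη).2 (by linarith)
    rw [mul_div_assoc]; linarith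
  · have hy0 : 1 / 2 < u / η := (lt_div_iff₀ hη).2 (by linarith)
    have hy1 : u / η < 1 := (div_lt_one hη).2 (by linarith)
    rw [mul_div_assoc]
    set w := u / η
    have e1 : 0 < 2 * w - 1 := by linarith
    have e2 : 0 < 2 - 2 * w := by linarith
    unfold Real.smoothTransition expNegInvGlue
    rw [if_neg (by linarith), if_neg (by linarith)]
    have h3 : 1 - (2 * w - 1) = 2 - 2 * w := by ring
    rw [h3]
    have h4 : Real.exp (-(2 - 2 * w)⁻¹) = Real.exp (-(2 * w - 1)⁻¹)
        * Real.exp ((1 - 2 * (2 * w - 1)) / ((2 * w - 1) * (2 - 2 * w))) := by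
      rw [← Real.exp_add]
      congr 1
      have e3 : 1 - 2 * (2 * w - 1) = (2 - 2 * w) - (2 * w - 1) := by ring
      rw [e3, sub_div, div_mul_cancel_right₀ e2.ne', div_mul_cancel_left₀ e1.ne']
      ring
    rw [h4]
    have h5 := Real.exp_pos (-(2 * w - 1)⁻¹)
    rw [← mul_one_add, div_mul_cancel_left₀ h5.ne']

lemma softThreshold_nonneg (hη : 0 < η) (u : ℝ) : 0 ≤ softThreshold η u := by
  rw [softThreshold_eq_smoothTransition hη]; exact Real.smoothTransition.nonneg _

lemma softThreshold_le_one (hη : 0 < η) (u : ℝ) : softThreshold η u ≤ 1 := by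
  rw [softThreshold_eq_smoothTransition hη]; exact Real.smoothTransition.le_one _

lemma softThreshold_of_le (h : η ≤ u) : softThreshold η u = 1 := if_pos h

lemma softThreshold_of_le_half (hη : 0 < η) (h : u ≤ η / 2) : softThreshold η u = 0 := by
  rw [softThreshold, if_neg (by linarith), if_pos h]

/-- Only the ratio of density to threshold matters, so the normalizing constant of the Gaussian
kernel drops out of the estimator. -/
lemma softThreshold_mul_mul {c : ℝ} (hc : 0 < c) (η u : ℝ) :
    softThreshold (c * η) (c * u) = softThreshold η u := by
  unfold softThreshold
  have h1 : c * η ≤ c * u ↔ η ≤ u := mul_le_mul_iff_right₀ hc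
  have h2 : c * u ≤ c * η / 2 ↔ u ≤ η / 2 := by rw [mul_div_assoc]; exact mul_le_mul_iff_right₀ hc
  have h3 : 2 * (c * u) / (c * η) = 2 * u / η := by
    rw [mul_left_comm, mul_div_mul_left _ _ hc.ne']
  simp only [h1, h2, h3]

lemma differentiable_softThreshold (hη : 0 < η) : Differentiable ℝ (softThreshold η) := by
  have : softThreshold η = fun u => Real.smoothTransition (2 * u / η - 1) :=
    funext (softThreshold_eq_smoothTransition hη)
  rw [this]
  have h : Differentiable ℝ Real.smoothTransition :=
    (Real.smoothTransition.contDiff (n := 1)).differentiable (by simp)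
  exact h.comp (by fun_prop)

lemma deriv_softThreshold_nonneg (hη : 0 < η) (u : ℝ) : 0 ≤ deriv (softThreshold η) u := by
  have : Monotone (softThreshold η) := by
    have : softThreshold η = fun u => Real.smoothTransition (2 * u / η - 1) :=
      funext (softThreshold_eq_smoothTransition hη)
    rw [this]
    intro a b hab
    apply Real.smoothTransition.monotone
    gcongr
  exact this.deriv_nonneg

lemma deriv_softThreshold_of_le (hη : 0 < η) (h : η ≤ u) : deriv (softThreshold η) u = 0 := by
  apply IsLocalMax.deriv_eq_zero
  refine .of_forall fun v => ?_
  rw [softThreshold_of_le h]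
  exact softThreshold_le_one hη v

lemma deriv_softThreshold_of_le_half (hη : 0 < η) (h : u ≤ η / 2) :
    deriv (softThreshold η) u = 0 := by
  apply IsLocalMin.deriv_eq_zero
  refine .of_forall fun v => ?_
  rw [softThreshold_of_le_half hη h]
  exact softThreshold_nonneg hη v

/-- The logarithmic derivative of the soft threshold is bounded by an absolute constant. -/
lemma exists_deriv_softThreshold_mul_le : ∃ C : ℝ, 1 ≤ C ∧ ∀ η u : ℝ, 0 < η → 0 ≤ u →
    deriv (softThreshold η) u * u ≤ C := by
  have hcont : Continuous (deriv Real.smoothTransition) :=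
    (Real.smoothTransition.contDiff (n := 1)).continuous_deriv (by simp)
  obtain ⟨B, hB⟩ := (isCompact_Icc (a := (0 : ℝ)) (b := 1)).exists_bound_of_continuousOn
    hcont.continuousOn
  -- In the transition zone the chain rule gives the factor `2 / η`, and `u < η` leaves at most `2 *
  -- B`. The maximum with `1` only serves later estimates that want a constant at least one.
  refine ⟨max 1 (2 * B), le_max_left _ _, fun η u hη hu => ?_⟩
  rcases le_or_gt η u with h | h
  · rw [deriv_softThreshold_of_le hη h]; simp
  rcases le_or_gt u (η / 2) with h' | h'
  · rw [deriv_softThreshold_of_le_half hη h']; simp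
  refine le_trans ?_ (le_max_right _ _)
  have hfun : softThreshold η = fun u => Real.smoothTransition (2 * u / η - 1) :=
    funext (softThreshold_eq_smoothTransition hη)
  have hd : Differentiable ℝ Real.smoothTransition :=
    (Real.smoothTransition.contDiff (n := 1)).differentiable (by simp)
  have h1 : HasDerivAt (fun u : ℝ => 2 * u / η - 1) (2 * 1 / η) u :=
    (((hasDerivAt_id u).const_mul 2).div_const η).sub_const 1
  have h2 := ((hd (2 * u / η - 1)).hasDerivAt.comp u h1).deriv
  have h3 : deriv (softThreshold η) u
      = deriv Real.smoothTransition (2 * u / η - 1) * (2 * 1 / η) := by rw [hfun]; exact h2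
  rw [h3]
  have e0 : 1 / 2 < u / η := (lt_div_iff₀ hη).2 (by linarith)
  have e1 : u / η < 1 := (div_lt_one hη).2 (by linarith)
  have h4 := hB (2 * u / η - 1) ⟨by rw [mul_div_assoc]; linarith, by rw [mul_div_assoc]; linarith⟩
  have h5 := (le_abs_self _).trans h4
  have hB0 : 0 ≤ B := (norm_nonneg _).trans h4
  calc deriv Real.smoothTransition (2 * u / η - 1) * (2 * 1 / η) * u
      = deriv Real.smoothTransition (2 * u / η - 1) * (2 * (u / η)) := by ring
    _ ≤ B * (2 * (u / η)) := mul_le_mul_of_nonneg_right h5 (by linarith)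
    _ ≤ 2 * B := by nlinarith

end softThreshold

/-! ### The score and its regularization at unit time -/

/-- The score of `μ ∗ N(0, I)`. -/
def unitScore {d : ℕ} (μ : Measure (Vec d)) (x : Vec d) : Vec d :=
  (mass μ x)⁻¹ • drift μ x

/-- The score of `μ ∗ N(0, I)`, regularized at level `η`. -/
def regScore {d : ℕ} (μ : Measure (Vec d)) (η : ℝ) (x : Vec d) : Vec d :=
  (softThreshold η (mass μ x) / mass μ x) • drift μ x

section scores

variable {d : ℕ} (μ : Measure (Vec d)) [IsProbabilityMeasure μ] {η : ℝ} (x : Vec d)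

/-- One product rule serves both scores: `χ u = 1/u` gives the score, and `χ u = softThreshold η u /
u` its regularization. -/
lemma hasFDerivAt_comp_mass_smul_drift {χ : ℝ → ℝ} {χ' : ℝ} (hχ : HasDerivAt χ χ' (mass μ x)) :
    HasFDerivAt (fun x => χ (mass μ x) • drift μ x)
      (χ (mass μ x) • (secondMoment μ x - mass μ x • ContinuousLinearMap.id ℝ (Vec d))
        + χ' • outer (drift μ x)) x := by
  have h := (hχ.comp_hasFDerivAt x (hasFDerivAt_mass μ x)).smul (hasFDerivAt_drift μ x)
  refine h.congr_fderiv ?_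
  ext1 v
  simp [outer_apply, smul_smul]

lemma hasFDerivAt_unitScore :
    HasFDerivAt (unitScore μ) ((mass μ x)⁻¹ • (secondMoment μ x
        - mass μ x • ContinuousLinearMap.id ℝ (Vec d))
      + (-(mass μ x ^ 2)⁻¹) • outer (drift μ x)) x :=
  hasFDerivAt_comp_mass_smul_drift μ x (hasDerivAt_inv (mass_pos μ x).ne')

lemma hasFDerivAt_regScore (hη : 0 < η) :
    HasFDerivAt (regScore μ η) ((softThreshold η (mass μ x) / mass μ x) • (secondMoment μ x
        - mass μ x • ContinuousLinearMap.id ℝ (Vec d))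
      + ((deriv (softThreshold η) (mass μ x) * mass μ x - softThreshold η (mass μ x))
        / mass μ x ^ 2) • outer (drift μ x)) x := by
  have h := ((differentiable_softThreshold hη) (mass μ x)).hasDerivAt.fun_div
    (hasDerivAt_id' (mass μ x)) (mass_pos μ x).ne'
  rw [mul_one] at h
  exact hasFDerivAt_comp_mass_smul_drift μ x h

lemma outer_isSymmetric {d : ℕ} (z : Vec d) : (outer z : Vec d →ₗ[ℝ] Vec d).IsSymmetric := by
  intro v w
  simp [outer_apply, inner_smul_left, inner_smul_right, real_inner_comm, mul_comm]

/-- Write `ψ` for the soft threshold. The quadratic form of the Jacobian is `ψ` times a posterior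
variance, plus a nonnegative multiple of `ψ'` times a square, minus `ψ ‖v‖²`. The first two are
nonnegative by Cauchy–Schwarz and monotonicity of the threshold, and `ψ ≤ 1 ≤ r` settles the third.
-/
lemma isPositive_fderiv_regScore (hη : 0 < η) {r : ℝ} (hr : 1 ≤ r) :
    (fderiv ℝ (regScore μ η) x + r • ContinuousLinearMap.id ℝ (Vec d)).IsPositive := by
  rw [(hasFDerivAt_regScore μ x hη).fderiv]
  have hq := mass_pos μ x
  refine ⟨?_, fun v => ?_⟩
  · have hid : ((ContinuousLinearMap.id ℝ (Vec d) : Vec d →L[ℝ] Vec d) :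
        Vec d →ₗ[ℝ] Vec d).IsSymmetric := fun v w => rfl
    have hs := secondMoment_isSymmetric μ x
    have ho := outer_isSymmetric (drift μ x)
    intro v w
    have h1 := hs v w
    have h2 := ho v w
    simp only [ContinuousLinearMap.coe_coe] at h1 h2
    simp only [ContinuousLinearMap.coe_coe, _root_.add_apply,
      _root_.smul_apply, _root_.sub_apply, inner_add_left,
      inner_sub_left, inner_smul_left, inner_add_right, inner_sub_right, inner_smul_right,
      ContinuousLinearMap.id_apply, h1, h2]
    simp
  · have hcs := inner_drift_sq_le μ x v
    have hψ0 := softThreshold_nonneg hη (mass μ x)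
    have hψ1 := softThreshold_le_one hη (mass μ x)
    have hd := deriv_softThreshold_nonneg hη (mass μ x)
    rw [ContinuousLinearMap.reApplyInnerSelf_apply]
    simp only [_root_.add_apply,
      _root_.smul_apply, _root_.sub_apply, inner_add_left,
      inner_sub_left, inner_smul_left, ContinuousLinearMap.id_apply, outer_apply,
      real_inner_self_eq_norm_sq, RCLike.re_to_real, conj_trivial]
    rw [real_inner_comm] at hcs
    set q := mass μ x
    set a : ℝ := inner ℝ (drift μ x) v
    set h : ℝ := inner ℝ (secondMoment μ x v) v
    set ψ := softThreshold η q
    set ψ' := deriv (softThreshold η) q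
    have key : ψ / q * (h - q * ‖v‖ ^ 2) + (ψ' * q - ψ) / q ^ 2 * (a * a) + r * ‖v‖ ^ 2
        = ψ / q ^ 2 * (q * h - a ^ 2) + ψ' / q * a ^ 2 + (r - ψ) * ‖v‖ ^ 2 := by
      field_simp; ring
    rw [key]
    have e1 : 0 ≤ ψ / q ^ 2 * (q * h - a ^ 2) := mul_nonneg (by positivity) (by linarith)
    have e2 : 0 ≤ (r - ψ) * ‖v‖ ^ 2 := mul_nonneg (by linarith) (by positivity)
    positivity

lemma norm_unitScore_sq_le : ‖unitScore μ x‖ ^ 2 ≤ energy μ x / mass μ x := by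
  have hq := mass_pos μ x
  have h := norm_drift_sq_le μ x
  rw [unitScore, norm_smul, mul_pow, norm_inv, Real.norm_of_nonneg hq.le, inv_pow,
    le_div_iff₀ hq, inv_mul_eq_div, div_mul_eq_mul_div, div_le_iff₀ (by positivity)]
  nlinarith

end scores

/-! ### Deterministic perturbation bounds -/

lemma norm_outer_sub_le {d : ℕ} (a b : Vec d) : ‖outer a - outer b‖ ≤ ‖a - b‖ * (‖a‖ + ‖b‖) := by
  have h : outer a - outer b
      = (innerSL ℝ (a - b)).smulRight a + (innerSL ℝ b).smulRight (a - b) := by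
    ext1 v
    simp [outer_apply, sub_smul, smul_sub]
  rw [h]
  refine (norm_add_le _ _).trans_eq ?_
  rw [ContinuousLinearMap.norm_smulRight_apply, ContinuousLinearMap.norm_smulRight_apply,
    innerSL_apply_norm, innerSL_apply_norm]
  ring

lemma outer_smul {d : ℕ} (c : ℝ) (a : Vec d) : outer (c • a) = c ^ 2 • outer a := by
  ext1 v
  simp [outer_apply, smul_smul, inner_smul_left]
  ring_nf

/-- A bound for the squared norm of a score where the density is at least half the threshold. -/
def logLevel (η : ℝ) : ℝ := 2 * Real.log (2 / η)

lemma one_le_logLevel {η : ℝ} (hη : 0 < η) (hη1 : η ≤ 1) : 1 ≤ logLevel η := by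
  have h : Real.log 2 ≤ Real.log (2 / η) :=
    Real.log_le_log (by norm_num) ((le_div_iff₀ hη).2 (by linarith))
  have := Real.log_two_gt_d9
  rw [logLevel]; linarith

lemma regScore_eq_smul {d : ℕ} (μ : Measure (Vec d)) (η : ℝ) (x : Vec d) :
    regScore μ η x = softThreshold η (mass μ x) • unitScore μ x := by
  rw [regScore, unitScore, smul_smul, div_eq_mul_inv]

lemma norm_regScore_le_norm_unitScore {d : ℕ} (μ : Measure (Vec d)) (x : Vec d) {η : ℝ}
    (hη : 0 < η) : ‖regScore μ η x‖ ≤ ‖unitScore μ x‖ := by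
  rw [regScore_eq_smul, norm_smul, Real.norm_of_nonneg (softThreshold_nonneg hη _)]
  exact mul_le_of_le_one_left (norm_nonneg _) (softThreshold_le_one hη _)

lemma regScore_of_le_half {d : ℕ} (μ : Measure (Vec d)) (x : Vec d) {η : ℝ} (hη : 0 < η)
    (h : mass μ x ≤ η / 2) : regScore μ η x = 0 := by
  rw [regScore_eq_smul, softThreshold_of_le_half hη h, zero_smul]

section perturbation

variable {d : ℕ} (μ ν : Measure (Vec d)) [IsProbabilityMeasure μ] [IsProbabilityMeasure ν]
  {η : ℝ} (x : Vec d)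

lemma energy_div_mass_le (hη : 0 < η) (h : η / 2 ≤ mass μ x) :
    energy μ x / mass μ x ≤ logLevel η := by
  have hq := mass_pos μ x
  rw [div_le_iff₀ hq]
  refine (energy_le μ x).trans ?_
  have : Real.log (1 / mass μ x) ≤ Real.log (2 / η) := by
    apply Real.log_le_log (by positivity)
    rw [div_le_div_iff₀ hq hη]; linarith
  rw [logLevel]
  nlinarith

lemma norm_unitScore_le (hη : 0 < η) (h : η / 2 ≤ mass μ x) :
    ‖unitScore μ x‖ ≤ √(logLevel η) :=
  Real.le_sqrt_of_sq_le ((norm_unitScore_sq_le μ x).trans (energy_div_mass_le μ x hη h))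

lemma norm_regScore_le (hη : 0 < η) : ‖regScore μ η x‖ ≤ √(logLevel η) := by
  rcases le_or_gt (mass μ x) (η / 2) with h | h
  · rw [regScore_of_le_half μ x hη h]; simp
  · exact (norm_regScore_le_norm_unitScore μ x hη).trans (norm_unitScore_le μ x hη h.le)

/-- The difference of quotients is expanded around the score of `μ`, so the size of the score of `ν`
never enters; only `1 / mass ν` does. -/
lemma norm_unitScore_sub_unitScore_le :
    ‖unitScore ν x - unitScore μ x‖ ≤ (mass ν x)⁻¹ * (‖drift ν x - drift μ x‖
      + ‖unitScore μ x‖ * |mass ν x - mass μ x|) := by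
  have hq := mass_pos μ x
  have hp := mass_pos ν x
  have h : unitScore ν x - unitScore μ x = (mass ν x)⁻¹ • ((drift ν x - drift μ x)
      - (mass ν x - mass μ x) • unitScore μ x) := by
    unfold unitScore
    match_scalars <;> field_simp
    ring
  rw [h, norm_smul, norm_inv, Real.norm_of_nonneg hp.le]
  refine mul_le_mul_of_nonneg_left ((norm_sub_le _ _).trans_eq ?_) (by positivity)
  rw [norm_smul, Real.norm_eq_abs, mul_comm |_|]

/-- Score error where the density is above the threshold. -/
lemma norm_regScore_sub_sq_le_of_ge (hη : 0 < η) (h : 2 * η ≤ mass μ x) :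
    ‖regScore ν η x - unitScore μ x‖ ^ 2 ≤ 8 / mass μ x ^ 2 * (‖drift ν x - drift μ x‖ ^ 2
      + 4 * logLevel η * (mass ν x - mass μ x) ^ 2) := by
  have hq := mass_pos μ x
  have hp := mass_pos ν x
  have hs : ‖unitScore μ x‖ ≤ √(logLevel η) := norm_unitScore_le μ x hη (by linarith)
  have hL0 : 0 ≤ logLevel η :=
    (div_nonneg (energy_nonneg μ x) hq.le).trans (energy_div_mass_le μ x hη (by linarith))
  -- Either `mass ν` is at least half of `mass μ`, so that the threshold is inactive and the
  -- quotients can be compared, or the deviation of the mass is itself at least `mass μ / 2` and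
  -- pays for the crude bound `2 √(logLevel η)`.
  have key : ‖regScore ν η x - unitScore μ x‖ ≤ 2 / mass μ x * (‖drift ν x - drift μ x‖
      + 2 * √(logLevel η) * |mass ν x - mass μ x|) := by
    rcases le_or_gt (mass μ x / 2) (mass ν x) with h' | h'
    · rw [regScore_eq_smul, softThreshold_of_le (by linarith), one_smul]
      refine (norm_unitScore_sub_unitScore_le μ ν x).trans ?_
      have h1 : (mass ν x)⁻¹ ≤ 2 / mass μ x := by
        rw [inv_eq_one_div, div_le_div_iff₀ hp hq]; linarith
      refine mul_le_mul h1 (add_le_add le_rfl (mul_le_mul_of_nonneg_right ?_ (abs_nonneg _)))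
        (by positivity) (by positivity)
      linarith [Real.sqrt_nonneg (logLevel η)]
    · have h1 : mass μ x / 2 ≤ |mass ν x - mass μ x| := by
        rw [abs_sub_comm]; exact le_trans (by linarith) (le_abs_self _)
      have h2 := (norm_sub_le (regScore ν η x) (unitScore μ x)).trans
        (add_le_add (norm_regScore_le ν x hη) hs)
      have h3 : 1 ≤ 2 / mass μ x * |mass ν x - mass μ x| := by
        rw [div_mul_eq_mul_div, le_div_iff₀ hq]; linarith
      have h4 : 0 ≤ 2 / mass μ x * ‖drift ν x - drift μ x‖ := by positivity
      nlinarith [Real.sqrt_nonneg (logLevel η)]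
  have h1 := pow_le_pow_left₀ (norm_nonneg _) key 2
  refine h1.trans ?_
  rw [mul_pow, div_pow]
  set a := ‖drift ν x - drift μ x‖
  set b := |mass ν x - mass μ x| with hb
  have h2 : (a + 2 * √(logLevel η) * b) ^ 2
      ≤ 2 * (a ^ 2 + 4 * logLevel η * (mass ν x - mass μ x) ^ 2) := by
    rw [← sq_abs (mass ν x - mass μ x), ← hb]
    have := Real.sq_sqrt hL0
    nlinarith [sq_nonneg (a - 2 * √(logLevel η) * b)]
  calc 2 ^ 2 / mass μ x ^ 2 * (a + 2 * √(logLevel η) * b) ^ 2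
      ≤ 2 ^ 2 / mass μ x ^ 2 * (2 * (a ^ 2 + 4 * logLevel η * (mass ν x - mass μ x) ^ 2)) :=
        mul_le_mul_of_nonneg_left h2 (by positivity)
    _ = _ := by ring

lemma norm_drift_le_norm_unitScore : ‖drift μ x‖ = mass μ x * ‖unitScore μ x‖ := by
  have hq := mass_pos μ x
  rw [unitScore, norm_smul, norm_inv, Real.norm_of_nonneg hq.le, mul_inv_cancel_left₀ hq.ne']

/-- Score error where the density is below the threshold. -/
lemma norm_regScore_sub_sq_le_of_lt (hη : 0 < η) (h : mass μ x < 2 * η) :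
    ‖regScore ν η x - unitScore μ x‖ ^ 2 ≤ 50 * (energy μ x / mass μ x)
      + 8 / η ^ 2 * ‖drift ν x - drift μ x‖ ^ 2 := by
  have hp := mass_pos ν x
  -- The regularized score vanishes unless `mass ν > η / 2`, so the quotient costs at most `2 / η`;
  -- the drift of `μ` is its score times a mass below `2η`.
  have hd : ‖regScore ν η x‖ ≤ 2 / η * ‖drift ν x - drift μ x‖ + 4 * ‖unitScore μ x‖ := by
    rcases le_or_gt (mass ν x) (η / 2) with h' | h'
    · rw [regScore_of_le_half ν x hη h']; rw [norm_zero]; positivity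
    · refine (norm_regScore_le_norm_unitScore ν x hη).trans ?_
      rw [unitScore, norm_smul, norm_inv, Real.norm_of_nonneg hp.le]
      have h1 : (mass ν x)⁻¹ ≤ 2 / η := by
        rw [inv_eq_one_div, div_le_div_iff₀ hp hη]; linarith
      have h2 : ‖drift ν x‖ ≤ ‖drift ν x - drift μ x‖ + 2 * η * ‖unitScore μ x‖ := by
        refine (norm_le_norm_sub_add _ (drift μ x)).trans (add_le_add le_rfl ?_)
        rw [norm_drift_le_norm_unitScore]
        exact mul_le_mul_of_nonneg_right h.le (norm_nonneg _)
      calc (mass ν x)⁻¹ * ‖drift ν x‖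
          ≤ 2 / η * (‖drift ν x - drift μ x‖ + 2 * η * ‖unitScore μ x‖) :=
            mul_le_mul h1 h2 (norm_nonneg _) (by positivity)
        _ = _ := by field_simp; ring
  have h1 := (norm_sub_le (regScore ν η x) (unitScore μ x)).trans (add_le_add hd le_rfl)
  have h2 := pow_le_pow_left₀ (norm_nonneg _) h1 2
  refine h2.trans ?_
  have h3 := norm_unitScore_sq_le μ x
  set s := ‖unitScore μ x‖
  set δ := ‖drift ν x - drift μ x‖
  have h4 : 8 / η ^ 2 * δ ^ 2 = 2 * (2 / η * δ) ^ 2 := by ring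
  rw [h4]
  -- This is `(a + 5s)² ≤ 2a² + 50s²` with `a = 2δ/η`; the `5` is `4` from the regularized score
  -- plus `1` from the score itself.
  nlinarith [sq_nonneg (2 / η * δ - 5 * s)]

/-- The norm of the Jacobian of the score. -/
lemma norm_fderiv_unitScore_le :
    ‖fderiv ℝ (unitScore μ) x‖ ≤ 1 + 2 * (energy μ x / mass μ x) := by
  have hq := mass_pos μ x
  rw [(hasFDerivAt_unitScore μ x).fderiv]
  have h1 : ‖(mass μ x)⁻¹ • (secondMoment μ x - mass μ x • ContinuousLinearMap.id ℝ (Vec d))‖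
      ≤ energy μ x / mass μ x + 1 := by
    rw [smul_sub, smul_smul, inv_mul_cancel₀ hq.ne', one_smul]
    refine (norm_sub_le _ _).trans (add_le_add ?_ ContinuousLinearMap.norm_id_le)
    rw [norm_smul, norm_inv, Real.norm_of_nonneg hq.le, inv_mul_eq_div]
    exact div_le_div_of_nonneg_right (norm_secondMoment_le μ x) hq.le
  have h2 : ‖(-(mass μ x ^ 2)⁻¹) • outer (drift μ x)‖ ≤ energy μ x / mass μ x := by
    rw [norm_smul, norm_neg, norm_inv, norm_pow, Real.norm_of_nonneg hq.le, norm_outer]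
    refine le_of_eq_of_le ?_ (norm_unitScore_sq_le μ x)
    rw [unitScore, norm_smul, mul_pow, norm_inv, Real.norm_of_nonneg hq.le, inv_pow]
  linarith [norm_add_le ((mass μ x)⁻¹ • (secondMoment μ x
    - mass μ x • ContinuousLinearMap.id ℝ (Vec d))) ((-(mass μ x ^ 2)⁻¹) • outer (drift μ x))]

lemma fderiv_regScore_of_le_half (hη : 0 < η) (h : mass μ x ≤ η / 2) :
    fderiv ℝ (regScore μ η) x = 0 := by
  rw [(hasFDerivAt_regScore μ x hη).fderiv, softThreshold_of_le_half hη h,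
    deriv_softThreshold_of_le_half hη h]
  ext1 v
  simp

/-- The norm of the Jacobian of the regularized score. -/
lemma norm_fderiv_regScore_le {C : ℝ}
    (hC : ∀ η u : ℝ, 0 < η → 0 ≤ u → deriv (softThreshold η) u * u ≤ C) (hη : 0 < η) :
    ‖fderiv ℝ (regScore μ η) x‖ ≤ 1 + ‖secondMoment μ x‖ / mass μ x
      + (C + 1) * (‖drift μ x‖ ^ 2 / mass μ x ^ 2) := by
  have hq := mass_pos μ x
  have hψ0 := softThreshold_nonneg hη (mass μ x)
  have hψ1 := softThreshold_le_one hη (mass μ x)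
  have hd := deriv_softThreshold_nonneg hη (mass μ x)
  have hdC := hC η (mass μ x) hη hq.le
  rw [(hasFDerivAt_regScore μ x hη).fderiv]
  refine (norm_add_le _ _).trans (add_le_add ?_ ?_)
  · rw [smul_sub, smul_smul, div_mul_cancel₀ _ hq.ne']
    refine (norm_sub_le _ _).trans ?_
    rw [add_comm]
    refine add_le_add ?_ ?_
    · rw [norm_smul, Real.norm_of_nonneg hψ0]
      exact mul_le_one₀ hψ1 (norm_nonneg _) ContinuousLinearMap.norm_id_le
    · rw [norm_smul, Real.norm_of_nonneg (by positivity), div_mul_eq_mul_div]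
      exact div_le_div_of_nonneg_right (mul_le_of_le_one_left (norm_nonneg _) hψ1) hq.le
  · rw [norm_smul, norm_div, norm_pow, Real.norm_of_nonneg hq.le, norm_outer, div_mul_eq_mul_div,
      mul_div_assoc]
    refine mul_le_mul_of_nonneg_right ?_ (by positivity)
    rw [Real.norm_eq_abs, abs_le]
    constructor <;> nlinarith [mul_nonneg hd hq.le]

lemma norm_fderiv_regScore_le_logLevel {C : ℝ} (hC1 : 1 ≤ C)
    (hC : ∀ η u : ℝ, 0 < η → 0 ≤ u → deriv (softThreshold η) u * u ≤ C) (hη : 0 < η)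
    (hη1 : η ≤ 1) : ‖fderiv ℝ (regScore μ η) x‖ ≤ (C + 3) * logLevel η := by
  have hL := one_le_logLevel hη hη1
  have hq := mass_pos μ x
  rcases le_or_gt (mass μ x) (η / 2) with h | h
  · rw [fderiv_regScore_of_le_half μ x hη h, norm_zero]; positivity
  · refine (norm_fderiv_regScore_le μ x hC hη).trans ?_
    have h1 : ‖secondMoment μ x‖ / mass μ x ≤ logLevel η :=
      (div_le_div_of_nonneg_right (norm_secondMoment_le μ x) hq.le).trans
        (energy_div_mass_le μ x hη h.le)
    have h2 : ‖drift μ x‖ ^ 2 / mass μ x ^ 2 ≤ logLevel η := by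
      refine le_of_eq_of_le ?_ ((norm_unitScore_sq_le μ x).trans (energy_div_mass_le μ x hη h.le))
      rw [norm_drift_le_norm_unitScore, mul_pow, mul_div_cancel_left₀ _ (by positivity)]
    nlinarith

/-- Jacobian error where the density is above the threshold. -/
lemma norm_fderiv_regScore_sub_le_of_ge {C : ℝ} (hC1 : 1 ≤ C)
    (hC : ∀ η u : ℝ, 0 < η → 0 ≤ u → deriv (softThreshold η) u * u ≤ C) (hη : 0 < η)
    (hη1 : η ≤ 1) (h : 2 * η ≤ mass μ x) :
    ‖fderiv ℝ (regScore ν η) x - fderiv ℝ (unitScore μ) x‖ ≤ 2 * (C + 6) / mass μ x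
      * (‖secondMoment ν x - secondMoment μ x‖ + √(logLevel η) * ‖drift ν x - drift μ x‖
        + logLevel η * |mass ν x - mass μ x|) := by
  have hq := mass_pos μ x
  have hp := mass_pos ν x
  have hL := one_le_logLevel hη hη1
  have hW := energy_div_mass_le μ x hη (by linarith)
  -- The same dichotomy as for the scores: the threshold is inactive, or the deviation of the mass
  -- pays for the crude bounds on both Jacobians.
  rcases le_or_gt (mass μ x / 2) (mass ν x) with h' | h'
  · have hs := norm_unitScore_le μ x hη (by linarith)
    have hs' := norm_unitScore_le ν x hη (by linarith)
    have hd := norm_unitScore_sub_unitScore_le μ ν x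
    have h1 : (mass ν x)⁻¹ ≤ 2 / mass μ x := by
      rw [inv_eq_one_div, div_le_div_iff₀ hp hq]; linarith
    -- Here the threshold equals `1` and its derivative `0`, so both Jacobians are a normalized
    -- second moment minus the identity minus the outer square of the score, and the identities
    -- cancel.
    have hJ : fderiv ℝ (regScore ν η) x - fderiv ℝ (unitScore μ) x
        = (mass ν x)⁻¹ • ((secondMoment ν x - secondMoment μ x)
          - (mass ν x - mass μ x) • ((mass μ x)⁻¹ • secondMoment μ x))
          - (outer (unitScore ν x) - outer (unitScore μ x)) := by
      rw [(hasFDerivAt_regScore ν x hη).fderiv, (hasFDerivAt_unitScore μ x).fderiv,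
        softThreshold_of_le (by linarith), deriv_softThreshold_of_le hη (by linarith),
        unitScore, unitScore, outer_smul, outer_smul]
      ext1 v
      simp only [_root_.add_apply, _root_.smul_apply, _root_.sub_apply,
        ContinuousLinearMap.id_apply]
      match_scalars <;> field_simp <;> ring
    have h2 : ‖(mass ν x)⁻¹ • ((secondMoment ν x - secondMoment μ x)
          - (mass ν x - mass μ x) • ((mass μ x)⁻¹ • secondMoment μ x))‖
        ≤ 2 / mass μ x * (‖secondMoment ν x - secondMoment μ x‖
          + logLevel η * |mass ν x - mass μ x|) := by
      rw [norm_smul, norm_inv, Real.norm_of_nonneg hp.le]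
      refine mul_le_mul h1 ((norm_sub_le _ _).trans (add_le_add le_rfl ?_)) (norm_nonneg _)
        (by positivity)
      rw [norm_smul, Real.norm_eq_abs, mul_comm]
      refine mul_le_mul_of_nonneg_right (le_trans ?_ hW) (abs_nonneg _)
      rw [norm_smul, norm_inv, Real.norm_of_nonneg hq.le, inv_mul_eq_div]
      exact div_le_div_of_nonneg_right (norm_secondMoment_le μ x) hq.le
    have hsq := Real.mul_self_sqrt (zero_le_one.trans hL)
    have hs0 := Real.sqrt_nonneg (logLevel η)
    set r := √(logLevel η)
    set δ0 := |mass ν x - mass μ x|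
    set δ1 := ‖drift ν x - drift μ x‖
    set δ2 := ‖secondMoment ν x - secondMoment μ x‖
    have hδ0 : 0 ≤ δ0 := abs_nonneg _
    have hδ1 : 0 ≤ δ1 := norm_nonneg _
    have hδ2 : 0 ≤ δ2 := norm_nonneg _
    have h3 : ‖outer (unitScore ν x) - outer (unitScore μ x)‖
        ≤ 2 / mass μ x * (δ1 + r * δ0) * (2 * r) := by
      refine (norm_outer_sub_le _ _).trans ?_
      refine mul_le_mul (hd.trans ?_) (by linarith) (by positivity) (by positivity)
      exact mul_le_mul h1 (add_le_add le_rfl (mul_le_mul_of_nonneg_right hs hδ0))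
        (by positivity) (by positivity)
    rw [hJ]
    refine (norm_sub_le _ _).trans ((add_le_add h2 h3).trans ?_)
    have h4 : 2 / mass μ x * (δ2 + logLevel η * δ0) + 2 / mass μ x * (δ1 + r * δ0) * (2 * r)
        = 2 / mass μ x * (δ2 + 2 * (r * δ1) + 3 * (logLevel η * δ0)) := by
      rw [← hsq]; ring
    have h5 : 2 * (C + 6) / mass μ x * (δ2 + r * δ1 + logLevel η * δ0)
        = 2 / mass μ x * ((C + 6) * (δ2 + r * δ1 + logLevel η * δ0)) := by ring
    rw [h4, h5]
    refine mul_le_mul_of_nonneg_left ?_ (by positivity)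
    have e1 : 0 ≤ r * δ1 := by positivity
    have e2 : 0 ≤ logLevel η * δ0 := by positivity
    nlinarith
  · have h1 : mass μ x / 2 ≤ |mass ν x - mass μ x| := by
      rw [abs_sub_comm]; exact le_trans (by linarith) (le_abs_self _)
    have h2 := (norm_sub_le (fderiv ℝ (regScore ν η) x) (fderiv ℝ (unitScore μ) x)).trans
      (add_le_add (norm_fderiv_regScore_le_logLevel ν x hC1 hC hη hη1)
        (norm_fderiv_unitScore_le μ x))
    have h3 : 1 ≤ 2 / mass μ x * |mass ν x - mass μ x| := by
      rw [div_mul_eq_mul_div, le_div_iff₀ hq]; linarith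
    have h4 : 2 * (C + 6) / mass μ x * (‖secondMoment ν x - secondMoment μ x‖
        + √(logLevel η) * ‖drift ν x - drift μ x‖ + logLevel η * |mass ν x - mass μ x|)
        = 2 * (C + 6) / mass μ x * (‖secondMoment ν x - secondMoment μ x‖
        + √(logLevel η) * ‖drift ν x - drift μ x‖)
        + (C + 6) * logLevel η * (2 / mass μ x * |mass ν x - mass μ x|) := by ring
    rw [h4]
    have h5 : 0 ≤ 2 * (C + 6) / mass μ x * (‖secondMoment ν x - secondMoment μ x‖
        + √(logLevel η) * ‖drift ν x - drift μ x‖) := by positivity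
    have h6 : (C + 6) * logLevel η
        ≤ (C + 6) * logLevel η * (2 / mass μ x * |mass ν x - mass μ x|) :=
      le_mul_of_one_le_right (by positivity) h3
    nlinarith

/-- Jacobian error where the density is below the threshold. -/
lemma norm_fderiv_regScore_sub_le_of_lt {C : ℝ} (hC1 : 1 ≤ C)
    (hC : ∀ η u : ℝ, 0 < η → 0 ≤ u → deriv (softThreshold η) u * u ≤ C) (hη : 0 < η)
    (h : mass μ x < 2 * η) :
    ‖fderiv ℝ (regScore ν η) x - fderiv ℝ (unitScore μ) x‖ ≤ 40 * (C + 1)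
      * (1 + energy μ x / mass μ x + (‖secondMoment ν x - secondMoment μ x‖ ^ 2
        + ‖drift ν x - drift μ x‖ ^ 2) / η ^ 2) := by
  have hq := mass_pos μ x
  have hp := mass_pos ν x
  have hW0 : 0 ≤ energy μ x / mass μ x := div_nonneg (energy_nonneg μ x) hq.le
  have hm := norm_unitScore_sq_le μ x
  have hs := norm_fderiv_unitScore_le μ x
  set δ1 := ‖drift ν x - drift μ x‖ with hδ1
  set δ2 := ‖secondMoment ν x - secondMoment μ x‖ with hδ2
  set w := energy μ x / mass μ x with hw
  -- Below the threshold the linear fluctuation is traded for a constant plus a square, since only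
  -- variances are available and the constant contributes no more than a multiple of the mass.
  have hd2 : 2 * (δ2 / η) ≤ 1 + (δ2 / η) ^ 2 := by nlinarith [sq_nonneg (δ2 / η - 1)]
  have key : ‖fderiv ℝ (regScore ν η) x‖
      ≤ 1 + (2 * (δ2 / η) + 4 * w) + (C + 1) * (8 * (δ1 / η) ^ 2 + 32 * w) := by
    rcases le_or_gt (mass ν x) (η / 2) with h' | h'
    · rw [fderiv_regScore_of_le_half ν x hη h', norm_zero]; positivity
    refine (norm_fderiv_regScore_le ν x hC hη).trans ?_
    have h1 : (mass ν x)⁻¹ ≤ 2 / η := by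
      rw [inv_eq_one_div, div_le_div_iff₀ hp hη]; linarith
    have h2 : ‖secondMoment ν x‖ / mass ν x ≤ 2 * (δ2 / η) + 4 * w := by
      have e1 : ‖secondMoment ν x‖ ≤ δ2 + 2 * η * w := by
        refine (norm_le_norm_sub_add _ (secondMoment μ x)).trans (add_le_add le_rfl ?_)
        refine (norm_secondMoment_le μ x).trans ?_
        rw [hw, mul_div_assoc', le_div_iff₀ hq, mul_comm]
        exact mul_le_mul_of_nonneg_right h.le (energy_nonneg μ x)
      rw [div_eq_inv_mul]
      refine (mul_le_mul h1 e1 (norm_nonneg _) (by positivity)).trans_eq ?_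
      field_simp; ring
    have h3 : ‖drift ν x‖ ^ 2 / mass ν x ^ 2 ≤ 8 * (δ1 / η) ^ 2 + 32 * w := by
      rw [← div_pow]
      have e1 : ‖drift ν x‖ ≤ δ1 + 2 * η * ‖unitScore μ x‖ := by
        refine (norm_le_norm_sub_add _ (drift μ x)).trans (add_le_add le_rfl ?_)
        rw [norm_drift_le_norm_unitScore]
        exact mul_le_mul_of_nonneg_right h.le (norm_nonneg _)
      have e2 : ‖drift ν x‖ / mass ν x ≤ 2 * (δ1 / η) + 4 * ‖unitScore μ x‖ := by
        rw [div_eq_inv_mul]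
        refine (mul_le_mul h1 e1 (norm_nonneg _) (by positivity)).trans_eq ?_
        field_simp; ring
      refine (pow_le_pow_left₀ (by positivity) e2 2).trans ?_
      nlinarith [sq_nonneg (2 * (δ1 / η) - 4 * ‖unitScore μ x‖)]
    have h4 : (C + 1) * (‖drift ν x‖ ^ 2 / mass ν x ^ 2)
        ≤ (C + 1) * (8 * (δ1 / η) ^ 2 + 32 * w) := mul_le_mul_of_nonneg_left h3 (by linarith)
    linarith
  refine (norm_sub_le _ _).trans ((add_le_add key hs).trans ?_)
  rw [add_div, ← div_pow, ← div_pow]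
  nlinarith [sq_nonneg (δ1 / η), sq_nonneg (δ2 / η), mul_nonneg (by linarith : 0 ≤ C) hW0,
    mul_nonneg (by linarith : 0 ≤ C) (sq_nonneg (δ1 / η)),
    mul_nonneg (by linarith : 0 ≤ C) (sq_nonneg (δ2 / η))]

end perturbation

/-! ### Sampling fluctuations -/

/-- The empirical measure of a sample. -/
def empirical {d n : ℕ} (data : Fin n → Vec d) : Measure (Vec d) :=
  (n : ℝ≥0∞)⁻¹ • ∑ i, Measure.dirac (data i)

lemma isProbabilityMeasure_empirical {d n : ℕ} (hn : n ≠ 0) (data : Fin n → Vec d) :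
    IsProbabilityMeasure (empirical data) := by
  refine ⟨?_⟩
  simp [empirical, ENNReal.inv_mul_cancel (Nat.cast_ne_zero.2 hn) (ENNReal.natCast_ne_top n)]

lemma blur_empirical {d n : ℕ} {F : Type*} [NormedAddCommGroup F] [NormedSpace ℝ F]
    [CompleteSpace F] (data : Fin n → Vec d) (f : Vec d → F) (x : Vec d) :
    blur (empirical data) f x = (1 / (n : ℝ)) • ∑ i, f (x - data i) := by
  unfold blur empirical
  rw [integral_smul_measure, integral_finsetSum_measure]
  · simp [integral_dirac]
  · intro i _
    exact integrable_dirac (by simp)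

lemma blur_clm_comp {d : ℕ} {F : Type*} [NormedAddCommGroup F] [NormedSpace ℝ F]
    [CompleteSpace F] (μ : Measure (Vec d)) [IsFiniteMeasure μ] (L : F →L[ℝ] ℝ) {f : Vec d → F}
    (hf : Continuous f) {C : ℝ} (hC : ∀ z, ‖f z‖ ≤ C) (x : Vec d) :
    L (blur μ f x) = blur μ (fun z => L (f z)) x :=
  (L.integral_comp_comm (integrable_comp_sub hf hC x)).symm

section fluctuation

variable {d n : ℕ}

/-- The empirical blur is the average of `n` independent copies of `f (x - Y)`, whose mean is the
population blur; its variance is `1/n` times that of one copy, hence at most `1/n` times the second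
moment. -/
lemma integral_empirical_sub_sq_le (hn : n ≠ 0) (μ : Measure (Vec d)) [IsProbabilityMeasure μ]
    (x : Vec d) {f : Vec d → ℝ} (hf : Continuous f) {C : ℝ}
    (hC : ∀ z, ‖f z‖ ≤ C) :
    ∫ data, (blur (empirical data) f x - blur μ f x) ^ 2 ∂(Measure.pi fun _ : Fin n => μ)
      ≤ 1 / (n : ℝ) * blur μ (fun z => f z ^ 2) x := by
  have hn' : (0 : ℝ) < n := by exact_mod_cast Nat.pos_of_ne_zero hn
  set X : Vec d → ℝ := fun y => f (x - y) with hX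
  have hXc : Continuous X := hf.comp (by fun_prop)
  have hmem : MemLp X 2 μ :=
    MemLp.of_bound hXc.aestronglyMeasurable C (.of_forall fun y => hC _)
  have hv := variance_sum_pi (μ := fun _ : Fin n => μ) (X := fun _ => X) (fun _ => hmem)
  have hsum : (∑ i : Fin n, fun ω : Fin n → Vec d => X (ω i)) = fun ω => ∑ i, X (ω i) := by
    ext ω; simp
  have hE : ∫ ω, ∑ i, X (ω i) ∂(Measure.pi fun _ : Fin n => μ) = n * blur μ f x := by
    rw [integral_finsetSum]
    · have h1 : ∀ i : Fin n, ∫ ω, X (ω i) ∂(Measure.pi fun _ : Fin n => μ) = blur μ f x :=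
        fun i => integral_comp_eval (μ := fun _ : Fin n => μ) (i := i) (f := X)
          hXc.aestronglyMeasurable
      simp [h1]
    · intro i _
      exact (hmem.comp_measurePreserving
        (measurePreserving_eval (fun _ : Fin n => μ) i)).integrable (by norm_num)
  have hcont : Continuous fun ω : Fin n → Vec d => ∑ i, X (ω i) := by fun_prop
  rw [hsum, variance_eq_integral hcont.aemeasurable, hE] at hv
  have h2 : Var[X; μ] ≤ blur μ (fun z => f z ^ 2) x :=
    variance_le_expectation_sq hXc.aestronglyMeasurable
  have h3 : ∀ ω : Fin n → Vec d, (blur (empirical ω) f x - blur μ f x) ^ 2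
      = (1 / (n : ℝ)) ^ 2 * (∑ i, X (ω i) - n * blur μ f x) ^ 2 := fun ω => by
    rw [blur_empirical, smul_eq_mul, ← mul_pow]
    congr 1
    rw [mul_sub, hX]
    field_simp
  simp only [h3]
  rw [integral_const_mul, hv, Finset.sum_const, Finset.card_univ, Fintype.card_fin, nsmul_eq_mul]
  calc (1 / (n : ℝ)) ^ 2 * (n * Var[X; μ]) = 1 / n * Var[X; μ] := by field_simp
    _ ≤ _ := mul_le_mul_of_nonneg_left h2 (by positivity)

lemma continuous_blur_empirical {F : Type*} [NormedAddCommGroup F] [NormedSpace ℝ F]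
    [CompleteSpace F] {f : Vec d → F} (hf : Continuous f) :
    Continuous fun z : (Fin n → Vec d) × Vec d => blur (empirical z.1) f z.2 := by
  simp only [blur_empirical]
  fun_prop

lemma norm_blur_le (μ : Measure (Vec d)) [IsProbabilityMeasure μ] (x : Vec d)
    {F : Type*} [NormedAddCommGroup F] [NormedSpace ℝ F] {f : Vec d → F} {C : ℝ}
    (hC : ∀ z, ‖f z‖ ≤ C) : ‖blur μ f x‖ ≤ C := by
  simpa [blur] using norm_integral_le_of_norm_le_const (μ := μ) (.of_forall fun y => hC (x - y))

lemma integrable_empirical_sub_sq (hn : n ≠ 0) (μ : Measure (Vec d)) [IsProbabilityMeasure μ]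
    (x : Vec d) {F : Type*} [NormedAddCommGroup F] [NormedSpace ℝ F]
    [CompleteSpace F] {f : Vec d → F} (hf : Continuous f) {C : ℝ} (hC : ∀ z, ‖f z‖ ≤ C) :
    Integrable (fun data => ‖blur (empirical data) f x - blur μ f x‖ ^ 2)
      (Measure.pi fun _ : Fin n => μ) := by
  refine Integrable.of_bound (C := (C + C) ^ 2) ?_ (.of_forall fun data => ?_)
  · have := (continuous_blur_empirical (n := n) hf).comp (Continuous.prodMk_left x)
    exact ((this.sub continuous_const).norm.pow 2).aestronglyMeasurable
  · have := isProbabilityMeasure_empirical hn data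
    rw [norm_pow, norm_norm]
    exact pow_le_pow_left₀ (norm_nonneg _) ((norm_sub_le _ _).trans
      (add_le_add (norm_blur_le _ x hC) (norm_blur_le μ x hC))) 2

/-- Mean squared fluctuation of a finite family of statistics dominated by the kernel. -/
lemma integral_sum_empirical_sub_sq_le (hn : n ≠ 0) (μ : Measure (Vec d)) [IsProbabilityMeasure μ]
    (x : Vec d) {ι : Type*} [Fintype ι] {f : ι → Vec d → ℝ}
    (hf : ∀ a, Continuous (f a)) {c : ℝ} (hc : ∀ z, ∑ a, f a z ^ 2 ≤ c * bump z) :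
    ∫ data, ∑ a, (blur (empirical data) (f a) x - blur μ (f a) x) ^ 2
      ∂(Measure.pi fun _ : Fin n => μ) ≤ c * (mass μ x / n) := by
  have hn' : (0 : ℝ) < n := by exact_mod_cast Nat.pos_of_ne_zero hn
  have hc0 : 0 ≤ c := by
    have h1 : 0 ≤ c * bump (0 : Vec d) :=
      (Finset.sum_nonneg fun a _ => sq_nonneg _).trans (hc 0)
    exact nonneg_of_mul_nonneg_left h1 (bump_pos _)
  have hb2 : ∀ a z, f a z ^ 2 ≤ c := fun a z =>
    (Finset.single_le_sum (f := fun a => f a z ^ 2) (fun _ _ => sq_nonneg _)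
      (Finset.mem_univ a)).trans ((hc z).trans (mul_le_of_le_one_right hc0 (bump_le_one z)))
  have hb : ∀ a z, ‖f a z‖ ≤ √c := fun a z =>
    Real.le_sqrt_of_sq_le (by rw [Real.norm_eq_abs, sq_abs]; exact hb2 a z)
  have hi : ∀ a, Integrable (fun data => (blur (empirical data) (f a) x - blur μ (f a) x) ^ 2)
      (Measure.pi fun _ : Fin n => μ) := fun a => by
    simpa using integrable_empirical_sub_sq hn μ x (hf a) (hb a)
  rw [integral_finsetSum _ fun a _ => hi a]
  calc _ ≤ ∑ a, 1 / (n : ℝ) * blur μ (fun z => f a z ^ 2) x :=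
        Finset.sum_le_sum fun a _ => integral_empirical_sub_sq_le hn μ x (hf a) (hb a)
    _ = 1 / (n : ℝ) * ∫ y, ∑ a, f a (x - y) ^ 2 ∂μ := by
        rw [← Finset.mul_sum, integral_finsetSum]
        · rfl
        · intro a _
          refine integrable_comp_sub (f := fun z => f a z ^ 2) ((hf a).pow 2) (C := c)
            (fun z => ?_) x
          rw [Real.norm_of_nonneg (sq_nonneg _)]; exact hb2 a z
    _ ≤ 1 / (n : ℝ) * ∫ y, c * bump (x - y) ∂μ := by
        refine mul_le_mul_of_nonneg_left (integral_mono_of_nonneg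
          (.of_forall fun y => Finset.sum_nonneg fun a _ => sq_nonneg _)
          ((integrable_comp_sub continuous_bump norm_bump_le x).const_mul c)
          (.of_forall fun y => hc _)) (by positivity)
    _ = c * (mass μ x / n) := by
        rw [integral_const_mul]
        change 1 / (n : ℝ) * (c * mass μ x) = _
        ring

lemma integral_mass_sub_sq_le (hn : n ≠ 0) (μ : Measure (Vec d)) [IsProbabilityMeasure μ]
    (x : Vec d) :
    ∫ data, (mass (empirical data) x - mass μ x) ^ 2 ∂(Measure.pi fun _ : Fin n => μ)
      ≤ mass μ x / n := by
  have := integral_sum_empirical_sub_sq_le hn μ x (ι := Unit) (f := fun _ => bump) (c := 1)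
    (fun _ => continuous_bump) (fun z => by
      have := bump_le_one z
      have := bump_pos z
      simp only [Finset.univ_unique, Finset.sum_const, Finset.card_singleton, one_smul]
      nlinarith)
  simpa [mass] using this

lemma integral_drift_sub_sq_le (hn : n ≠ 0) (μ : Measure (Vec d)) [IsProbabilityMeasure μ]
    (x : Vec d) :
    ∫ data, ‖drift (empirical data) x - drift μ x‖ ^ 2 ∂(Measure.pi fun _ : Fin n => μ)
      ≤ mass μ x / n := by
  have hL : ∀ j (z : Vec d), EuclideanSpace.proj (𝕜 := ℝ) j (-(bump z • z)) = -(bump z * z j) :=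
    fun j z => by simp
  have h := integral_sum_empirical_sub_sq_le hn μ x (ι := Fin d)
    (f := fun j z => -(bump z * z j)) (c := 1)
    (fun j => (continuous_bump.mul (by fun_prop)).neg) (fun z => by
      have h1 := bump_mul_sq_le_one z
      have h2 := bump_pos z
      simp only [neg_sq, mul_pow]
      rw [← Finset.mul_sum]
      have : ‖z‖ ^ 2 = ∑ j, z j ^ 2 := by simp [EuclideanSpace.norm_sq_eq]
      rw [← this]
      nlinarith)
  rw [one_mul] at h
  refine le_of_eq_of_le (integral_congr_ae (.of_forall fun data => ?_)) h
  have := isProbabilityMeasure_empirical hn data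
  simp only [EuclideanSpace.norm_sq_eq, Real.norm_eq_abs, sq_abs]
  refine Finset.sum_congr rfl fun j _ => ?_
  have h1 := blur_clm_comp (empirical data) (EuclideanSpace.proj (𝕜 := ℝ) j)
    continuous_bump_smul norm_bump_smul_le x
  have h2 := blur_clm_comp μ (EuclideanSpace.proj (𝕜 := ℝ) j)
    continuous_bump_smul norm_bump_smul_le x
  simp only [hL] at h1 h2
  rw [← h1, ← h2]
  rfl

/-- The Frobenius norm dominates the operator norm, which turns the operator-valued fluctuation into
scalar variances. Nothing is lost in dimension, because the squared entries of `bump z • outer z`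
sum to `bump z ^ 2 * ‖z‖ ^ 4`. -/
lemma norm_sq_le_sum_entries {d : ℕ} (A : Vec d →L[ℝ] Vec d) :
    ‖A‖ ^ 2 ≤ ∑ a : Fin d × Fin d, (A (EuclideanSpace.single a.1 1) a.2) ^ 2 := by
  set S := ∑ a : Fin d × Fin d, (A (EuclideanSpace.single a.1 1) a.2) ^ 2 with hS
  have hS0 : 0 ≤ S := Finset.sum_nonneg fun a _ => sq_nonneg _
  have h : ‖A‖ ≤ √S := by
    refine A.opNorm_le_bound (Real.sqrt_nonneg _) fun v => ?_
    refine abs_le_of_sq_le_sq' ?_ (by positivity) |>.2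
    rw [mul_pow, Real.sq_sqrt hS0, EuclideanSpace.norm_sq_eq]
    have hv : v = ∑ j, v j • EuclideanSpace.single j (1 : ℝ) := by
      ext k
      simp [Finset.sum_apply, Pi.single_apply]
    have hA : ∀ k, A v k = ∑ j, v j * A (EuclideanSpace.single j 1) k := fun k => by
      conv_lhs => rw [hv, map_sum]
      simp
    rw [hS, Fintype.sum_prod_type, Finset.sum_comm, Finset.sum_mul]
    refine Finset.sum_le_sum fun k _ => ?_
    rw [Real.norm_eq_abs, sq_abs, hA]
    refine (Finset.sum_mul_sq_le_sq_mul_sq _ _ _).trans_eq ?_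
    rw [mul_comm]
    congr 1
    simp [EuclideanSpace.norm_sq_eq]
  calc ‖A‖ ^ 2 ≤ √S ^ 2 := pow_le_pow_left₀ (norm_nonneg _) h 2
    _ = S := Real.sq_sqrt hS0

lemma integral_secondMoment_sub_sq_le (hn : n ≠ 0) (μ : Measure (Vec d)) [IsProbabilityMeasure μ]
    (x : Vec d) :
    ∫ data, ‖secondMoment (empirical data) x - secondMoment μ x‖ ^ 2
      ∂(Measure.pi fun _ : Fin n => μ) ≤ 4 * (mass μ x / n) := by
  let L : Fin d × Fin d → (Vec d →L[ℝ] Vec d) →L[ℝ] ℝ := fun a =>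
    (EuclideanSpace.proj (𝕜 := ℝ) a.2).comp
      (ContinuousLinearMap.apply ℝ (Vec d) (EuclideanSpace.single a.1 1))
  have hLA : ∀ a (A : Vec d →L[ℝ] Vec d), L a A = A (EuclideanSpace.single a.1 1) a.2 :=
    fun a A => rfl
  have hL : ∀ a (z : Vec d), L a (bump z • outer z) = bump z * (z a.1 * z a.2) :=
    fun a z => by
      rw [hLA]
      simp [outer_apply, EuclideanSpace.inner_single_right]
  have hbound : ∀ z : Vec d, ∑ a : Fin d × Fin d, (bump z * (z a.1 * z a.2)) ^ 2 ≤ 4 * bump z :=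
    fun z => by
      have h1 := bump_mul_pow_four_le z
      have h2 := bump_pos z
      simp only [mul_pow]
      rw [← Finset.mul_sum, Fintype.sum_prod_type]
      simp only [← Finset.mul_sum, ← Finset.sum_mul]
      have : ‖z‖ ^ 2 = ∑ j, z j ^ 2 := by simp [EuclideanSpace.norm_sq_eq]
      rw [← this]
      nlinarith
  have h := integral_sum_empirical_sub_sq_le hn μ x (ι := Fin d × Fin d)
    (f := fun a z => bump z * (z a.1 * z a.2)) (c := 4)
    (fun j => (continuous_bump.mul (by fun_prop))) hbound
  have hi : Integrable (fun data => ∑ a : Fin d × Fin d,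
      (blur (empirical data) (fun z => bump z * (z a.1 * z a.2)) x
        - blur μ (fun z => bump z * (z a.1 * z a.2)) x) ^ 2) (Measure.pi fun _ : Fin n => μ) := by
    refine integrable_finsetSum _ fun a _ => ?_
    have := integrable_empirical_sub_sq hn μ x (f := fun z : Vec d => bump z * (z a.1 * z a.2))
      (C := 2) (continuous_bump.mul (by fun_prop)) (fun z => by
        refine abs_le_of_sq_le_sq ?_ (by norm_num)
        have h1 := Finset.single_le_sum (f := fun a : Fin d × Fin d =>
          (bump z * (z a.1 * z a.2)) ^ 2) (fun _ _ => sq_nonneg _) (Finset.mem_univ a)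
        have h2 := hbound z
        have h3 := bump_le_one z
        simp only at h1
        linarith)
    simpa using this
  refine le_trans (integral_mono_of_nonneg (.of_forall fun data => sq_nonneg _) hi
    (.of_forall fun data => ?_)) h
  have := isProbabilityMeasure_empirical hn data
  refine (norm_sq_le_sum_entries _).trans_eq (Finset.sum_congr rfl fun a _ => ?_)
  have h1 := blur_clm_comp (empirical data) (L a)
    continuous_bump_smul_outer norm_bump_smul_outer_le x
  have h2 := blur_clm_comp μ (L a) continuous_bump_smul_outer norm_bump_smul_outer_le x
  simp only [hL] at h1 h2
  rw [← h1, ← h2]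
  rfl

end fluctuation

/-! ### Mean errors at a point -/

/-- Only the majorant is integrated, so `X` need not be measurable. The three slots receive the
squared fluctuations of mass, drift and second moment; an absent one gets coefficient zero and a
repeated entry. -/
lemma lintegral_ofReal_le_of_le {Ω : Type*} [MeasurableSpace Ω] {P : Measure Ω}
    [IsProbabilityMeasure P] {X D₀ D₁ D₂ : Ω → ℝ} {c a₀ a₁ a₂ b₀ b₁ b₂ : ℝ}
    (ha₀ : 0 ≤ a₀) (ha₁ : 0 ≤ a₁) (ha₂ : 0 ≤ a₂) (hX : ∀ ω, 0 ≤ X ω)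
    (hXB : ∀ ω, X ω ≤ c + (a₀ * D₀ ω + (a₁ * D₁ ω + a₂ * D₂ ω)))
    (i₀ : Integrable D₀ P) (i₁ : Integrable D₁ P) (i₂ : Integrable D₂ P)
    (h₀ : ∫ ω, D₀ ω ∂P ≤ b₀) (h₁ : ∫ ω, D₁ ω ∂P ≤ b₁) (h₂ : ∫ ω, D₂ ω ∂P ≤ b₂) :
    ∫⁻ ω, ENNReal.ofReal (X ω) ∂P
      ≤ ENNReal.ofReal (c + (a₀ * b₀ + (a₁ * b₁ + a₂ * b₂))) := by
  have j₁₂ : Integrable (fun ω => a₁ * D₁ ω + a₂ * D₂ ω) P :=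
    (i₁.const_mul a₁).add (i₂.const_mul a₂)
  have j : Integrable (fun ω => a₀ * D₀ ω + (a₁ * D₁ ω + a₂ * D₂ ω)) P :=
    (i₀.const_mul a₀).add j₁₂
  have hB : Integrable (fun ω => c + (a₀ * D₀ ω + (a₁ * D₁ ω + a₂ * D₂ ω))) P :=
    (integrable_const c).add j
  calc ∫⁻ ω, ENNReal.ofReal (X ω) ∂P
      ≤ ∫⁻ ω, ENNReal.ofReal (c + (a₀ * D₀ ω + (a₁ * D₁ ω + a₂ * D₂ ω))) ∂P :=
        lintegral_mono fun ω => ENNReal.ofReal_le_ofReal (hXB ω)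
    _ = ENNReal.ofReal (∫ ω, (c + (a₀ * D₀ ω + (a₁ * D₁ ω + a₂ * D₂ ω))) ∂P) :=
        (ofReal_integral_eq_lintegral_ofReal hB (.of_forall fun ω => (hX ω).trans (hXB ω))).symm
    _ ≤ _ := by
        refine ENNReal.ofReal_le_ofReal ?_
        rw [integral_add (integrable_const c) j, integral_add (i₀.const_mul a₀) j₁₂,
          integral_add (i₁.const_mul a₁) (i₂.const_mul a₂), integral_const_mul,
          integral_const_mul, integral_const_mul]
        simp only [integral_const, probReal_univ, one_smul]
        gcongr

lemma enorm_sq_eq_ofReal {E : Type*} [SeminormedAddGroup E] (v : E) :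
    ‖v‖ₑ ^ 2 = ENNReal.ofReal (‖v‖ ^ 2) := by
  rw [← ofReal_norm, ENNReal.ofReal_pow (norm_nonneg _)]

section pointwise

variable {d n : ℕ}

lemma integrable_mass_sub_sq (hn : n ≠ 0) (μ : Measure (Vec d)) [IsProbabilityMeasure μ]
    (x : Vec d) :
    Integrable (fun data => (mass (empirical data) x - mass μ x) ^ 2)
      (Measure.pi fun _ : Fin n => μ) := by
  simpa [mass] using integrable_empirical_sub_sq hn μ x continuous_bump norm_bump_le

lemma integrable_drift_sub_sq (hn : n ≠ 0) (μ : Measure (Vec d)) [IsProbabilityMeasure μ]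
    (x : Vec d) :
    Integrable (fun data => ‖drift (empirical data) x - drift μ x‖ ^ 2)
      (Measure.pi fun _ : Fin n => μ) :=
  integrable_empirical_sub_sq hn μ x continuous_bump_smul norm_bump_smul_le

lemma integrable_secondMoment_sub_sq (hn : n ≠ 0) (μ : Measure (Vec d)) [IsProbabilityMeasure μ]
    (x : Vec d) :
    Integrable (fun data => ‖secondMoment (empirical data) x - secondMoment μ x‖ ^ 2)
      (Measure.pi fun _ : Fin n => μ) :=
  integrable_empirical_sub_sq hn μ x continuous_bump_smul_outer norm_bump_smul_outer_le

/-- The weight `mass μ x` is the density of the point up to normalization. It multiplies a factor `1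
/ mass²` and a variance `mass / n`, and the three cancel to `1 / n`; the contribution of this region
is thus governed by its volume. -/
lemma mass_mul_lintegral_score_le_of_ge (hn : n ≠ 0) (μ : Measure (Vec d)) [IsProbabilityMeasure μ]
    (x : Vec d) {η : ℝ} (hη : 0 < η) (h : 2 * η ≤ mass μ x) :
    ENNReal.ofReal (mass μ x) * ∫⁻ data, ‖regScore (empirical data) η x - unitScore μ x‖ₑ ^ 2
      ∂(Measure.pi fun _ : Fin n => μ) ≤ ENNReal.ofReal (8 * (1 + 4 * logLevel η) / n) := by
  have hq := mass_pos μ x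
  have hn' : (0 : ℝ) < n := by exact_mod_cast Nat.pos_of_ne_zero hn
  have hL0 : 0 ≤ logLevel η :=
    (div_nonneg (energy_nonneg μ x) hq.le).trans (energy_div_mass_le μ x hη (by linarith))
  have i0 := integrable_mass_sub_sq hn μ x
  have i1 := integrable_drift_sub_sq hn μ x
  have e0 := integral_mass_sub_sq_le hn μ x
  have e1 := integral_drift_sub_sq_le hn μ x
  simp only [enorm_sq_eq_ofReal]
  have key := lintegral_ofReal_le_of_le (P := Measure.pi fun _ : Fin n => μ)
    (X := fun data => ‖regScore (empirical data) η x - unitScore μ x‖ ^ 2)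
    (c := 0) (a₀ := 8 / mass μ x ^ 2 * (4 * logLevel η)) (a₁ := 8 / mass μ x ^ 2) (a₂ := 0)
    (by positivity) (by positivity) le_rfl (fun _ => sq_nonneg _) (fun data => by
      have := isProbabilityMeasure_empirical hn data
      refine (norm_regScore_sub_sq_le_of_ge μ _ x hη h).trans_eq ?_
      ring) i0 i1 i1 e0 e1 e1
  refine (mul_le_mul_right key _).trans_eq ?_
  rw [← ENNReal.ofReal_mul hq.le]
  congr 1
  field_simp
  ring

/-- From `mass < 2η` and `nη ≥ 1/2`, the relative variance `mass / (n η²)` is at most `4`, so the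
fluctuations cost only a multiple of the mass: `32 = 8 * 4`. -/
lemma mass_mul_lintegral_score_le_of_lt (hn : n ≠ 0) (μ : Measure (Vec d)) [IsProbabilityMeasure μ]
    (x : Vec d) {η : ℝ} (hη : 0 < η) (hnη : 1 / 2 ≤ n * η)
    (h : mass μ x < 2 * η) :
    ENNReal.ofReal (mass μ x) * ∫⁻ data, ‖regScore (empirical data) η x - unitScore μ x‖ₑ ^ 2
      ∂(Measure.pi fun _ : Fin n => μ) ≤ ENNReal.ofReal (50 * energy μ x + 32 * mass μ x) := by
  have hq := mass_pos μ x
  have hn' : (0 : ℝ) < n := by exact_mod_cast Nat.pos_of_ne_zero hn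
  have i1 := integrable_drift_sub_sq hn μ x
  have e1 := integral_drift_sub_sq_le hn μ x
  simp only [enorm_sq_eq_ofReal]
  have key := lintegral_ofReal_le_of_le (P := Measure.pi fun _ : Fin n => μ)
    (X := fun data => ‖regScore (empirical data) η x - unitScore μ x‖ ^ 2)
    (c := 50 * (energy μ x / mass μ x)) (a₀ := 8 / η ^ 2) (a₁ := 0) (a₂ := 0)
    (by positivity) le_rfl le_rfl (fun _ => sq_nonneg _) (fun data => by
      have := isProbabilityMeasure_empirical hn data
      refine (norm_regScore_sub_sq_le_of_lt μ _ x hη h).trans_eq ?_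
      ring) i1 i1 i1 e1 e1 e1
  refine (mul_le_mul_right key _).trans ?_
  rw [← ENNReal.ofReal_mul hq.le]
  refine ENNReal.ofReal_le_ofReal ?_
  have h1 : mass μ x * (50 * (energy μ x / mass μ x)
      + (8 / η ^ 2 * (mass μ x / n) + (0 * (mass μ x / n) + 0 * (mass μ x / n))))
      = 50 * energy μ x + mass μ x * (8 * (mass μ x / (η * (n * η)))) := by field_simp; ring
  rw [h1]
  have h2 : mass μ x / (η * (n * η)) ≤ 4 := by
    rw [div_le_iff₀ (by positivity)]
    nlinarith
  nlinarith

/-- The Jacobian error is linear in the fluctuations, which are of size `√(mass / n)` and carry one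
factor `1 / mass`; the weight removes that factor. -/
lemma mass_mul_lintegral_jacobian_le_of_ge (hn : n ≠ 0) (μ : Measure (Vec d))
    [IsProbabilityMeasure μ] (x : Vec d) {η : ℝ} {C : ℝ} (hC1 : 1 ≤ C)
    (hC : ∀ η u : ℝ, 0 < η → 0 ≤ u → deriv (softThreshold η) u * u ≤ C) (hη : 0 < η)
    (hη1 : η ≤ 1) (h : 2 * η ≤ mass μ x) :
    ENNReal.ofReal (mass μ x) * ∫⁻ data,
      ‖fderiv ℝ (regScore (empirical data) η) x - fderiv ℝ (unitScore μ) x‖ₑ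
      ∂(Measure.pi fun _ : Fin n => μ)
      ≤ ENNReal.ofReal (18 * (C + 6) * logLevel η * √(mass μ x / n)) := by
  have hq := mass_pos μ x
  have hn' : (0 : ℝ) < n := by exact_mod_cast Nat.pos_of_ne_zero hn
  have hL := one_le_logLevel hη hη1
  have i0 := integrable_mass_sub_sq hn μ x
  have i1 := integrable_drift_sub_sq hn μ x
  have i2 := integrable_secondMoment_sub_sq hn μ x
  have e0 := integral_mass_sub_sq_le hn μ x
  have e1 := integral_drift_sub_sq_le hn μ x
  have e2 := integral_secondMoment_sub_sq_le hn μ x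
  have hκ : 0 < √(mass μ x / n) := Real.sqrt_pos.2 (by positivity)
  have hκ2 : mass μ x / n = √(mass μ x / n) * √(mass μ x / n) :=
    (Real.mul_self_sqrt (by positivity)).symm
  rw [hκ2] at e0 e1 e2
  set κ := √(mass μ x / n)
  set r := √(logLevel η) with hr
  have hr0 : 0 ≤ r := Real.sqrt_nonneg _
  have hrL : r ≤ logLevel η := by
    rw [hr, Real.sqrt_le_left (by linarith)]; nlinarith
  -- Turns the variance bounds into first moment bounds: with `κ` of the order of the standard
  -- deviation, both terms have mean of order `κ`.
  have amgm : ∀ t : ℝ, t ≤ κ + t ^ 2 / κ := fun t => by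
    rw [← sub_le_iff_le_add', le_div_iff₀ hκ]; nlinarith [sq_nonneg (t - κ), sq_nonneg t]
  simp only [← ofReal_norm]
  have hA : 0 ≤ 2 * (C + 6) / mass μ x := div_nonneg (by linarith) hq.le
  have key := lintegral_ofReal_le_of_le (P := Measure.pi fun _ : Fin n => μ)
    (X := fun data => ‖fderiv ℝ (regScore (empirical data) η) x - fderiv ℝ (unitScore μ) x‖)
    (c := 2 * (C + 6) / mass μ x * ((1 + r + logLevel η) * κ))
    (a₀ := 2 * (C + 6) / mass μ x * (logLevel η / κ)) (a₁ := 2 * (C + 6) / mass μ x * (r / κ))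
    (a₂ := 2 * (C + 6) / mass μ x / κ) (by positivity) (by positivity) (by positivity)
    (fun _ => norm_nonneg _) (fun data => by
      have := isProbabilityMeasure_empirical hn data
      refine (norm_fderiv_regScore_sub_le_of_ge μ (empirical data) x hC1 hC hη hη1 h).trans ?_
      have a2 := amgm ‖secondMoment (empirical data) x - secondMoment μ x‖
      have a1 := mul_le_mul_of_nonneg_left (amgm ‖drift (empirical data) x - drift μ x‖) hr0
      have a0 := mul_le_mul_of_nonneg_left (amgm |mass (empirical data) x - mass μ x|)
        (zero_le_one.trans hL)
      rw [sq_abs] at a0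
      rw [← hr]
      refine (mul_le_mul_of_nonneg_left (add_le_add (add_le_add a2 a1) a0) hA).trans_eq ?_
      ring) i0 i1 i2 e0 e1 e2
  refine (mul_le_mul_right key _).trans ?_
  rw [← ENNReal.ofReal_mul hq.le]
  refine ENNReal.ofReal_le_ofReal ?_
  have h1 : mass μ x * (2 * (C + 6) / mass μ x * ((1 + r + logLevel η) * κ)
      + (2 * (C + 6) / mass μ x * (logLevel η / κ) * (κ * κ)
        + (2 * (C + 6) / mass μ x * (r / κ) * (κ * κ)
          + 2 * (C + 6) / mass μ x / κ * (4 * (κ * κ)))))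
      = 2 * (C + 6) * κ * (5 + 2 * r + 2 * logLevel η) := by field_simp; ring
  rw [h1]
  have h2 : 5 + 2 * r + 2 * logLevel η ≤ 9 * logLevel η := by linarith
  calc 2 * (C + 6) * κ * (5 + 2 * r + 2 * logLevel η)
      ≤ 2 * (C + 6) * κ * (9 * logLevel η) :=
        mul_le_mul_of_nonneg_left h2 (by positivity)
    _ = _ := by ring

lemma mass_mul_lintegral_jacobian_le_of_lt (hn : n ≠ 0) (μ : Measure (Vec d))
    [IsProbabilityMeasure μ] (x : Vec d) {η : ℝ} {C : ℝ} (hC1 : 1 ≤ C)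
    (hC : ∀ η u : ℝ, 0 < η → 0 ≤ u → deriv (softThreshold η) u * u ≤ C) (hη : 0 < η)
    (hnη : 1 / 2 ≤ n * η) (h : mass μ x < 2 * η) :
    ENNReal.ofReal (mass μ x) * ∫⁻ data,
      ‖fderiv ℝ (regScore (empirical data) η) x - fderiv ℝ (unitScore μ) x‖ₑ
      ∂(Measure.pi fun _ : Fin n => μ)
      ≤ ENNReal.ofReal (40 * (C + 1) * (energy μ x + 21 * mass μ x)) := by
  have hq := mass_pos μ x
  have hn' : (0 : ℝ) < n := by exact_mod_cast Nat.pos_of_ne_zero hn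
  have i1 := integrable_drift_sub_sq hn μ x
  have i2 := integrable_secondMoment_sub_sq hn μ x
  have e1 := integral_drift_sub_sq_le hn μ x
  have e2 := integral_secondMoment_sub_sq_le hn μ x
  simp only [← ofReal_norm]
  have key := lintegral_ofReal_le_of_le (P := Measure.pi fun _ : Fin n => μ)
    (X := fun data => ‖fderiv ℝ (regScore (empirical data) η) x - fderiv ℝ (unitScore μ) x‖)
    (c := 40 * (C + 1) * (1 + energy μ x / mass μ x)) (a₀ := 40 * (C + 1) / η ^ 2)
    (a₁ := 40 * (C + 1) / η ^ 2) (a₂ := 0) (by positivity) (by positivity) le_rfl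
    (fun _ => norm_nonneg _) (fun data => by
      have := isProbabilityMeasure_empirical hn data
      refine (norm_fderiv_regScore_sub_le_of_lt μ _ x hC1 hC hη h).trans_eq ?_
      ring) i2 i1 i1 e2 e1 e1
  refine (mul_le_mul_right key _).trans ?_
  rw [← ENNReal.ofReal_mul hq.le]
  refine ENNReal.ofReal_le_ofReal ?_
  have h1 : mass μ x * (40 * (C + 1) * (1 + energy μ x / mass μ x)
      + (40 * (C + 1) / η ^ 2 * (4 * (mass μ x / n)) + (40 * (C + 1) / η ^ 2 * (mass μ x / n)
        + 0 * (mass μ x / n))))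
      = 40 * (C + 1) * (energy μ x + mass μ x * (1 + 5 * (mass μ x / (η * (n * η))))) := by
    field_simp; ring
  rw [h1]
  -- The constant `21` is `1 + 5 * 4`, where `5 = 4 + 1` collects the variance constants of the
  -- second moment and the drift.
  have h2 : mass μ x / (η * (n * η)) ≤ 4 := by
    rw [div_le_iff₀ (by positivity)]
    nlinarith
  refine mul_le_mul_of_nonneg_left ?_ (by linarith)
  nlinarith

end pointwise

/-! ### Measurability of the errors -/

section measurability

variable {d n : ℕ}

lemma continuous_regScore_empirical (hn : n ≠ 0) {η : ℝ} (hη : 0 < η) :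
    Continuous fun z : (Fin n → Vec d) × Vec d => regScore (empirical z.1) η z.2 := by
  have hm : Continuous fun z : (Fin n → Vec d) × Vec d => mass (empirical z.1) z.2 :=
    continuous_blur_empirical continuous_bump
  have hd : Continuous fun z : (Fin n → Vec d) × Vec d => drift (empirical z.1) z.2 :=
    continuous_blur_empirical continuous_bump_smul
  refine Continuous.smul (((differentiable_softThreshold hη).continuous.comp hm).div hm
    fun z => ?_) hd
  have := isProbabilityMeasure_empirical hn z.1
  exact (mass_pos _ _).ne'

lemma continuous_fderiv_regScore_empirical (hn : n ≠ 0) {η : ℝ} (hη : 0 < η) :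
    Continuous fun z : (Fin n → Vec d) × Vec d =>
      fderiv ℝ (regScore (empirical z.1) η) z.2 := by
  have hm : Continuous fun z : (Fin n → Vec d) × Vec d => mass (empirical z.1) z.2 :=
    continuous_blur_empirical continuous_bump
  have hd : Continuous fun z : (Fin n → Vec d) × Vec d => drift (empirical z.1) z.2 :=
    continuous_blur_empirical continuous_bump_smul
  have hs : Continuous fun z : (Fin n → Vec d) × Vec d => secondMoment (empirical z.1) z.2 :=
    continuous_blur_empirical continuous_bump_smul_outer
  have h0 : ∀ z : (Fin n → Vec d) × Vec d, mass (empirical z.1) z.2 ≠ 0 := fun z => by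
    have := isProbabilityMeasure_empirical hn z.1
    exact (mass_pos _ _).ne'
  have hψ := (differentiable_softThreshold hη).continuous.comp hm
  have hψ' : Continuous (deriv (softThreshold η)) := by
    have : softThreshold η = fun u => Real.smoothTransition (2 * u / η - 1) :=
      funext (softThreshold_eq_smoothTransition hη)
    rw [this]
    refine ContDiff.continuous_deriv (n := 1) ?_ le_rfl
    exact (Real.smoothTransition.contDiff (n := 1)).comp
      ((contDiff_const.mul contDiff_id).div_const η |>.sub contDiff_const)
  have hfd : (fun z : (Fin n → Vec d) × Vec d => fderiv ℝ (regScore (empirical z.1) η) z.2)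
      = fun z => _ := funext fun z => by
    have := isProbabilityMeasure_empirical hn z.1
    exact (hasFDerivAt_regScore (empirical z.1) z.2 hη).fderiv
  rw [hfd]
  exact ((hψ.div hm h0).smul (hs.sub (hm.smul continuous_const))).add
    (((((hψ'.comp hm).mul hm).sub hψ).div (hm.pow 2) fun z => pow_ne_zero 2 (h0 z)).smul
      (continuous_outer.comp hd))

lemma continuous_unitScore (μ : Measure (Vec d)) [IsProbabilityMeasure μ] :
    Continuous (unitScore μ) :=
  ((continuous_mass μ).inv₀ fun x => (mass_pos μ x).ne').smul (continuous_drift μ)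

lemma continuous_fderiv_unitScore (μ : Measure (Vec d)) [IsProbabilityMeasure μ] :
    Continuous (fderiv ℝ (unitScore μ)) := by
  have hfd : fderiv ℝ (unitScore μ) = fun x => _ :=
    funext fun x => (hasFDerivAt_unitScore μ x).fderiv
  rw [hfd]
  have hm := continuous_mass μ
  have h0 : ∀ x, mass μ x ≠ 0 := fun x => (mass_pos μ x).ne'
  exact ((hm.inv₀ h0).smul ((continuous_secondMoment μ).sub (hm.smul continuous_const))).add
    ((((hm.pow 2).inv₀ fun x => pow_ne_zero 2 (h0 x)).neg).smul
      (continuous_outer.comp (continuous_drift μ)))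

lemma measurable_score_error (hn : n ≠ 0) (μ : Measure (Vec d)) [IsProbabilityMeasure μ] {η : ℝ}
    (hη : 0 < η) :
    Measurable fun z : (Fin n → Vec d) × Vec d =>
      ‖regScore (empirical z.1) η z.2 - unitScore μ z.2‖ₑ ^ 2 :=
  (((continuous_regScore_empirical hn hη).sub
    ((continuous_unitScore μ).comp continuous_snd)).enorm.measurable).pow_const 2

lemma measurable_jacobian_error (hn : n ≠ 0) (μ : Measure (Vec d)) [IsProbabilityMeasure μ] {η : ℝ}
    (hη : 0 < η) :
    Measurable fun z : (Fin n → Vec d) × Vec d =>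
      ‖fderiv ℝ (regScore (empirical z.1) η) z.2 - fderiv ℝ (unitScore μ) z.2‖ₑ :=
  ((continuous_fderiv_regScore_empirical hn hη).sub
    ((continuous_fderiv_unitScore μ).comp continuous_snd)).enorm.measurable

end measurability

/-! ### Integration over space -/

section gaussian

variable {d : ℕ}

lemma integrable_exp_neg_mul_norm_sq {b : ℝ} (hb : 0 < b) :
    Integrable fun v : Vec d => Real.exp (-b * ‖v‖ ^ 2) := by
  have h := GaussianFourier.integrable_cexp_neg_mul_sq_norm_add (V := Vec d) (b := (b : ℂ))
    (by simpa using hb) 0 0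
  refine h.re.congr (.of_forall fun v => ?_)
  have : (-(b : ℂ) * (‖v‖ : ℂ) ^ 2) = ((-b * ‖v‖ ^ 2 : ℝ) : ℂ) := by push_cast; ring
  simp only [zero_mul, add_zero]
  rw [this, ← Complex.ofReal_exp]
  rfl

lemma integral_exp_neg_mul_norm_sq {b : ℝ} (hb : 0 < b) :
    ∫ v : Vec d, Real.exp (-b * ‖v‖ ^ 2) = (Real.pi / b) ^ ((d : ℝ) / 2) := by
  simpa using GaussianFourier.integral_rexp_neg_mul_sq_norm (V := Vec d) hb

lemma bump_eq_exp_neg_mul (z : Vec d) : bump z = Real.exp (-(1 / 2) * ‖z‖ ^ 2) := by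
  rw [bump]; congr 1; ring

lemma integrable_bump : Integrable (bump (d := d)) := by
  rw [funext bump_eq_exp_neg_mul]
  exact integrable_exp_neg_mul_norm_sq (by norm_num)

lemma integral_bump : ∫ z : Vec d, bump z = (2 * Real.pi) ^ ((d : ℝ) / 2) := by
  rw [funext bump_eq_exp_neg_mul, integral_exp_neg_mul_norm_sq (by norm_num)]
  congr 1; ring

lemma integrable_bump_mul_sq : Integrable fun z : Vec d => bump z * ‖z‖ ^ 2 := by
  refine ((integrable_exp_neg_mul_norm_sq (d := d) (b := 1 / 4) (by norm_num)).const_mul 4).mono'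
    continuous_bump_mul_sq.aestronglyMeasurable (.of_forall fun z => ?_)
  have h := Real.add_one_le_exp (1 / 4 * ‖z‖ ^ 2)
  have h1 : ‖z‖ ^ 2 ≤ 4 * Real.exp (1 / 4 * ‖z‖ ^ 2) := by linarith
  rw [Real.norm_of_nonneg (mul_nonneg (bump_pos z).le (sq_nonneg _))]
  refine (mul_le_mul_of_nonneg_left h1 (bump_pos z).le).trans_eq ?_
  rw [mul_left_comm, bump, ← Real.exp_add]
  congr 2; ring

variable (μ : Measure (Vec d)) [IsProbabilityMeasure μ]

lemma integrable_blur_uncurry {f : Vec d → ℝ} (hf : Continuous f) (hi : Integrable f) :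
    Integrable (fun z : Vec d × Vec d => f (z.1 - z.2)) (volume.prod μ) := by
  have hc : Continuous fun z : Vec d × Vec d => f (z.1 - z.2) := hf.comp (by fun_prop)
  rw [integrable_prod_iff' hc.aestronglyMeasurable]
  refine ⟨.of_forall fun y => hi.comp_sub_right y, ?_⟩
  have : (fun y : Vec d => ∫ x : Vec d, ‖f (x - y)‖) = fun _ => ∫ x : Vec d, ‖f x‖ :=
    funext fun y => integral_sub_right_eq_self (fun x => ‖f x‖) y
  simp only [this]
  exact integrable_const _

lemma integrable_blur {f : Vec d → ℝ} (hf : Continuous f) (hi : Integrable f) :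
    Integrable (blur μ f) :=
  (integrable_blur_uncurry μ hf hi).integral_prod_left

lemma integral_blur {f : Vec d → ℝ} (hf : Continuous f) (hi : Integrable f) :
    ∫ x, blur μ f x = ∫ z, f z := by
  unfold blur
  rw [integral_integral_swap (integrable_blur_uncurry μ hf hi)]
  simp [integral_sub_right_eq_self]

lemma integrable_mass : Integrable (mass μ) := integrable_blur μ continuous_bump integrable_bump

lemma integral_mass : ∫ x, mass μ x = (2 * Real.pi) ^ ((d : ℝ) / 2) := by
  rw [mass, integral_blur μ continuous_bump integrable_bump, integral_bump]

lemma integrable_energy : Integrable (energy μ) :=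
  integrable_blur μ continuous_bump_mul_sq integrable_bump_mul_sq

end gaussian

/-! ### Integration by parts against a truncated density. -/

section parts

variable {d : ℕ} (μ : Measure (Vec d)) [IsProbabilityMeasure μ] {η : ℝ}

/-- A smooth version of `min (mass μ x) η`. -/
def cappedMass {d : ℕ} (μ : Measure (Vec d)) (η : ℝ) (x : Vec d) : ℝ :=
  mass μ x * η / (mass μ x + η)

/-- The density whose integral is computed by integration by parts. -/
def cappedEnergy {d : ℕ} (μ : Measure (Vec d)) (η : ℝ) (x : Vec d) : ℝ :=
  cappedMass μ η x * (energy μ x / mass μ x - ‖drift μ x‖ ^ 2 / mass μ x ^ 2)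
    + η ^ 2 / (mass μ x + η) ^ 2 * (‖drift μ x‖ ^ 2 / mass μ x)

lemma cappedMass_nonneg (hη : 0 < η) (x : Vec d) : 0 ≤ cappedMass μ η x := by
  have := mass_pos μ x
  unfold cappedMass; positivity

lemma cappedMass_le_mass (hη : 0 < η) (x : Vec d) : cappedMass μ η x ≤ mass μ x := by
  have := mass_pos μ x
  unfold cappedMass
  rw [div_le_iff₀ (by positivity)]
  nlinarith

lemma cappedMass_le (hη : 0 < η) (x : Vec d) : cappedMass μ η x ≤ η := by
  have := mass_pos μ x
  unfold cappedMass
  rw [div_le_iff₀ (by positivity)]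
  nlinarith

lemma mass_le_cappedMass (hη : 0 < η) {x : Vec d} (h : mass μ x < 2 * η) :
    mass μ x ≤ 3 * cappedMass μ η x := by
  have := mass_pos μ x
  unfold cappedMass
  rw [mul_div_assoc', le_div_iff₀ (by positivity)]
  nlinarith

lemma norm_drift_sq_div_le (x : Vec d) :
    ‖drift μ x‖ ^ 2 / mass μ x ^ 2 ≤ energy μ x / mass μ x := by
  have hq := mass_pos μ x
  rw [div_le_div_iff₀ (by positivity) hq]
  nlinarith [norm_drift_sq_le μ x]

lemma cappedEnergy_nonneg (hη : 0 < η) (x : Vec d) : 0 ≤ cappedEnergy μ η x := by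
  have hq := mass_pos μ x
  refine add_nonneg (mul_nonneg (cappedMass_nonneg μ hη x) ?_) (by positivity)
  linarith [norm_drift_sq_div_le μ x]

/-- Below `2η` the truncation keeps a third of the mass and its derivative `(η / (mass + η))²` is at
least `1/9`. Both pieces of `cappedEnergy` are nonnegative, so together they keep a ninth of the
energy. -/
lemma energy_le_cappedEnergy (hη : 0 < η) {x : Vec d} (h : mass μ x < 2 * η) :
    energy μ x ≤ 9 * cappedEnergy μ η x := by
  have hq := mass_pos μ x
  have h1 := mass_le_cappedMass μ hη h
  have h2 := norm_drift_sq_div_le μ x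
  have h3 : 1 / 9 ≤ η ^ 2 / (mass μ x + η) ^ 2 := by
    rw [div_le_div_iff₀ (by norm_num) (by positivity)]
    nlinarith
  have h4 : mass μ x * (energy μ x / mass μ x - ‖drift μ x‖ ^ 2 / mass μ x ^ 2)
      ≤ 3 * cappedMass μ η x * (energy μ x / mass μ x - ‖drift μ x‖ ^ 2 / mass μ x ^ 2) :=
    mul_le_mul_of_nonneg_right h1 (by linarith)
  have h5 : 1 / 9 * (‖drift μ x‖ ^ 2 / mass μ x)
      ≤ η ^ 2 / (mass μ x + η) ^ 2 * (‖drift μ x‖ ^ 2 / mass μ x) :=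
    mul_le_mul_of_nonneg_right h3 (by positivity)
  have h6 : mass μ x * (energy μ x / mass μ x - ‖drift μ x‖ ^ 2 / mass μ x ^ 2)
      = energy μ x - ‖drift μ x‖ ^ 2 / mass μ x := by field_simp
  have h7 : 0 ≤ cappedMass μ η x * (energy μ x / mass μ x - ‖drift μ x‖ ^ 2 / mass μ x ^ 2) :=
    mul_nonneg (cappedMass_nonneg μ hη x) (by linarith)
  unfold cappedEnergy
  linarith

lemma continuous_cappedMass (hη : 0 < η) : Continuous (cappedMass μ η) := by
  have hm := continuous_mass μ
  refine (hm.mul continuous_const).div (hm.add continuous_const) fun x => ?_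
  have := mass_pos μ x
  positivity

lemma integrable_cappedMass (hη : 0 < η) : Integrable (cappedMass μ η) := by
  refine (integrable_mass μ).mono' (continuous_cappedMass μ hη).aestronglyMeasurable
    (.of_forall fun x => ?_)
  rw [Real.norm_of_nonneg (cappedMass_nonneg μ hη x)]
  exact cappedMass_le_mass μ hη x

lemma hasFDerivAt_cappedMass (hη : 0 < η) (x : Vec d) :
    HasFDerivAt (cappedMass μ η) ((η ^ 2 / (mass μ x + η) ^ 2) • innerSL ℝ (drift μ x)) x := by
  have hq := mass_pos μ x
  have h1 : HasDerivAt (fun u : ℝ => u * η / (u + η)) (η ^ 2 / (mass μ x + η) ^ 2) (mass μ x) := by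
    have h := ((hasDerivAt_id' (mass μ x)).mul_const η).fun_div
      ((hasDerivAt_id' (mass μ x)).add_const η) (by positivity)
    exact h.congr_deriv (by ring)
  exact h1.comp_hasFDerivAt x (hasFDerivAt_mass μ x)

lemma sum_secondMoment_apply (x : Vec d) :
    ∑ j, secondMoment μ x (EuclideanSpace.single j 1) j = energy μ x := by
  have h : ∀ j, secondMoment μ x (EuclideanSpace.single j 1) j
      = ∫ y, bump (x - y) * ((x - y) j) ^ 2 ∂μ := fun j => by
    have := inner_secondMoment μ x (EuclideanSpace.single j 1)
    simpa [EuclideanSpace.inner_single_left, EuclideanSpace.inner_single_right] using this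
  simp only [h]
  rw [← integral_finsetSum]
  · refine integral_congr_ae (.of_forall fun y => ?_)
    simp only [← Finset.mul_sum, EuclideanSpace.norm_sq_eq, Real.norm_eq_abs, sq_abs]
  · intro j _
    refine integrable_comp_sub (f := fun z : Vec d => bump z * z j ^ 2) (C := 1)
      (continuous_bump.mul (by fun_prop)) (fun z => ?_) x
    rw [Real.norm_of_nonneg (mul_nonneg (bump_pos z).le (sq_nonneg _))]
    refine le_trans (mul_le_mul_of_nonneg_left ?_ (bump_pos z).le) (bump_mul_sq_le_one z)
    rw [EuclideanSpace.norm_sq_eq]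
    simp only [Real.norm_eq_abs, sq_abs]
    exact Finset.single_le_sum (f := fun j => z j ^ 2) (fun _ _ => sq_nonneg _)
      (Finset.mem_univ j)

lemma abs_apply_le_norm (v : Vec d) (j : Fin d) : |v j| ≤ ‖v‖ := by
  simpa using PiLp.norm_apply_le v j

/-- Integration by parts in one coordinate. -/
lemma integral_cappedMass_mul_fderiv (hη : 0 < η) (j : Fin d) :
    Integrable (fun x => cappedMass μ η x
      * (fderiv ℝ (unitScore μ) x (EuclideanSpace.single j 1)) j) ∧
    Integrable (fun x => η ^ 2 / (mass μ x + η) ^ 2 * (drift μ x j ^ 2 / mass μ x)) ∧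
    ∫ x, cappedMass μ η x * (fderiv ℝ (unitScore μ) x (EuclideanSpace.single j 1)) j
      = -∫ x, η ^ 2 / (mass μ x + η) ^ 2 * (drift μ x j ^ 2 / mass μ x) := by
  have hm := continuous_mass μ
  have hd := continuous_drift μ
  -- A common majorant for the three integrands that integration by parts requires; it is `mass`
  -- times the bound on the Jacobian of the score.
  have hdom : Integrable fun x => mass μ x + 2 * energy μ x :=
    (integrable_mass μ).add ((integrable_energy μ).const_mul 2)
  have hd_j : Continuous fun x => drift μ x j := by fun_prop
  have hf' : Continuous fun x => η ^ 2 / (mass μ x + η) ^ 2 :=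
    continuous_const.div ((hm.add continuous_const).pow 2) fun x => by
      have := mass_pos μ x
      positivity
  have i1 : Integrable fun x => cappedMass μ η x
      * (fderiv ℝ (unitScore μ) x (EuclideanSpace.single j 1)) j := by
    refine hdom.mono' ?_ (.of_forall fun x => ?_)
    · have h1 : Continuous fun x => fderiv ℝ (unitScore μ) x (EuclideanSpace.single j 1) :=
        (continuous_fderiv_unitScore μ).clm_apply continuous_const
      exact ((continuous_cappedMass μ hη).mul (by fun_prop)).aestronglyMeasurable
    · have hq := mass_pos μ x
      rw [norm_mul, Real.norm_of_nonneg (cappedMass_nonneg μ hη x), Real.norm_eq_abs]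
      have h1 : |(fderiv ℝ (unitScore μ) x (EuclideanSpace.single j 1)) j|
          ≤ 1 + 2 * (energy μ x / mass μ x) := by
        refine (abs_apply_le_norm _ j).trans ((ContinuousLinearMap.le_opNorm _ _).trans ?_)
        simpa using norm_fderiv_unitScore_le μ x
      refine (mul_le_mul (cappedMass_le_mass μ hη x) h1 (abs_nonneg _) hq.le).trans_eq ?_
      field_simp
  have e2 : ∀ x, ((η ^ 2 / (mass μ x + η) ^ 2) • innerSL ℝ (drift μ x))
      (EuclideanSpace.single j 1) * unitScore μ x j
      = η ^ 2 / (mass μ x + η) ^ 2 * (drift μ x j ^ 2 / mass μ x) := fun x => by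
    simp [unitScore, EuclideanSpace.inner_single_right]
    ring
  have i2 : Integrable fun x => η ^ 2 / (mass μ x + η) ^ 2 * (drift μ x j ^ 2 / mass μ x) := by
    refine hdom.mono' ?_ (.of_forall fun x => ?_)
    · exact (hf'.mul ((hd_j.pow 2).div hm fun x => (mass_pos μ x).ne')).aestronglyMeasurable
    · have hq := mass_pos μ x
      rw [Real.norm_of_nonneg (by positivity)]
      have h1 : η ^ 2 / (mass μ x + η) ^ 2 ≤ 1 := by
        rw [div_le_one (by positivity)]; gcongr; linarith
      have h2 : drift μ x j ^ 2 / mass μ x ≤ energy μ x := by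
        rw [div_le_iff₀ hq, mul_comm]
        refine le_trans ?_ (norm_drift_sq_le μ x)
        rw [← sq_abs]
        exact pow_le_pow_left₀ (abs_nonneg _) (abs_apply_le_norm _ j) 2
      have h3 := mul_le_mul h1 h2 (by positivity) zero_le_one
      have := energy_nonneg μ x
      linarith
  have i3 : Integrable fun x => cappedMass μ η x * unitScore μ x j := by
    refine hdom.mono' ?_ (.of_forall fun x => ?_)
    · have h1 : Continuous fun x => unitScore μ x j :=
        (EuclideanSpace.proj (𝕜 := ℝ) j).continuous.comp (continuous_unitScore μ)
      exact ((continuous_cappedMass μ hη).mul h1).aestronglyMeasurable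
    · have hq := mass_pos μ x
      rw [norm_mul, Real.norm_of_nonneg (cappedMass_nonneg μ hη x), Real.norm_eq_abs]
      refine (mul_le_mul (cappedMass_le_mass μ hη x) (abs_apply_le_norm _ j) (abs_nonneg _)
        hq.le).trans ?_
      have h1 := norm_unitScore_sq_le μ x
      have h2 : mass μ x * (energy μ x / mass μ x) = energy μ x := by field_simp
      have h3 : ‖unitScore μ x‖ ≤ 1 + energy μ x / mass μ x := by
        nlinarith [sq_nonneg (‖unitScore μ x‖ - 1)]
      have h4 := mul_le_mul_of_nonneg_left h3 hq.le
      have := energy_nonneg μ x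
      linarith
  refine ⟨i1, i2, ?_⟩
  have hg : ∀ x, HasFDerivAt (fun x => unitScore μ x j)
      ((EuclideanSpace.proj (𝕜 := ℝ) j).comp (fderiv ℝ (unitScore μ) x)) x := fun x =>
    (EuclideanSpace.proj (𝕜 := ℝ) j).hasFDerivAt.comp x
      (hasFDerivAt_unitScore μ x).differentiableAt.hasFDerivAt
  have key := integral_bilinear_hasFDerivAt_right_eq_neg_left_of_integrable
    (μ := (volume : Measure (Vec d))) (B := ContinuousLinearMap.mul ℝ ℝ)
    (v := EuclideanSpace.single j 1) (f := cappedMass μ η)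
    (f' := fun x => (η ^ 2 / (mass μ x + η) ^ 2) • innerSL ℝ (drift μ x))
    (g := fun x => unitScore μ x j)
    (g' := fun x => (EuclideanSpace.proj (𝕜 := ℝ) j).comp (fderiv ℝ (unitScore μ) x))
    (by simpa only [ContinuousLinearMap.mul_apply', e2] using i2)
    i1 i3 (fun x _ => hasFDerivAt_cappedMass μ hη x) (fun x _ => hg x)
  simp only [ContinuousLinearMap.mul_apply', e2] at key
  exact key

/-- This is the divergence of the score. The trace of the identity is the source of the factor `d`
in the bounds below the threshold. -/
lemma sum_fderiv_unitScore_apply (x : Vec d) :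
    ∑ j, (fderiv ℝ (unitScore μ) x (EuclideanSpace.single j 1)) j
      = energy μ x / mass μ x - d - ‖drift μ x‖ ^ 2 / mass μ x ^ 2 := by
  have hq := mass_pos μ x
  have h : ∀ j, (fderiv ℝ (unitScore μ) x (EuclideanSpace.single j 1)) j
      = secondMoment μ x (EuclideanSpace.single j 1) j / mass μ x - 1
        - drift μ x j ^ 2 / mass μ x ^ 2 := fun j => by
    rw [(hasFDerivAt_unitScore μ x).fderiv]
    simp [outer_apply, EuclideanSpace.inner_single_right]
    field_simp
    ring
  simp only [h]
  rw [Finset.sum_sub_distrib, Finset.sum_sub_distrib, ← Finset.sum_div, ← Finset.sum_div,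
    sum_secondMoment_apply]
  simp [EuclideanSpace.norm_sq_eq]

/-- With `f = cappedMass` and `s` the score, this is `∫ f div s = -∫ ⟨∇f, s⟩` with the term `-d ∫ f`
of the divergence moved across. It controls the energy at low density, where the entropy bound has
an unbounded logarithm. -/
lemma integral_cappedEnergy (hη : 0 < η) :
    Integrable (cappedEnergy μ η) ∧
    ∫ x, cappedEnergy μ η x = d * ∫ x, cappedMass μ η x := by
  have h := integral_cappedMass_mul_fderiv μ hη
  have ha : ∀ x, ∑ j, cappedMass μ η x * (fderiv ℝ (unitScore μ) x (EuclideanSpace.single j 1)) j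
      = cappedMass μ η x * (energy μ x / mass μ x - ‖drift μ x‖ ^ 2 / mass μ x ^ 2)
        - d * cappedMass μ η x := fun x => by
    rw [← Finset.mul_sum, sum_fderiv_unitScore_apply]; ring
  have hb : ∀ x, ∑ j, η ^ 2 / (mass μ x + η) ^ 2 * (drift μ x j ^ 2 / mass μ x)
      = η ^ 2 / (mass μ x + η) ^ 2 * (‖drift μ x‖ ^ 2 / mass μ x) := fun x => by
    rw [← Finset.mul_sum, ← Finset.sum_div]
    simp [EuclideanSpace.norm_sq_eq]
  have ia := integrable_finsetSum Finset.univ fun j _ => (h j).1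
  have ib := integrable_finsetSum Finset.univ fun j _ => (h j).2.1
  have hE : cappedEnergy μ η = fun x =>
      (∑ j, cappedMass μ η x * (fderiv ℝ (unitScore μ) x (EuclideanSpace.single j 1)) j)
      + ((∑ j, η ^ 2 / (mass μ x + η) ^ 2 * (drift μ x j ^ 2 / mass μ x))
      + d * cappedMass μ η x) := by
    ext x
    rw [ha, hb, cappedEnergy]; ring
  have ic := (integrable_cappedMass μ hη).const_mul (d : ℝ)
  have ibc : Integrable fun x => (∑ j, η ^ 2 / (mass μ x + η) ^ 2 * (drift μ x j ^ 2 / mass μ x))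
      + d * cappedMass μ η x := ib.add ic
  refine ⟨?_, ?_⟩
  · rw [hE]
    exact ia.add ibc
  · rw [hE]
    rw [integral_add ia ibc, integral_add ib ic, integral_const_mul,
      integral_finsetSum _ fun j _ => (h j).1, integral_finsetSum _ fun j _ => (h j).2.1,
      Finset.sum_congr rfl fun j _ => (h j).2.2, Finset.sum_neg_distrib]
    ring

end parts

/-! ### Mean errors at unit time -/

/-- The law `μ ∗ N(0, I)`. -/
def unitLaw {d : ℕ} (μ : Measure (Vec d)) : Measure (Vec d) :=
  volume.withDensity fun x => ENNReal.ofReal (((2 * Real.pi) ^ ((d : ℝ) / 2))⁻¹ * mass μ x)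

/-! ### The threshold level at unit time. -/

section levels

variable {n : ℕ}

lemma log_natCast_ge (hn : 2 ≤ n) : 0.69 ≤ Real.log n := by
  have h : Real.log 2 ≤ Real.log n := Real.log_le_log (by norm_num) (by exact_mod_cast hn)
  linarith [Real.log_two_gt_d9]

lemma level_pos (hn : 2 ≤ n) : 0 < Real.log n / n := by
  have := log_natCast_ge hn
  have : (0 : ℝ) < n := by positivity
  exact div_pos (by linarith) this

lemma level_le_one (hn : 2 ≤ n) : Real.log n / n ≤ 1 := by
  have : (0 : ℝ) < n := by positivity
  rw [div_le_one this]
  linarith [Real.log_le_sub_one_of_pos this]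

lemma half_le_mul_level (hn : 2 ≤ n) : 1 / 2 ≤ (n : ℝ) * (Real.log n / n) := by
  have h := log_natCast_ge hn
  have : (0 : ℝ) < n := by positivity
  rw [mul_div_cancel₀ _ this.ne']
  linarith

lemma logLevel_le (hn : 2 ≤ n) : logLevel (Real.log n / n) ≤ 6 * Real.log n := by
  have h := log_natCast_ge hn
  have hn0 : (0 : ℝ) < n := by positivity
  have hL : 0 < Real.log n := by linarith
  have h1 : (2 : ℝ) / (Real.log n / n) = 2 * n / Real.log n := by field_simp
  -- `log (log n)` is negative for `n = 2`, so it is bounded from below rather than dropped.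
  have h2 := Real.one_sub_inv_le_log_of_pos hL
  rw [logLevel, h1, Real.log_div (by positivity) hL.ne', Real.log_mul (by norm_num) hn0.ne']
  have h3 : (Real.log n)⁻¹ ≤ (0.69 : ℝ)⁻¹ := inv_anti₀ (by norm_num) h
  have h4 := Real.log_two_lt_d9
  norm_num at h3
  linarith

end levels

/-! ### Small powers of the density as a substitute for the volume above the threshold. -/

section spatial

variable {d n : ℕ} (μ : Measure (Vec d)) [IsProbabilityMeasure μ] {η θ σ : ℝ}

lemma rpow_mass_div_le (hη : 0 < η) (hθ : 0 ≤ θ) (hσ : 0 < σ) (hμ : IsSubgaussian σ μ)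
    (x : Vec d) : (mass μ x / η) ^ θ
      ≤ (2 / η) ^ θ * Real.exp (-(θ / (2 + σ ^ 2)) * ‖x‖ ^ 2) := by
  have hq := mass_pos μ x
  have h := mass_le_of_isSubgaussian μ x hσ hμ
  calc (mass μ x / η) ^ θ ≤ (2 / η * Real.exp (-‖x‖ ^ 2 / (2 + σ ^ 2))) ^ θ := by
        refine Real.rpow_le_rpow (by positivity) ?_ hθ
        rw [div_mul_eq_mul_div]
        exact div_le_div_of_nonneg_right h hη.le
    _ = _ := by
        rw [Real.mul_rpow (by positivity) (Real.exp_pos _).le, ← Real.exp_mul]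
        congr 2
        ring

lemma continuous_rpow_mass_div (hη : 0 < η) : Continuous fun x => (mass μ x / η) ^ θ :=
  ((continuous_mass μ).div_const η).rpow_const fun x => by
    have := mass_pos μ x
    exact Or.inl (by positivity)

lemma integrable_rpow_mass_div (hη : 0 < η) (hθ : 0 < θ) (hσ : 0 < σ)
    (hμ : IsSubgaussian σ μ) : Integrable fun x => (mass μ x / η) ^ θ := by
  refine ((integrable_exp_neg_mul_norm_sq (d := d) (b := θ / (2 + σ ^ 2))
    (by positivity)).const_mul ((2 / η) ^ θ)).mono'
    (continuous_rpow_mass_div μ hη).aestronglyMeasurable (.of_forall fun x => ?_)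
  have hq := mass_pos μ x
  rw [Real.norm_of_nonneg (by positivity)]
  exact rpow_mass_div_le μ hη hθ.le hσ hμ x

lemma integral_rpow_mass_div_le (hη : 0 < η) (hθ : 0 < θ) (hσ : 0 < σ)
    (hμ : IsSubgaussian σ μ) :
    ((2 * Real.pi) ^ ((d : ℝ) / 2))⁻¹ * ∫ x, (mass μ x / η) ^ θ
      ≤ (2 / η) ^ θ * ((2 + σ ^ 2) / (2 * θ)) ^ ((d : ℝ) / 2) := by
  have hb : 0 < θ / (2 + σ ^ 2) := by positivity
  have h := integral_mono (integrable_rpow_mass_div μ hη hθ hσ hμ)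
    ((integrable_exp_neg_mul_norm_sq (d := d) hb).const_mul ((2 / η) ^ θ))
    (fun x => rpow_mass_div_le μ hη hθ.le hσ hμ x)
  rw [integral_const_mul, integral_exp_neg_mul_norm_sq hb] at h
  refine (mul_le_mul_of_nonneg_left h (by positivity)).trans_eq ?_
  have h1 : Real.pi / (θ / (2 + σ ^ 2)) = (2 * Real.pi) * ((2 + σ ^ 2) / (2 * θ)) := by
    field_simp
  have h2 : 0 < (2 * Real.pi) ^ ((d : ℝ) / 2) := by positivity
  have h3 := Real.mul_rpow (x := 2 * Real.pi) (y := (2 + σ ^ 2) / (2 * θ)) (z := (d : ℝ) / 2)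
    (by positivity) (by positivity)
  rw [h1, h3, mul_left_comm, inv_mul_cancel_left₀ h2.ne']

/-- Since `min(u, 1) ≤ u ^ θ` for `0 ≤ θ ≤ 1`, the integral that bounds the volume above the
threshold also bounds the truncated mass. -/
lemma cappedMass_le_rpow (hη : 0 < η) (hθ : 0 ≤ θ) (hθ1 : θ ≤ 1) (x : Vec d) :
    cappedMass μ η x ≤ η * (mass μ x / η) ^ θ := by
  have hq := mass_pos μ x
  rcases le_total η (mass μ x) with h | h
  · refine (cappedMass_le μ hη x).trans (le_mul_of_one_le_right hη.le ?_)
    exact Real.one_le_rpow ((one_le_div hη).2 h) hθ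
  · refine (cappedMass_le_mass μ hη x).trans ?_
    have h1 : mass μ x / η ≤ (mass μ x / η) ^ θ :=
      Real.self_le_rpow_of_le_one (by positivity) ((div_le_one hη).2 h) hθ1
    calc mass μ x = η * (mass μ x / η) := by field_simp
      _ ≤ _ := mul_le_mul_of_nonneg_left h1 hη.le

/-- Integrating a bound for the mean error at a point. -/
lemma lintegral_prod_unitLaw_le {Φ : (Fin n → Vec d) × Vec d → ℝ≥0∞} (hΦ : Measurable Φ)
    {B : Vec d → ℝ} (hB : Integrable B) (hB0 : ∀ x, 0 ≤ B x)
    (h : ∀ x, ENNReal.ofReal (mass μ x) * ∫⁻ data, Φ (data, x) ∂(Measure.pi fun _ : Fin n => μ)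
      ≤ ENNReal.ofReal (B x)) :
    ∫⁻ z, Φ z ∂((Measure.pi fun _ : Fin n => μ).prod (unitLaw μ))
      ≤ ENNReal.ofReal (((2 * Real.pi) ^ ((d : ℝ) / 2))⁻¹ * ∫ x, B x) := by
  have hc : 0 ≤ ((2 * Real.pi) ^ ((d : ℝ) / 2))⁻¹ := by positivity
  have hm : Measurable fun x =>
      ENNReal.ofReal (((2 * Real.pi) ^ ((d : ℝ) / 2))⁻¹ * mass μ x) :=
    ((continuous_mass μ).measurable.const_mul _).ennreal_ofReal
  have : SFinite (unitLaw μ) := by unfold unitLaw; infer_instance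
  rw [lintegral_prod_symm' _ hΦ, unitLaw,
    lintegral_withDensity_eq_lintegral_mul _ hm hΦ.lintegral_prod_left',
    ENNReal.ofReal_mul hc, ofReal_integral_eq_lintegral_ofReal hB (.of_forall hB0),
    ← lintegral_const_mul' _ _ ENNReal.ofReal_ne_top]
  refine lintegral_mono fun x => ?_
  simp only [Pi.mul_apply]
  rw [ENNReal.ofReal_mul hc, mul_assoc]
  exact mul_le_mul_right (h x) _

end spatial

/-! ### Integrated errors in terms of the effective volume `V`. -/

section unitBounds

variable {d n : ℕ} (μ : Measure (Vec d)) [IsProbabilityMeasure μ] {η θ σ V : ℝ}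

/-- The bound by `1`, the total mass, is kept for the Jacobian error, whose rate is a square root
and can be smaller than `η * V` when that is large. -/
lemma normalized_integral_cappedMass_le (hη : 0 < η) (hθ : 0 < θ) (hθ1 : θ ≤ 1) (hσ : 0 < σ)
    (hμ : IsSubgaussian σ μ)
    (hV : ((2 * Real.pi) ^ ((d : ℝ) / 2))⁻¹ * ∫ x, (mass μ x / η) ^ θ ≤ V) :
    ((2 * Real.pi) ^ ((d : ℝ) / 2))⁻¹ * ∫ x, cappedMass μ η x ≤ min 1 (η * V) := by
  have hc : 0 < (2 * Real.pi) ^ ((d : ℝ) / 2) := by positivity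
  refine le_min ?_ ?_
  · rw [inv_mul_le_iff₀ hc, mul_one, ← integral_mass μ]
    exact integral_mono (integrable_cappedMass μ hη) (integrable_mass μ)
      (cappedMass_le_mass μ hη)
  · have h := integral_mono (integrable_cappedMass μ hη)
      ((integrable_rpow_mass_div μ hη hθ hσ hμ).const_mul η)
      (cappedMass_le_rpow μ hη hθ.le hθ1)
    rw [integral_const_mul] at h
    calc _ ≤ ((2 * Real.pi) ^ ((d : ℝ) / 2))⁻¹ * (η * ∫ x, (mass μ x / η) ^ θ) :=
          mul_le_mul_of_nonneg_left h (by positivity)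
      _ = η * (((2 * Real.pi) ^ ((d : ℝ) / 2))⁻¹ * ∫ x, (mass μ x / η) ^ θ) := by ring
      _ ≤ η * V := mul_le_mul_of_nonneg_left hV hη.le

/-- The indicator of `mass ≥ 2η` is dominated by `(mass / η) ^ θ`, and the lower region by
`cappedEnergy` and `cappedMass`: `450 = 50 * 9` and `96 = 32 * 3`. -/
lemma lintegral_score_error_le (hn : n ≠ 0) (hη : 0 < η) (hη1 : η ≤ 1) (hnη : 1 / 2 ≤ n * η)
    (hθ : 0 < θ) (hθ1 : θ ≤ 1) (hσ : 0 < σ) (hμ : IsSubgaussian σ μ)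
    (hV : ((2 * Real.pi) ^ ((d : ℝ) / 2))⁻¹ * ∫ x, (mass μ x / η) ^ θ ≤ V) :
    ∫⁻ z, ‖regScore (empirical z.1) η z.2 - unitScore μ z.2‖ₑ ^ 2
      ∂((Measure.pi fun _ : Fin n => μ).prod (unitLaw μ))
      ≤ ENNReal.ofReal (8 * (1 + 4 * logLevel η) / n * V + (450 * d + 96) * (η * V)) := by
  have hn' : (0 : ℝ) < n := by exact_mod_cast Nat.pos_of_ne_zero hn
  have hL := one_le_logLevel hη hη1
  have hE := integral_cappedEnergy μ hη
  have i1 := (integrable_rpow_mass_div μ hη hθ hσ hμ).const_mul (8 * (1 + 4 * logLevel η) / n)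
  have i2 := hE.1.const_mul 450
  have i3 := (integrable_cappedMass μ hη).const_mul 96
  have i23 : Integrable fun x => 450 * cappedEnergy μ η x + 96 * cappedMass μ η x := i2.add i3
  have hA : 0 ≤ 8 * (1 + 4 * logLevel η) / n := by positivity
  have p1 : ∀ x, 0 ≤ 8 * (1 + 4 * logLevel η) / n * (mass μ x / η) ^ θ := fun x =>
    mul_nonneg hA (Real.rpow_nonneg (div_nonneg (mass_pos μ x).le hη.le) _)
  have p2 := cappedEnergy_nonneg μ hη
  have p3 := cappedMass_nonneg μ hη
  refine (lintegral_prod_unitLaw_le μ (measurable_score_error hn μ hη)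
    (B := fun x => 8 * (1 + 4 * logLevel η) / n * (mass μ x / η) ^ θ
      + (450 * cappedEnergy μ η x + 96 * cappedMass μ η x)) (i1.add i23)
    (fun x => by have := p1 x; have := p2 x; have := p3 x; positivity) fun x => ?_).trans ?_
  · have := p1 x
    have := p2 x
    have := p3 x
    rcases le_or_gt (2 * η) (mass μ x) with h | h
    · refine (mass_mul_lintegral_score_le_of_ge hn μ x hη h).trans
        (ENNReal.ofReal_le_ofReal ?_)
      have h1 : 1 ≤ (mass μ x / η) ^ θ :=
        Real.one_le_rpow ((one_le_div hη).2 (by linarith)) hθ.le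
      have := le_mul_of_one_le_right hA h1
      linarith
    · refine (mass_mul_lintegral_score_le_of_lt hn μ x hη hnη h).trans
        (ENNReal.ofReal_le_ofReal ?_)
      have := energy_le_cappedEnergy μ hη h
      have := mass_le_cappedMass μ hη h
      linarith
  · refine ENNReal.ofReal_le_ofReal ?_
    rw [integral_add i1 i23, integral_add i2 i3, integral_const_mul, integral_const_mul,
      integral_const_mul, hE.2]
    have hS := (normalized_integral_cappedMass_le μ hη hθ hθ1 hσ hμ hV).trans (min_le_right _ _)
    have h1 := mul_le_mul_of_nonneg_left hV hA
    have h2 := mul_le_mul_of_nonneg_left hS (by positivity : (0 : ℝ) ≤ 450 * d + 96)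
    linarith

lemma lintegral_jacobian_error_le {C : ℝ} (hC1 : 1 ≤ C)
    (hC : ∀ η u : ℝ, 0 < η → 0 ≤ u → deriv (softThreshold η) u * u ≤ C)
    (hn : n ≠ 0) (hη : 0 < η) (hη1 : η ≤ 1) (hnη : 1 / 2 ≤ n * η)
    (hθ : 0 < θ) (hθ1 : θ ≤ 1) (hσ : 0 < σ) (hμ : IsSubgaussian σ μ) (hV0 : 0 < V)
    (hV : ((2 * Real.pi) ^ ((d : ℝ) / 2))⁻¹ * ∫ x, (mass μ x / η) ^ θ ≤ V) :
    ∫⁻ z, ‖fderiv ℝ (regScore (empirical z.1) η) z.2 - fderiv ℝ (unitScore μ) z.2‖ₑ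
      ∂((Measure.pi fun _ : Fin n => μ).prod (unitLaw μ))
      ≤ ENNReal.ofReal (18 * (C + 6) * logLevel η * √(V / n)
        + 40 * (C + 1) * (9 * d + 63) * min 1 (η * V)) := by
  have hn' : (0 : ℝ) < n := by exact_mod_cast Nat.pos_of_ne_zero hn
  have hL := one_le_logLevel hη hη1
  have hE := integral_cappedEnergy μ hη
  -- The balancing parameter in `2 √(mass / n) ≤ l * mass + 1 / (l n)`. The normalized integrals of
  -- the two terms are then at most `l` and `V / (l n) = l`, as Cauchy–Schwarz over the upper region
  -- would give.
  set l := √(V / n) with hl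
  have hl0 : 0 < l := Real.sqrt_pos.2 (by positivity)
  have hl2 : l * l = V / n := Real.mul_self_sqrt (by positivity)
  set A := 9 * (C + 6) * logLevel η with hAdef
  have hA : 0 < A := by positivity
  have i0 := (integrable_mass μ).const_mul (A * l)
  have i1 := (integrable_rpow_mass_div μ hη hθ hσ hμ).const_mul (A / (l * n))
  have i2 := hE.1.const_mul (360 * (C + 1))
  have i3 := (integrable_cappedMass μ hη).const_mul (2520 * (C + 1))
  have i23 : Integrable fun x => 360 * (C + 1) * cappedEnergy μ η x
    + 2520 * (C + 1) * cappedMass μ η x := i2.add i3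
  have i123 : Integrable fun x => A / (l * n) * (mass μ x / η) ^ θ
    + (360 * (C + 1) * cappedEnergy μ η x + 2520 * (C + 1) * cappedMass μ η x) := i1.add i23
  have p0 : ∀ x, 0 ≤ A * l * mass μ x := fun x => by have := mass_pos μ x; positivity
  have p1 : ∀ x, 0 ≤ A / (l * n) * (mass μ x / η) ^ θ := fun x => by
    have := mass_pos μ x; positivity
  have p2 : ∀ x, 0 ≤ 360 * (C + 1) * cappedEnergy μ η x := fun x => by
    have := cappedEnergy_nonneg μ hη x; positivity
  have p3 : ∀ x, 0 ≤ 2520 * (C + 1) * cappedMass μ η x := fun x => by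
    have := cappedMass_nonneg μ hη x; positivity
  refine (lintegral_prod_unitLaw_le μ (measurable_jacobian_error hn μ hη)
    (B := fun x => A * l * mass μ x + (A / (l * n) * (mass μ x / η) ^ θ
      + (360 * (C + 1) * cappedEnergy μ η x + 2520 * (C + 1) * cappedMass μ η x)))
    (i0.add i123)
    (fun x => add_nonneg (p0 x) (add_nonneg (p1 x) (add_nonneg (p2 x) (p3 x)))) fun x => ?_).trans
    ?_
  · have hp0 := p0 x
    have hp1 := p1 x
    have hp2 := p2 x
    have hp3 := p3 x
    rcases le_or_gt (2 * η) (mass μ x) with h | h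
    · refine (mass_mul_lintegral_jacobian_le_of_ge hn μ x hC1 hC hη hη1 h).trans
        (ENNReal.ofReal_le_ofReal ?_)
      have hq := mass_pos μ x
      have h1 : 1 ≤ (mass μ x / η) ^ θ :=
        Real.one_le_rpow ((one_le_div hη).2 (by linarith)) hθ.le
      have h2 := le_mul_of_one_le_right (by positivity : 0 ≤ A / (l * n)) h1
      have h3 : 2 * √(mass μ x / n) ≤ l * mass μ x + 1 / (l * n) := by
        have e1 : √(mass μ x / n) ^ 2 = mass μ x / n := Real.sq_sqrt (by positivity)
        have e2 : mass μ x / n = (l * mass μ x) * (1 / (l * n)) := by field_simp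
        have e3 : 0 ≤ l * mass μ x := by positivity
        have e4 : 0 ≤ 1 / (l * n) := by positivity
        refine abs_le_of_sq_le_sq' ?_ (by positivity) |>.2
        rw [mul_pow, e1, e2]
        nlinarith [sq_nonneg (l * mass μ x - 1 / (l * n))]
      have h4 := mul_le_mul_of_nonneg_left h3 hA.le
      have h5 : A * (l * mass μ x + 1 / (l * n)) = A * l * mass μ x + A / (l * n) := by ring
      have h6 : 18 * (C + 6) * logLevel η * √(mass μ x / n) = A * (2 * √(mass μ x / n)) := by
        rw [hAdef]; ring
      rw [h6]
      linarith
    · refine (mass_mul_lintegral_jacobian_le_of_lt hn μ x hC1 hC hη hnη h).trans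
        (ENNReal.ofReal_le_ofReal ?_)
      have h1 := energy_le_cappedEnergy μ hη h
      have h2 := mass_le_cappedMass μ hη h
      have h3 : 40 * (C + 1) * (energy μ x + 21 * mass μ x)
          ≤ 40 * (C + 1) * (9 * cappedEnergy μ η x + 21 * (3 * cappedMass μ η x)) :=
        mul_le_mul_of_nonneg_left (by linarith) (by linarith)
      linarith
  · refine ENNReal.ofReal_le_ofReal ?_
    rw [integral_add i0 i123, integral_add i1 i23, integral_add i2 i3, integral_const_mul,
      integral_const_mul, integral_const_mul, integral_const_mul, hE.2, integral_mass]
    have hc : 0 < (2 * Real.pi) ^ ((d : ℝ) / 2) := by positivity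
    have hS := normalized_integral_cappedMass_le μ hη hθ hθ1 hσ hμ hV
    have h1 := mul_le_mul_of_nonneg_left hV (by positivity : 0 ≤ A / (l * n))
    have h2 := mul_le_mul_of_nonneg_left hS
      (by positivity : (0 : ℝ) ≤ 40 * (C + 1) * (9 * d + 63))
    have h3 : A / (l * n) * V = A * l := by
      have : V = l * l * n := by rw [hl2]; field_simp
      rw [this]; field_simp
    have h4 : ((2 * Real.pi) ^ ((d : ℝ) / 2))⁻¹ * (A * l * (2 * Real.pi) ^ ((d : ℝ) / 2))
        = A * l := by field_simp
    have h5 : 18 * (C + 6) * logLevel η * l = 2 * (A * l) := by rw [hAdef]; ring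
    rw [h5]
    linarith

end unitBounds

/-! ### Explicit rates at unit time -/

section rates

variable {d n : ℕ} (μ : Measure (Vec d)) [IsProbabilityMeasure μ] {σ : ℝ}

/-- The exponent is of order `1 / log n`, so that `(2/η) ^ θ ≤ e³`, because `log (2/η) ≤ 3 log n`.
The price is a Gaussian whose variance is of order `(2 + σ²) log n`, which produces the power `(log
n)^(d/2)`. -/
lemma effective_volume_le (hn : 2 ≤ n) (hσ : 0 < σ) (hμ : IsSubgaussian σ μ) :
    ((2 * Real.pi) ^ ((d : ℝ) / 2))⁻¹
      * ∫ x, (mass μ x / (Real.log n / n)) ^ (1 / (1 + Real.log n))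
      ≤ Real.exp 3 * (2 ^ d * (1 + σ ^ d) * Real.log n ^ ((d : ℝ) / 2)) := by
  have hL := log_natCast_ge hn
  have hη := level_pos hn
  have hΛ := logLevel_le hn
  set L := Real.log n
  set η := L / n
  have hθ : 0 < 1 / (1 + L) := by positivity
  refine (integral_rpow_mass_div_le μ hη hθ hσ hμ).trans ?_
  have h1 : (2 / η) ^ (1 / (1 + L)) ≤ Real.exp 3 := by
    rw [Real.rpow_def_of_pos (by positivity), Real.exp_le_exp, mul_one_div,
      div_le_iff₀ (by positivity)]
    have : Real.log (2 / η) = logLevel η / 2 := by rw [logLevel]; ring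
    rw [this]; linarith
  have h2 : ((2 + σ ^ 2) / (2 * (1 / (1 + L)))) ^ ((d : ℝ) / 2)
      ≤ 2 ^ d * (1 + σ ^ d) * L ^ ((d : ℝ) / 2) := by
    -- The constant `4` relies on `log n ≥ 0.69`; it must give a base `2 ^ d` below that of `Cd' d`.
    have e1 : (2 + σ ^ 2) / (2 * (1 / (1 + L))) ≤ 2 ^ 2 * max 1 σ ^ 2 * L := by
      have m1 : 1 ≤ max 1 σ ^ 2 := one_le_pow₀ (le_max_left _ _)
      have m2 : σ ^ 2 ≤ max 1 σ ^ 2 := pow_le_pow_left₀ hσ.le (le_max_right _ _) 2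
      have e0 : (2 + σ ^ 2) / (2 * (1 / (1 + L))) = (2 + σ ^ 2) * (1 + L) / 2 := by field_simp
      rw [e0]
      nlinarith
    have e2 : (2 ^ 2 * max 1 σ ^ 2 * L) ^ ((d : ℝ) / 2)
        = 2 ^ d * max 1 σ ^ d * L ^ ((d : ℝ) / 2) := by
      have hm : 0 ≤ max 1 σ := zero_le_one.trans (le_max_left _ _)
      have hpow : ∀ a : ℝ, 0 ≤ a → (a ^ 2) ^ ((d : ℝ) / 2) = a ^ d := fun a ha => by
        rw [← Real.rpow_natCast a 2, ← Real.rpow_mul ha, ← Real.rpow_natCast a d]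
        congr 1
        push_cast; ring
      rw [Real.mul_rpow (by positivity) (by positivity), Real.mul_rpow (by positivity)
        (by positivity), hpow 2 (by norm_num), hpow _ hm]
    have e3 : max 1 σ ^ d ≤ 1 + σ ^ d := by
      rcases le_total 1 σ with h | h
      · rw [max_eq_right h]; linarith
      · rw [max_eq_left h, one_pow]; have := pow_pos hσ d; linarith
    calc _ ≤ (2 ^ 2 * max 1 σ ^ 2 * L) ^ ((d : ℝ) / 2) :=
          Real.rpow_le_rpow (by positivity) e1 (by positivity)
      _ = 2 ^ d * max 1 σ ^ d * L ^ ((d : ℝ) / 2) := e2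
      _ ≤ _ := by gcongr
  exact mul_le_mul h1 h2 (by positivity) (by positivity)

/-- The rate of the regularized score estimator at unit time. -/
lemma exists_score_rate : ∃ A : ℝ, 0 < A ∧ ∀ (d n : ℕ) (σ : ℝ) (μ : Measure (Vec d)),
    1 ≤ d → 2 ≤ n → 0 < σ → IsProbabilityMeasure μ → IsSubgaussian σ μ →
    ∫⁻ z, ‖regScore (empirical z.1) (Real.log n / n) z.2 - unitScore μ z.2‖ₑ ^ 2
      ∂((Measure.pi fun _ : Fin n => μ).prod (unitLaw μ))
      ≤ ENNReal.ofReal (A * (d * 2 ^ d / n * (1 + σ ^ d) * Real.log n ^ ((d : ℝ) / 2 + 1))) := by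
  refine ⟨1000 * Real.exp 3, by positivity, fun d n σ μ hd hn hσ hp hμ => ?_⟩
  have hL := log_natCast_ge hn
  have hn0 : (0 : ℝ) < n := by positivity
  have hd1 : (1 : ℝ) ≤ d := by exact_mod_cast hd
  refine (lintegral_score_error_le μ (by omega) (level_pos hn) (level_le_one hn)
    (half_le_mul_level hn) (θ := 1 / (1 + Real.log n)) (by positivity)
    ((div_le_one (by positivity)).2 (by linarith)) hσ hμ (effective_volume_le μ hn hσ hμ)).trans
    (ENNReal.ofReal_le_ofReal ?_)
  have hΛ := logLevel_le hn
  rw [Real.rpow_add_one (by positivity)]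
  set L := Real.log n
  set W := 2 ^ d * (1 + σ ^ d) * L ^ ((d : ℝ) / 2) with hW
  have hW0 : 0 < W := by positivity
  have e1 : 8 * (1 + 4 * logLevel (L / n)) / n ≤ 250 * (L / n) := by
    rw [mul_div_assoc', div_le_div_iff_of_pos_right hn0]; linarith
  have e2 : 8 * (1 + 4 * logLevel (L / n)) / n * (Real.exp 3 * W)
      ≤ 250 * (L / n) * (Real.exp 3 * W) := mul_le_mul_of_nonneg_right e1 (by positivity)
  have e3 : 1000 * Real.exp 3 * (d * 2 ^ d / n * (1 + σ ^ d) * (L ^ ((d : ℝ) / 2) * L))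
      = 1000 * d * (L / n * (Real.exp 3 * W)) := by rw [hW]; ring
  rw [e3]
  have e4 : 0 < L / n * (Real.exp 3 * W) := by positivity
  nlinarith

/-- In these arithmetic lemmas `r² = 2^d / n`, `s² = σ^d`, `l² = (log n)^(d/2)`, `L = log n` and `e
= exp 3`. -/
lemma sqrt_rate_le {e r s l : ℝ} (he1 : 1 ≤ e) (hr0 : 0 < r) (hs0 : 0 < s) (hl0 : 0 < l) :
    √(e * (1 + s ^ 2) * (r ^ 2 * l ^ 2)) ≤ e * (r * (1 + s) * l) := by
  refine Real.sqrt_le_iff.2 ⟨by positivity, ?_⟩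
  have h2 : (e * (r * (1 + s) * l)) ^ 2 = e ^ 2 * (1 + s) ^ 2 * (r ^ 2 * l ^ 2) := by ring
  rw [h2]
  refine mul_le_mul_of_nonneg_right (mul_le_mul ?_ ?_ (by positivity) (by positivity))
    (by positivity)
  · nlinarith
  · nlinarith

/-- The summand free of `σ` must drop to the square root rate. If `r * l ≤ 1` then squaring
decreases it; otherwise the bound by `1` suffices, since `2 L > 1`. -/
lemma min_rate_le {e r s l L : ℝ} (he1 : 1 ≤ e) (hr0 : 0 < r) (hs0 : 0 < s) (hl0 : 0 < l)
    (hL : 0.69 ≤ L) :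
    min 1 (e * (r * l) ^ 2 * L + e * (r ^ 2 * s ^ 2 * (l ^ 2 * L)))
      ≤ 2 * e * (r * l * L) + e * (r ^ 2 * s ^ 2 * (l ^ 2 * L)) := by
  have p1 : 0 < e * (r ^ 2 * s ^ 2 * (l ^ 2 * L)) := by positivity
  have p2 : 0 < r * l := by positivity
  rcases le_total (r * l) 1 with h | h
  · refine (min_le_right _ _).trans (add_le_add ?_ le_rfl)
    have h1 : (r * l) ^ 2 ≤ r * l := by nlinarith
    have h2 : e * (r * l) ^ 2 * L ≤ e * (r * l) * L := by gcongr
    have h3 : 0 < e * (r * l) * L := by positivity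
    linarith
  · refine (min_le_left _ _).trans ?_
    have h1 : 1 ≤ 2 * (r * l * L) := by nlinarith
    have h2 : 1 ≤ e * (2 * (r * l * L)) := one_le_mul_of_one_le_of_one_le he1 h1
    linarith

lemma jacobian_rate_arith {C e r s l L Λ d : ℝ} (hC1 : 1 ≤ C) (he1 : 1 ≤ e) (hr0 : 0 < r)
    (hs0 : 0 < s) (hl0 : 0 < l) (hL : 0.69 ≤ L) (hΛ : Λ ≤ 6 * L) (hd1 : 1 ≤ d) :
    18 * (C + 6) * Λ * √(e * (1 + s ^ 2) * (r ^ 2 * l ^ 2)) + 40 * (C + 1) * (9 * d + 63)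
      * min 1 (e * (r * l) ^ 2 * L + e * (r ^ 2 * s ^ 2 * (l ^ 2 * L)))
    ≤ 10000 * (C + 6) * e * (d * r * (1 + s) * (l * L) + d * r ^ 2 * s ^ 2 * (l ^ 2 * L)) := by
  have u1 : 18 * (C + 6) * Λ * √(e * (1 + s ^ 2) * (r ^ 2 * l ^ 2))
      ≤ 18 * (C + 6) * (6 * L) * (e * (r * (1 + s) * l)) :=
    mul_le_mul (mul_le_mul_of_nonneg_left hΛ (by positivity)) (sqrt_rate_le he1 hr0 hs0 hl0)
      (Real.sqrt_nonneg _) (by positivity)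
  have u2 : 40 * (C + 1) * (9 * d + 63)
      * min 1 (e * (r * l) ^ 2 * L + e * (r ^ 2 * s ^ 2 * (l ^ 2 * L)))
      ≤ 40 * (C + 6) * (72 * d) * (2 * e * (r * l * L) + e * (r ^ 2 * s ^ 2 * (l ^ 2 * L))) := by
    refine mul_le_mul (mul_le_mul (by linarith) (by linarith) (by positivity) (by positivity))
      (min_rate_le he1 hr0 hs0 hl0 hL) (le_min zero_le_one (by positivity)) (by positivity)
  refine (add_le_add u1 u2).trans ?_
  have p0 : 0 < (C + 6) * e := by positivity
  have p1 : 0 < r * l * L := by positivity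
  have p2 : 0 < r * l * L * s := by positivity
  have p3 : 0 < d * (r ^ 2 * s ^ 2 * (l ^ 2 * L)) := by positivity
  have w1 : r * l * L ≤ d * (r * l * L) := le_mul_of_one_le_left p1.le hd1
  have w2 : r * l * L * s ≤ d * (r * l * L * s) := le_mul_of_one_le_left p2.le hd1
  have v1 : 18 * (C + 6) * (6 * L) * (e * (r * (1 + s) * l))
      + 40 * (C + 6) * (72 * d) * (2 * e * (r * l * L) + e * (r ^ 2 * s ^ 2 * (l ^ 2 * L)))
      = (C + 6) * e * (108 * (r * l * L) + 108 * (r * l * L * s) + 5760 * (d * (r * l * L))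
        + 2880 * (d * (r ^ 2 * s ^ 2 * (l ^ 2 * L)))) := by ring
  have v2 : 10000 * (C + 6) * e * (d * r * (1 + s) * (l * L) + d * r ^ 2 * s ^ 2 * (l ^ 2 * L))
      = (C + 6) * e * (10000 * (d * (r * l * L)) + 10000 * (d * (r * l * L * s))
        + 10000 * (d * (r ^ 2 * s ^ 2 * (l ^ 2 * L)))) := by ring
  rw [v1, v2]
  exact mul_le_mul_of_nonneg_left (by linarith) p0.le

/-- The rate of the Jacobian of the regularized score estimator at unit time. -/
lemma exists_jacobian_rate : ∃ A : ℝ, 0 < A ∧ ∀ (d n : ℕ) (σ : ℝ) (μ : Measure (Vec d)),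
    1 ≤ d → 2 ≤ n → 0 < σ → IsProbabilityMeasure μ → IsSubgaussian σ μ →
    ∫⁻ z, ‖fderiv ℝ (regScore (empirical z.1) (Real.log n / n)) z.2
        - fderiv ℝ (unitScore μ) z.2‖ₑ
      ∂((Measure.pi fun _ : Fin n => μ).prod (unitLaw μ))
      ≤ ENNReal.ofReal (A * (d * √(2 ^ d / n) * (1 + σ ^ ((d : ℝ) / 2))
          * Real.log n ^ ((d : ℝ) / 4 + 1)
        + d * 2 ^ d / n * σ ^ d * Real.log n ^ ((d : ℝ) / 2 + 1))) := by
  obtain ⟨C, hC1, hC⟩ := exists_deriv_softThreshold_mul_le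
  refine ⟨10000 * (C + 6) * Real.exp 3, by positivity, fun d n σ μ hd hn hσ hp hμ => ?_⟩
  have hL := log_natCast_ge hn
  have hn0 : (0 : ℝ) < n := by positivity
  have hd1 : (1 : ℝ) ≤ d := by exact_mod_cast hd
  refine (lintegral_jacobian_error_le μ hC1 hC (by omega) (level_pos hn) (level_le_one hn)
    (half_le_mul_level hn) (θ := 1 / (1 + Real.log n)) (by positivity)
    ((div_le_one (by positivity)).2 (by linarith)) hσ hμ (by positivity)
    (effective_volume_le μ hn hσ hμ)).trans (ENNReal.ofReal_le_ofReal ?_)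
  have hΛ := logLevel_le hn
  rw [Real.rpow_add_one (by positivity), Real.rpow_add_one (by positivity)]
  set L := Real.log n
  set s := σ ^ ((d : ℝ) / 2) with hs
  have hs0 : 0 < s := by positivity
  have hs2 : s ^ 2 = σ ^ d := by
    rw [hs, ← Real.rpow_natCast, ← Real.rpow_mul hσ.le, ← Real.rpow_natCast σ d]
    congr 1; push_cast; ring
  set l := L ^ ((d : ℝ) / 4) with hl
  have hl0 : 0 < l := by positivity
  have hl2 : L ^ ((d : ℝ) / 2) = l ^ 2 := by
    rw [hl, ← Real.rpow_natCast, ← Real.rpow_mul (by positivity)]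
    congr 1; push_cast; ring
  set r := √(2 ^ d / n : ℝ) with hr
  have hr0 : 0 < r := Real.sqrt_pos.2 (by positivity)
  have hr2 : r ^ 2 = 2 ^ d / n := Real.sq_sqrt (by positivity)
  set e := Real.exp 3 with he
  have he1 : 1 ≤ e := Real.one_le_exp (by norm_num)
  have h1 : e * (2 ^ d * (1 + σ ^ d) * L ^ ((d : ℝ) / 2)) / n
      = e * (1 + s ^ 2) * (r ^ 2 * l ^ 2) := by rw [hr2, hs2, hl2]; ring
  have h2 : L / n * (e * (2 ^ d * (1 + σ ^ d) * L ^ ((d : ℝ) / 2)))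
      = e * (r * l) ^ 2 * L + e * (r ^ 2 * s ^ 2 * (l ^ 2 * L)) := by
    rw [mul_pow, hr2, hs2, hl2]; ring
  rw [h1, h2, hl2, ← hs2, mul_div_assoc, ← hr2]
  exact jacobian_rate_arith hC1 he1 hr0 hs0 hl0 hL hΛ hd1

end rates

/-! ### The law of the forward process -/

section alpha

variable {K : ℕ} {c₀ c₁ : ℝ}

lemma alphaBar_pos
    (hα : ∀ k ∈ Finset.Icc 1 K, 0 < alpha K c₀ c₁ k ∧ alpha K c₀ c₁ k < 1)
    {k : ℕ} (hk : k ≤ K) : 0 < alphaBar K c₀ c₁ k := by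
  induction k with
  | zero => simp [alphaBar]
  | succ k ih =>
    have h := (hα (k + 1) (Finset.mem_Icc.2 ⟨by omega, hk⟩)).1
    rw [alpha, Nat.add_sub_cancel] at h
    have := ih (by omega)
    exact (div_pos_iff_of_pos_right this).1 h

lemma alphaBar_succ_eq
    (hα : ∀ k ∈ Finset.Icc 1 K, 0 < alpha K c₀ c₁ k ∧ alpha K c₀ c₁ k < 1)
    {k : ℕ} (hk : k + 1 ≤ K) :
    alphaBar K c₀ c₁ (k + 1) = alpha K c₀ c₁ (k + 1) * alphaBar K c₀ c₁ k := by
  have := alphaBar_pos hα (k := k) (by omega)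
  rw [alpha, Nat.add_sub_cancel, div_mul_cancel₀ _ this.ne']

lemma alphaBar_lt_one
    (hα : ∀ k ∈ Finset.Icc 1 K, 0 < alpha K c₀ c₁ k ∧ alpha K c₀ c₁ k < 1)
    {k : ℕ} (hk : k ∈ Finset.Icc 1 K) : alphaBar K c₀ c₁ k < 1 := by
  have key : ∀ k, k ≤ K → alphaBar K c₀ c₁ k ≤ 1 := fun k => by
    induction k with
    | zero => intro _; simp [alphaBar]
    | succ k ih =>
      intro hk
      have h := hα (k + 1) (Finset.mem_Icc.2 ⟨by omega, hk⟩)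
      rw [alphaBar_succ_eq hα hk]
      exact mul_le_one₀ h.2.le (alphaBar_pos hα (by omega)).le (ih (by omega))
  obtain ⟨h1, h2⟩ := Finset.mem_Icc.1 hk
  obtain ⟨j, rfl⟩ : ∃ j, k = j + 1 := ⟨k - 1, by omega⟩
  have h := hα (j + 1) hk
  rw [alphaBar_succ_eq hα h2]
  exact mul_lt_one_of_nonneg_of_lt_one_left h.1.le h.2 (key j (by omega))

end alpha

section law

variable {d : ℕ} (p : Measure (Vec d)) [IsProbabilityMeasure p]

lemma map_smul_add_smul_eq_conv (μ ν : Measure (Vec d)) [IsProbabilityMeasure μ]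
    [IsProbabilityMeasure ν] (a b : ℝ) :
    (μ.prod ν).map (fun z => a • z.1 + b • z.2)
      = (μ.map (fun x => a • x)).conv (ν.map (fun x => b • x)) := by
  rw [Measure.conv, Measure.map_prod_map _ _ (by fun_prop) (by fun_prop),
    Measure.map_map (by fun_prop) (by fun_prop)]
  rfl

lemma isProbabilityMeasure_forwardLaw (τ : ℝ) (K : ℕ) (c₀ c₁ : ℝ) (k : ℕ) :
    IsProbabilityMeasure (forwardLaw p τ K c₀ c₁ k) := by
  induction k with
  | zero =>
    have : IsProbabilityMeasure ((stdGaussian (Vec d)).map (fun w => √τ • w)) :=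
      Measure.isProbabilityMeasure_map (by fun_prop)
    rw [forwardLaw]
    infer_instance
  | succ k ih =>
    rw [forwardLaw]
    exact Measure.isProbabilityMeasure_map (by fun_prop)

lemma charFun_stdGaussian_smul (a : ℝ) (ξ : Vec d) :
    charFun (stdGaussian (Vec d)) (a • ξ) = Complex.exp (((-(a ^ 2 * ‖ξ‖ ^ 2) / 2 : ℝ) : ℂ)) := by
  rw [charFun_stdGaussian]
  congr 1
  rw [norm_smul, Complex.ofReal_mul, mul_pow, Real.norm_eq_abs, ← Complex.ofReal_pow |a|, sq_abs]
  push_cast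
  ring

/-- The law is that of `√ᾱ_k X` plus an independent Gaussian of variance `v_k = 1 - ᾱ_k + ᾱ_k τ`:
the recursion `v_k = α_k v_(k-1) + 1 - α_k` starts from `v_0 = τ`. -/
lemma charFun_forwardLaw {τ : ℝ} (hτ : 0 ≤ τ) {K : ℕ} {c₀ c₁ : ℝ}
    (hα : ∀ k ∈ Finset.Icc 1 K, 0 < alpha K c₀ c₁ k ∧ alpha K c₀ c₁ k < 1) {k : ℕ} (hk : k ≤ K)
    (ξ : Vec d) :
    charFun (forwardLaw p τ K c₀ c₁ k) ξ = charFun p (√(alphaBar K c₀ c₁ k) • ξ)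
      * Complex.exp (((-((1 - alphaBar K c₀ c₁ k + alphaBar K c₀ c₁ k * τ) * ‖ξ‖ ^ 2) / 2 : ℝ)
        : ℂ)) := by
  induction k generalizing ξ with
  | zero =>
    have : IsProbabilityMeasure ((stdGaussian (Vec d)).map (fun w => √τ • w)) :=
      Measure.isProbabilityMeasure_map (by fun_prop)
    rw [forwardLaw, charFun_conv, charFun_map_smul, charFun_stdGaussian_smul, Real.sq_sqrt hτ]
    simp [alphaBar]
  | succ k ih =>
    have := isProbabilityMeasure_forwardLaw p τ K c₀ c₁ k
    have i1 : IsProbabilityMeasure ((forwardLaw p τ K c₀ c₁ k).map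
        (fun x => √(alpha K c₀ c₁ (k + 1)) • x)) := Measure.isProbabilityMeasure_map (by fun_prop)
    have i2 : IsProbabilityMeasure ((stdGaussian (Vec d)).map
        (fun x => √(1 - alpha K c₀ c₁ (k + 1)) • x)) :=
      Measure.isProbabilityMeasure_map (by fun_prop)
    have h := hα (k + 1) (Finset.mem_Icc.2 ⟨by omega, hk⟩)
    rw [forwardLaw, map_smul_add_smul_eq_conv, charFun_conv, charFun_map_smul, charFun_map_smul,
      charFun_stdGaussian_smul, ih (by omega), alphaBar_succ_eq hα hk,
      Real.sq_sqrt (by linarith), mul_assoc, ← Complex.exp_add, smul_smul,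
      ← Real.sqrt_mul' _ h.1.le, mul_comm (alphaBar K c₀ c₁ k)]
    congr 2
    rw [norm_smul, mul_pow, Real.norm_eq_abs, sq_abs, Real.sq_sqrt h.1.le]
    push_cast
    ring

lemma integrable_density :
    Integrable fun x => ((2 * Real.pi) ^ ((d : ℝ) / 2))⁻¹ * mass p x :=
  (integrable_mass p).const_mul _

lemma isProbabilityMeasure_unitLaw : IsProbabilityMeasure (unitLaw p) := by
  refine ⟨?_⟩
  rw [unitLaw, withDensity_apply _ MeasurableSet.univ, Measure.restrict_univ,
    ← ofReal_integral_eq_lintegral_ofReal (integrable_density p) (.of_forall fun x => by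
      have := mass_pos p x
      positivity), integral_const_mul, integral_mass, inv_mul_cancel₀ (by positivity),
    ENNReal.ofReal_one]

lemma integral_bump_mul_cexp (ξ : Vec d) :
    ∫ z : Vec d, (bump z : ℂ) * Complex.exp (inner ℝ z ξ * Complex.I)
      = (((2 * Real.pi) ^ ((d : ℝ) / 2) : ℝ) : ℂ) * Complex.exp ((-‖ξ‖ ^ 2 / 2 : ℝ) : ℂ) := by
  have h := GaussianFourier.integral_cexp_neg_mul_sq_norm_add (V := Vec d) (b := (1 / 2 : ℂ))
    (by norm_num) Complex.I ξ
  convert h using 1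
  · refine integral_congr_ae (.of_forall fun z => ?_)
    simp only
    rw [bump, Complex.ofReal_exp, ← Complex.exp_add, real_inner_comm]
    congr 1
    push_cast
    ring
  · rw [Complex.ofReal_cpow (by positivity)]
    congr 1
    · push_cast
      rw [finrank_euclideanSpace, Fintype.card_fin]
      congr 1
      ring
    · congr 1
      rw [Complex.I_sq]
      push_cast
      ring

/-- Certifies that `unitLaw p`, which is introduced through a density, has the characteristic
function of the convolution with a standard Gaussian. -/
lemma charFun_unitLaw (ξ : Vec d) :
    charFun (unitLaw p) ξ = charFun p ξ * Complex.exp ((-‖ξ‖ ^ 2 / 2 : ℝ) : ℂ) := by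
  have hm : Measurable fun x : Vec d =>
      (((2 * Real.pi) ^ ((d : ℝ) / 2))⁻¹ * mass p x).toNNReal :=
    ((continuous_mass p).measurable.const_mul _).real_toNNReal
  have hc : (0 : ℝ) < (2 * Real.pi) ^ ((d : ℝ) / 2) := by positivity
  have hexp_int : Integrable (fun z : Vec d × Vec d =>
      (bump (z.1 - z.2) : ℂ) * Complex.exp (inner ℝ z.1 ξ * Complex.I)) (volume.prod p) := by
    refine (integrable_blur_uncurry p continuous_bump integrable_bump).mono' ?_
      (.of_forall fun z => ?_)
    · have : Continuous fun z : Vec d × Vec d =>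
          (bump (z.1 - z.2) : ℂ) * Complex.exp (inner ℝ z.1 ξ * Complex.I) := by
        have := continuous_bump (d := d)
        fun_prop
      exact this.aestronglyMeasurable
    · rw [norm_mul, Complex.norm_exp_ofReal_mul_I, mul_one, Complex.norm_real,
        Real.norm_of_nonneg (bump_pos _).le]
  rw [charFun_apply, unitLaw]
  change ∫ x, Complex.exp (inner ℝ x ξ * Complex.I)
    ∂(volume.withDensity fun x =>
      ((((2 * Real.pi) ^ ((d : ℝ) / 2))⁻¹ * mass p x).toNNReal : ℝ≥0∞)) = _
  rw [integral_withDensity_eq_integral_smul hm]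
  have e1 : ∀ x : Vec d, (((2 * Real.pi) ^ ((d : ℝ) / 2))⁻¹ * mass p x).toNNReal
        • Complex.exp (inner ℝ x ξ * Complex.I)
      = (((2 * Real.pi) ^ ((d : ℝ) / 2) : ℝ) : ℂ)⁻¹
        * ∫ y, (bump (x - y) : ℂ) * Complex.exp (inner ℝ x ξ * Complex.I) ∂p := fun x => by
    have hq := mass_pos p x
    have hm' : ∫ y, (bump (x - y) : ℂ) ∂p = (mass p x : ℂ) := integral_complex_ofReal
    rw [integral_mul_const, hm', NNReal.smul_def, Real.coe_toNNReal _ (by positivity),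
      Complex.real_smul]
    push_cast
    ring
  simp only [e1]
  rw [integral_const_mul, integral_integral_swap hexp_int]
  have e2 : ∀ y : Vec d, ∫ x : Vec d, (bump (x - y) : ℂ) * Complex.exp (inner ℝ x ξ * Complex.I)
      = Complex.exp (inner ℝ y ξ * Complex.I)
        * ((((2 * Real.pi) ^ ((d : ℝ) / 2) : ℝ) : ℂ)
          * Complex.exp ((-‖ξ‖ ^ 2 / 2 : ℝ) : ℂ)) := fun y => by
    rw [← integral_add_right_eq_self _ y, ← integral_bump_mul_cexp, ← integral_const_mul]
    refine integral_congr_ae (.of_forall fun z => ?_)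
    simp only [add_sub_cancel_right, inner_add_left]
    rw [Complex.ofReal_add, add_mul, Complex.exp_add]
    ring
  simp only [e2]
  rw [integral_mul_const, charFun_apply]
  have hc' : (((2 * Real.pi) ^ ((d : ℝ) / 2) : ℝ) : ℂ) ≠ 0 := by exact_mod_cast hc.ne'
  rw [mul_left_comm, inv_mul_cancel_left₀ hc']

/-- The forward process at step `k` is a rescaling of a Gaussian smoothing at unit time. -/
lemma forwardLaw_eq_map {τ : ℝ} (hτ : 0 ≤ τ) {K : ℕ} {c₀ c₁ : ℝ}
    (hα : ∀ k ∈ Finset.Icc 1 K, 0 < alpha K c₀ c₁ k ∧ alpha K c₀ c₁ k < 1) {k : ℕ}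
    (hk : k ∈ Finset.Icc 1 K) :
    forwardLaw p τ K c₀ c₁ k
      = (unitLaw (p.map fun y => (√(time τ K c₀ c₁ k))⁻¹ • y)).map
        (fun x => (√(alphaBar K c₀ c₁ k) * √(time τ K c₀ c₁ k)) • x) := by
  have h0 := alphaBar_pos hα (Finset.mem_Icc.1 hk).2
  have h1 := alphaBar_lt_one hα hk
  have ht : 0 < time τ K c₀ c₁ k := by
    rw [time]
    exact add_pos_of_pos_of_nonneg (div_pos (by linarith) h0) hτ
  have i0 := isProbabilityMeasure_forwardLaw p τ K c₀ c₁ k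
  have i1 : IsProbabilityMeasure (p.map fun y => (√(time τ K c₀ c₁ k))⁻¹ • y) :=
    Measure.isProbabilityMeasure_map (by fun_prop)
  have i2 := isProbabilityMeasure_unitLaw (p.map fun y => (√(time τ K c₀ c₁ k))⁻¹ • y)
  have i3 : IsProbabilityMeasure ((unitLaw (p.map fun y => (√(time τ K c₀ c₁ k))⁻¹ • y)).map
        (fun x => (√(alphaBar K c₀ c₁ k) * √(time τ K c₀ c₁ k)) • x)) :=
    Measure.isProbabilityMeasure_map (by fun_prop)
  refine Measure.ext_of_charFun ?_
  ext ξ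
  have hst : 0 < √(time τ K c₀ c₁ k) := Real.sqrt_pos.2 ht
  rw [charFun_forwardLaw p hτ hα (Finset.mem_Icc.1 hk).2, charFun_map_smul, charFun_unitLaw,
    charFun_map_smul, smul_smul]
  congr 2
  · congr 1
    field_simp
  · congr 1
    -- The Gaussian parts agree because `ᾱ_k t_k = 1 - ᾱ_k + ᾱ_k τ`.
    rw [norm_smul, mul_pow, Real.norm_eq_abs, sq_abs, mul_pow, Real.sq_sqrt h0.le,
      Real.sq_sqrt ht.le, time]
    field_simp

end law

/-! ### Reduction of the forward process to unit time -/

section density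

variable {d : ℕ} (μ : Measure (Vec d)) [IsProbabilityMeasure μ] {b : ℝ}

/-- Two continuous densities agree almost everywhere, hence everywhere since Lebesgue measure
charges every nonempty open set; this pins down the choice made by `Classical.epsilon`. -/
lemma IsContDensity.density_eq {ν : Measure (Vec d)} {q : Vec d → ℝ} [SigmaFinite ν]
    (h : IsContDensity ν q) : density ν = q := by
  have h' : IsContDensity ν (density ν) := Classical.epsilon_spec ⟨q, h⟩
  have heq := h'.2.2.symm.trans h.2.2
  have hae := (withDensity_eq_iff_of_sigmaFinite
    h'.1.measurable.ennreal_ofReal.aemeasurable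
    h.1.measurable.ennreal_ofReal.aemeasurable).1 heq
  refine (Continuous.ae_eq_iff_eq volume h'.1 h.1).1 ?_
  filter_upwards [hae] with x hx
  exact (ENNReal.ofReal_eq_ofReal_iff (h'.2.1 x) (h.2.1 x)).1 hx

/-- The density of a rescaled smoothing. -/
lemma isContDensity_map_unitLaw (hb : 0 < b) :
    IsContDensity ((unitLaw μ).map fun x => b • x) fun x =>
      (b ^ d)⁻¹ * (((2 * Real.pi) ^ ((d : ℝ) / 2))⁻¹ * mass μ (b⁻¹ • x)) := by
  have hm := continuous_mass μ
  refine ⟨by fun_prop, fun x => ?_, ?_⟩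
  · have := mass_pos μ (b⁻¹ • x)
    positivity
  have hcont : Continuous fun x : Vec d =>
      ((2 * Real.pi) ^ ((d : ℝ) / 2))⁻¹ * mass μ (b⁻¹ • x) := by fun_prop
  have hF : Measurable fun x : Vec d =>
      ENNReal.ofReal (((2 * Real.pi) ^ ((d : ℝ) / 2))⁻¹ * mass μ (b⁻¹ • x)) :=
    hcont.measurable.ennreal_ofReal
  ext s hs
  have hg : Measurable fun x : Vec d => b • x := by fun_prop
  rw [Measure.map_apply hg hs, unitLaw, withDensity_apply _ (hg hs), withDensity_apply _ hs]
  have h1 := setLIntegral_map (μ := (volume : Measure (Vec d))) hs hF hg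
  simp only [inv_smul_smul₀ hb.ne'] at h1
  rw [← h1, Measure.map_addHaar_smul _ hb.ne', Measure.restrict_smul, lintegral_smul_measure,
    finrank_euclideanSpace, Fintype.card_fin, abs_of_pos (by positivity), smul_eq_mul,
    ← lintegral_const_mul _ hF]
  refine lintegral_congr fun x => ?_
  rw [← ENNReal.ofReal_mul (by positivity)]

lemma hasFDerivAt_smul_comp_smul {f : Vec d → Vec d} {f' : Vec d →L[ℝ] Vec d} {c : ℝ}
    {x : Vec d} (h : HasFDerivAt f f' (c • x)) :
    HasFDerivAt (fun x => c • f (c • x)) (c ^ 2 • f') x := by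
  have h1 := (h.comp x ((hasFDerivAt_id x).const_smul c)).const_smul c
  refine h1.congr_fderiv ?_
  ext1 v
  simp [smul_smul, sq]

lemma score_map_unitLaw (hb : 0 < b) (x : Vec d) :
    score ((unitLaw μ).map fun x => b • x) x = b⁻¹ • unitScore μ (b⁻¹ • x) := by
  have := isProbabilityMeasure_unitLaw μ
  have : IsProbabilityMeasure ((unitLaw μ).map fun x => b • x) :=
    Measure.isProbabilityMeasure_map (by fun_prop)
  rw [score, (isContDensity_map_unitLaw μ hb).density_eq]
  refine HasGradientAt.gradient ?_
  have hq := mass_pos μ (b⁻¹ • x)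
  have h1 := (((hasFDerivAt_mass μ (b⁻¹ • x)).comp x
    ((hasFDerivAt_id x).const_smul b⁻¹)).const_mul ((2 * Real.pi) ^ ((d : ℝ) / 2))⁻¹).const_mul
      (b ^ d)⁻¹
  have h2 := h1.log (by simp only [Function.comp_apply]; positivity)
  rw [hasGradientAt_iff_hasFDerivAt]
  refine h2.congr_fderiv ?_
  ext1 v
  simp only [Function.comp_apply, _root_.smul_apply, ContinuousLinearMap.comp_apply,
    ContinuousLinearMap.id_apply, innerSL_apply_apply, smul_eq_mul, inner_smul_right, unitScore,
    InnerProductSpace.toDual_apply_apply, inner_smul_left, conj_trivial]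
  field_simp

end density

lemma isSubgaussian_map {d : ℕ} {μ : Measure (Vec d)} {σ c : ℝ} (hc : 0 < c)
    (h : IsSubgaussian σ μ) :
    IsSubgaussian (σ / c) (μ.map fun y => c⁻¹ • y) := by
  intro θ hθ
  have hcont : Continuous fun y : Vec d => Real.exp ((inner ℝ y θ / (σ / c)) ^ 2) := by fun_prop
  rw [lintegral_map hcont.measurable.ennreal_ofReal (by fun_prop)]
  refine le_of_eq_of_le (lintegral_congr fun y => ?_) (h θ hθ)
  rw [inner_smul_left, conj_trivial]
  congr 3
  field_simp

/-! ### The estimator as a regularized score of the empirical measure. -/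

section estimator

variable {d n : ℕ} (data : Fin n → Vec d) {t : ℝ}

lemma kde_eq (ht : 0 < t) (x : Vec d) :
    kde data t x = 1 / (2 * Real.pi * t) ^ ((d : ℝ) / 2)
      * mass (empirical fun i => (√t)⁻¹ • data i) ((√t)⁻¹ • x) := by
  have hterm : ∀ i, gaussKernel t (data i - x) = 1 / (2 * Real.pi * t) ^ ((d : ℝ) / 2)
      * bump ((√t)⁻¹ • x - (√t)⁻¹ • data i) := fun i => ?_
  · simp only [kde, mass, blur_empirical, smul_eq_mul, hterm, ← Finset.mul_sum]
    ring
  rw [gaussKernel, bump, ← smul_sub, norm_smul, mul_pow, norm_inv, Real.norm_eq_abs,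
    abs_of_nonneg (Real.sqrt_nonneg t), inv_pow, Real.sq_sqrt ht.le, norm_sub_rev]
  congr 2
  field_simp

/-- The prefactor is the one in `kde_eq`, so after rescaling the threshold is `log n / n` for every
`t`. -/
lemma threshold_eq (d n : ℕ) (t : ℝ) :
    threshold d n t = 1 / (2 * Real.pi * t) ^ ((d : ℝ) / 2) * (Real.log n / n) := by
  rw [threshold, div_mul_div_comm, one_mul, mul_comm]

lemma scoreHat_eq (hn : n ≠ 0) (ht : 0 < t) (x : Vec d) :
    scoreHat data t x = (√t)⁻¹ • regScore (empirical fun i => (√t)⁻¹ • data i)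
      (Real.log n / n) ((√t)⁻¹ • x) := by
  have := isProbabilityMeasure_empirical hn fun i => (√t)⁻¹ • data i
  set ν := empirical fun i => (√t)⁻¹ • data i
  have hc : 0 < 1 / (2 * Real.pi * t) ^ ((d : ℝ) / 2) := by positivity
  have hkde : kde data t = fun x => 1 / (2 * Real.pi * t) ^ ((d : ℝ) / 2)
      * mass ν ((√t)⁻¹ • x) := funext (kde_eq data ht)
  have hq := mass_pos ν ((√t)⁻¹ • x)
  have hg : gradient (kde data t) x = (1 / (2 * Real.pi * t) ^ ((d : ℝ) / 2))
      • ((√t)⁻¹ • drift ν ((√t)⁻¹ • x)) := by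
    refine HasGradientAt.gradient ?_
    rw [hkde, hasGradientAt_iff_hasFDerivAt]
    have h1 := (((hasFDerivAt_mass ν ((√t)⁻¹ • x)).comp x
      ((hasFDerivAt_id x).const_smul (√t)⁻¹)).const_mul (1 / (2 * Real.pi * t) ^ ((d : ℝ) / 2)))
    refine h1.congr_fderiv ?_
    ext1 v
    simp only [_root_.smul_apply, ContinuousLinearMap.comp_apply,
      ContinuousLinearMap.id_apply, innerSL_apply_apply, smul_eq_mul, inner_smul_right,
      InnerProductSpace.toDual_apply_apply, inner_smul_left, conj_trivial]
  rw [scoreHat, hg, threshold_eq, congrFun hkde x, softThreshold_mul_mul hc, regScore, smul_smul,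
    smul_smul, smul_smul]
  congr 1
  generalize mass ν ((√t)⁻¹ • x) = q at hq
  field_simp

end estimator

/-! ### Errors at step `k` as errors at unit time. -/

section reduction

variable {d n K : ℕ} {τ c₀ c₁ : ℝ} {k : ℕ}

/-- The ratio between the forward process and a Gaussian smoothing at unit time. -/
def scale (τ : ℝ) (K : ℕ) (c₀ c₁ : ℝ) (k : ℕ) : ℝ :=
  √(alphaBar K c₀ c₁ k) * √(time τ K c₀ c₁ k)

lemma time_pos (hτ : 0 ≤ τ)
    (hα : ∀ k ∈ Finset.Icc 1 K, 0 < alpha K c₀ c₁ k ∧ alpha K c₀ c₁ k < 1)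
    (hk : k ∈ Finset.Icc 1 K) : 0 < time τ K c₀ c₁ k := by
  have h0 := alphaBar_pos hα (Finset.mem_Icc.1 hk).2
  have h1 := alphaBar_lt_one hα hk
  rw [time]
  exact add_pos_of_pos_of_nonneg (div_pos (by linarith) h0) hτ

lemma scale_pos (hτ : 0 ≤ τ)
    (hα : ∀ k ∈ Finset.Icc 1 K, 0 < alpha K c₀ c₁ k ∧ alpha K c₀ c₁ k < 1)
    (hk : k ∈ Finset.Icc 1 K) : 0 < scale τ K c₀ c₁ k :=
  mul_pos (Real.sqrt_pos.2 (alphaBar_pos hα (Finset.mem_Icc.1 hk).2))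
    (Real.sqrt_pos.2 (time_pos hτ hα hk))

/-- `scale² = 1 - ᾱ_k + ᾱ_k τ` is at least `1 - ᾱ_k`, so the weights in the averaged errors cancel
the factor produced by rescaling. -/
lemma one_sub_alphaBar_mul_le (hτ : 0 ≤ τ)
    (hα : ∀ k ∈ Finset.Icc 1 K, 0 < alpha K c₀ c₁ k ∧ alpha K c₀ c₁ k < 1)
    (hk : k ∈ Finset.Icc 1 K) :
    (1 - alphaBar K c₀ c₁ k) * (scale τ K c₀ c₁ k)⁻¹ ^ 2 ≤ 1 := by
  have h0 := alphaBar_pos hα (Finset.mem_Icc.1 hk).2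
  have ht := time_pos hτ hα hk
  rw [inv_pow, scale, mul_pow, Real.sq_sqrt h0.le, Real.sq_sqrt ht.le, ← div_eq_mul_inv,
    div_le_one (by positivity), time, mul_add, mul_div_cancel₀ _ h0.ne']
  nlinarith

lemma scoreHatX_eq (hn : n ≠ 0) (hτ : 0 ≤ τ)
    (hα : ∀ k ∈ Finset.Icc 1 K, 0 < alpha K c₀ c₁ k ∧ alpha K c₀ c₁ k < 1)
    (hk : k ∈ Finset.Icc 1 K) (data : Fin n → Vec d) :
    scoreHatX data τ K c₀ c₁ k = fun x => (scale τ K c₀ c₁ k)⁻¹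
      • regScore (empirical fun i => (√(time τ K c₀ c₁ k))⁻¹ • data i) (Real.log n / n)
        ((scale τ K c₀ c₁ k)⁻¹ • x) := by
  ext1 x
  rw [scoreHatX, scoreHat_eq data hn (time_pos hτ hα hk), smul_smul, smul_smul, one_div, scale,
    mul_inv, mul_comm (√(time τ K c₀ c₁ k))⁻¹]

variable (p : Measure (Vec d)) [IsProbabilityMeasure p]

lemma score_forwardLaw_eq (hτ : 0 ≤ τ)
    (hα : ∀ k ∈ Finset.Icc 1 K, 0 < alpha K c₀ c₁ k ∧ alpha K c₀ c₁ k < 1)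
    (hk : k ∈ Finset.Icc 1 K) :
    score (forwardLaw p τ K c₀ c₁ k) = fun x => (scale τ K c₀ c₁ k)⁻¹
      • unitScore (p.map fun y => (√(time τ K c₀ c₁ k))⁻¹ • y) ((scale τ K c₀ c₁ k)⁻¹ • x) := by
  have : IsProbabilityMeasure (p.map fun y => (√(time τ K c₀ c₁ k))⁻¹ • y) :=
    Measure.isProbabilityMeasure_map (by fun_prop)
  ext1 x
  rw [forwardLaw_eq_map p hτ hα hk]
  exact score_map_unitLaw _ (scale_pos hτ hα hk) x

lemma regularity_forwardLaw (hn : 2 ≤ n) (hτ : 0 ≤ τ)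
    (hα : ∀ k ∈ Finset.Icc 1 K, 0 < alpha K c₀ c₁ k ∧ alpha K c₀ c₁ k < 1)
    (hk : k ∈ Finset.Icc 1 K) :
    IsContDensity (forwardLaw p τ K c₀ c₁ k) (density (forwardLaw p τ K c₀ c₁ k)) ∧
      (∀ x, 0 < density (forwardLaw p τ K c₀ c₁ k) x) ∧
      Differentiable ℝ (density (forwardLaw p τ K c₀ c₁ k)) ∧
      Differentiable ℝ (score (forwardLaw p τ K c₀ c₁ k)) ∧
      ∀ data : Fin n → Vec d, Differentiable ℝ (scoreHatX data τ K c₀ c₁ k) := by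
  have := isProbabilityMeasure_forwardLaw p τ K c₀ c₁ k
  have : IsProbabilityMeasure (p.map fun y => (√(time τ K c₀ c₁ k))⁻¹ • y) :=
    Measure.isProbabilityMeasure_map (by fun_prop)
  have hb := scale_pos hτ hα hk
  have hd := isContDensity_map_unitLaw (p.map fun y => (√(time τ K c₀ c₁ k))⁻¹ • y) hb
  have hlaw : (unitLaw (p.map fun y => (√(time τ K c₀ c₁ k))⁻¹ • y)).map
      (fun x => scale τ K c₀ c₁ k • x) = forwardLaw p τ K c₀ c₁ k :=
    (forwardLaw_eq_map p hτ hα hk).symm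
  rw [hlaw] at hd
  rw [hd.density_eq]
  refine ⟨hd, fun x => ?_, fun x => ?_, fun x => ?_, fun data x => ?_⟩
  · have := mass_pos (p.map fun y => (√(time τ K c₀ c₁ k))⁻¹ • y) ((scale τ K c₀ c₁ k)⁻¹ • x)
    positivity
  · exact ((((hasFDerivAt_mass _ _).comp x
      ((hasFDerivAt_id x).const_smul (scale τ K c₀ c₁ k)⁻¹)).const_mul _).const_mul
        _).differentiableAt
  · rw [score_forwardLaw_eq p hτ hα hk]
    exact (hasFDerivAt_smul_comp_smul (hasFDerivAt_unitScore _ _)).differentiableAt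
  · rw [scoreHatX_eq (by omega) hτ hα hk]
    have := isProbabilityMeasure_empirical (by omega)
      fun i => (√(time τ K c₀ c₁ k))⁻¹ • data i
    exact (hasFDerivAt_smul_comp_smul
      (hasFDerivAt_regScore _ _ (level_pos hn))).differentiableAt

lemma isPositive_fderiv_scoreHatX (hn : 2 ≤ n) (hτ : 0 ≤ τ)
    (hα : ∀ k ∈ Finset.Icc 1 K, 0 < alpha K c₀ c₁ k ∧ alpha K c₀ c₁ k < 1)
    (hk : k ∈ Finset.Icc 1 K) (data : Fin n → Vec d) (x : Vec d) :
    (fderiv ℝ (scoreHatX data τ K c₀ c₁ k) x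
      + (1 / (1 - alphaBar K c₀ c₁ k)) • ContinuousLinearMap.id ℝ (Vec d)).IsPositive := by
  have h1 := alphaBar_lt_one hα hk
  have hb := scale_pos hτ hα hk
  have hle := one_sub_alphaBar_mul_le hτ hα hk
  have := isProbabilityMeasure_empirical (by omega) fun i => (√(time τ K c₀ c₁ k))⁻¹ • data i
  rw [scoreHatX_eq (by omega) hτ hα hk]
  set ν := empirical fun i => (√(time τ K c₀ c₁ k))⁻¹ • data i
  set b := scale τ K c₀ c₁ k
  have hreg := (hasFDerivAt_regScore ν (b⁻¹ • x) (level_pos hn)).differentiableAt.hasFDerivAt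
  rw [(hasFDerivAt_smul_comp_smul hreg).fderiv]
  -- In unit coordinates the multiple of the identity is `scale² / (1 - ᾱ_k)`, which is large enough
  -- for the bound at unit time.
  have hr : 1 ≤ b ^ 2 / (1 - alphaBar K c₀ c₁ k) := by
    rw [one_le_div (by linarith)]
    rw [inv_pow, ← div_eq_mul_inv, div_le_one (by positivity)] at hle
    exact hle
  have hpos := isPositive_fderiv_regScore ν (b⁻¹ • x) (level_pos hn) hr
  have heq : b⁻¹ ^ 2 • fderiv ℝ (regScore ν (Real.log n / n)) (b⁻¹ • x)
      + (1 / (1 - alphaBar K c₀ c₁ k)) • ContinuousLinearMap.id ℝ (Vec d)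
      = (b⁻¹ ^ 2) • (fderiv ℝ (regScore ν (Real.log n / n)) (b⁻¹ • x)
        + (b ^ 2 / (1 - alphaBar K c₀ c₁ k)) • ContinuousLinearMap.id ℝ (Vec d)) := by
    rw [smul_add, smul_smul]
    congr 2
    field_simp
  rw [heq]
  exact hpos.smul_of_nonneg (by positivity)

/-- The joint law of the sample and the forward process, rescaled to unit time. -/
lemma map_pi_prod_forwardLaw (n : ℕ) (hτ : 0 ≤ τ)
    (hα : ∀ k ∈ Finset.Icc 1 K, 0 < alpha K c₀ c₁ k ∧ alpha K c₀ c₁ k < 1)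
    (hk : k ∈ Finset.Icc 1 K) :
    ((Measure.pi fun _ : Fin n => p).prod (forwardLaw p τ K c₀ c₁ k)).map
      (Prod.map (fun data i => (√(time τ K c₀ c₁ k))⁻¹ • data i)
        (fun x => (scale τ K c₀ c₁ k)⁻¹ • x))
      = (Measure.pi fun _ : Fin n => p.map fun y => (√(time τ K c₀ c₁ k))⁻¹ • y).prod
        (unitLaw (p.map fun y => (√(time τ K c₀ c₁ k))⁻¹ • y)) := by
  have := isProbabilityMeasure_forwardLaw p τ K c₀ c₁ k
  have : IsProbabilityMeasure (p.map fun y => (√(time τ K c₀ c₁ k))⁻¹ • y) :=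
    Measure.isProbabilityMeasure_map (by fun_prop)
  have hb := scale_pos hτ hα hk
  rw [← Measure.map_prod_map _ _ (by fun_prop) (by fun_prop)]
  congr 1
  · exact Measure.pi_map_pi (μ := fun _ : Fin n => p) (f := fun _ y =>
      (√(time τ K c₀ c₁ k))⁻¹ • y) fun _ => by fun_prop
  · rw [forwardLaw_eq_map p hτ hα hk, Measure.map_map (by fun_prop) (by fun_prop)]
    convert Measure.map_id
    ext1 x
    simp only [Function.comp_apply, id_eq]
    exact inv_smul_smul₀ hb.ne' x

/-- Both scores have the form `c • f (c • x)` with `c = scale⁻¹`. The squared norm brings out `c²`;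
for the Jacobian, `c²` comes from the outer factor and the chain rule. -/
lemma scErrSq_eq (hn : 2 ≤ n) (hτ : 0 ≤ τ)
    (hα : ∀ k ∈ Finset.Icc 1 K, 0 < alpha K c₀ c₁ k ∧ alpha K c₀ c₁ k < 1)
    (hk : k ∈ Finset.Icc 1 K) :
    scErrSq p n τ K c₀ c₁ k = ENNReal.ofReal ((scale τ K c₀ c₁ k)⁻¹ ^ 2)
      * ∫⁻ z, ‖regScore (empirical z.1) (Real.log n / n) z.2
        - unitScore (p.map fun y => (√(time τ K c₀ c₁ k))⁻¹ • y) z.2‖ₑ ^ 2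
      ∂((Measure.pi fun _ : Fin n => p.map fun y => (√(time τ K c₀ c₁ k))⁻¹ • y).prod
        (unitLaw (p.map fun y => (√(time τ K c₀ c₁ k))⁻¹ • y))) := by
  have : IsProbabilityMeasure (p.map fun y => (√(time τ K c₀ c₁ k))⁻¹ • y) :=
    Measure.isProbabilityMeasure_map (by fun_prop)
  have hb := scale_pos hτ hα hk
  rw [← map_pi_prod_forwardLaw p n hτ hα hk, lintegral_map (measurable_score_error (by omega) _
    (level_pos hn)) (by fun_prop), ← lintegral_const_mul' _ _ ENNReal.ofReal_ne_top, scErrSq]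
  refine lintegral_congr fun z => ?_
  rw [scoreHatX_eq (by omega) hτ hα hk, score_forwardLaw_eq p hτ hα hk]
  simp only [Prod.map_fst, Prod.map_snd]
  rw [← smul_sub, enorm_smul, mul_pow, enorm_sq_eq_ofReal, Real.norm_eq_abs, sq_abs]

lemma jcbErr_eq (hn : 2 ≤ n) (hτ : 0 ≤ τ)
    (hα : ∀ k ∈ Finset.Icc 1 K, 0 < alpha K c₀ c₁ k ∧ alpha K c₀ c₁ k < 1)
    (hk : k ∈ Finset.Icc 1 K) :
    jcbErr p n τ K c₀ c₁ k = ENNReal.ofReal ((scale τ K c₀ c₁ k)⁻¹ ^ 2)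
      * ∫⁻ z, ‖fderiv ℝ (regScore (empirical z.1) (Real.log n / n)) z.2
        - fderiv ℝ (unitScore (p.map fun y => (√(time τ K c₀ c₁ k))⁻¹ • y)) z.2‖ₑ
      ∂((Measure.pi fun _ : Fin n => p.map fun y => (√(time τ K c₀ c₁ k))⁻¹ • y).prod
        (unitLaw (p.map fun y => (√(time τ K c₀ c₁ k))⁻¹ • y))) := by
  have : IsProbabilityMeasure (p.map fun y => (√(time τ K c₀ c₁ k))⁻¹ • y) :=
    Measure.isProbabilityMeasure_map (by fun_prop)
  have hb := scale_pos hτ hα hk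
  rw [← map_pi_prod_forwardLaw p n hτ hα hk, lintegral_map (measurable_jacobian_error (by omega) _
    (level_pos hn)) (by fun_prop), ← lintegral_const_mul' _ _ ENNReal.ofReal_ne_top, jcbErr]
  refine lintegral_congr fun z => ?_
  have := isProbabilityMeasure_empirical (by omega)
    fun i => (√(time τ K c₀ c₁ k))⁻¹ • z.1 i
  rw [scoreHatX_eq (by omega) hτ hα hk, score_forwardLaw_eq p hτ hα hk,
    (hasFDerivAt_smul_comp_smul
      (hasFDerivAt_regScore _ _ (level_pos hn)).differentiableAt.hasFDerivAt).fderiv,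
    (hasFDerivAt_smul_comp_smul
      (hasFDerivAt_unitScore _ _).differentiableAt.hasFDerivAt).fderiv]
  simp only [Prod.map_fst, Prod.map_snd]
  have hsmul (c : ℝ) (A B : Vec d →L[ℝ] Vec d) : ‖c ^ 2 • A - c ^ 2 • B‖ₑ
      = ENNReal.ofReal (c ^ 2) * ‖A - B‖ₑ := by
    rw [show c ^ 2 • A - c ^ 2 • B = c ^ 2 • (A - B) from (smul_sub (c ^ 2) A B).symm,
      enorm_smul, ← ofReal_norm (c ^ 2), Real.norm_of_nonneg (by positivity)]
  exact hsmul _ _ _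

end reduction

/-! ### Averaging over the steps of the forward process -/

section schedule

variable {d K : ℕ} {τ c₀ c₁ a : ℝ} {k : ℕ}

/-- With `h = c₁ log K / K` and `b = ᾱ_(k+1)`, one step multiplies the ratio by `(1 + h b) / (1 - h
(1 - b))`. This is at least `1 + h`, since `(1 + h)(1 - h (1 - b)) = 1 + h b - h² (1 - b)`. The
exponent lags the index by one because the recursion starts at `k = 1`, where `1 - ᾱ_1 = K^(-c₀)`.
-/
lemma inv_mul_pow_le_noise_ratio (hc₁ : 0 ≤ c₁) (hK : 1 ≤ K)
    (hα : ∀ k ∈ Finset.Icc 1 K, 0 < alpha K c₀ c₁ k ∧ alpha K c₀ c₁ k < 1) (hk : k + 1 ≤ K) :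
    ((K : ℝ) ^ c₀)⁻¹ * (1 + c₁ * Real.log K / K) ^ k
      ≤ (1 - alphaBar K c₀ c₁ (k + 1)) / alphaBar K c₀ c₁ (k + 1) := by
  have hh : 0 ≤ c₁ * Real.log K / K := by
    have := Real.log_natCast_nonneg K
    positivity
  induction k with
  | zero =>
    have h0 := alphaBar_pos hα hk
    have h1 := alphaBar_lt_one hα (Finset.mem_Icc.2 ⟨le_rfl, hk⟩)
    rw [le_div_iff₀ h0]
    have h2 : 1 - alphaBar K c₀ c₁ 1 = ((K : ℝ) ^ c₀)⁻¹ := by simp [alphaBar]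
    simp only [zero_add, pow_zero, mul_one] at *
    rw [h2]
    exact mul_le_of_le_one_right (by positivity) h1.le
  | succ k ih =>
    have hk' : k + 1 ≤ K := by omega
    have h0 := alphaBar_pos hα hk'
    have h1 := alphaBar_lt_one hα (Finset.mem_Icc.2 ⟨by omega, hk'⟩)
    have h0' := alphaBar_pos hα hk
    have hrec : alphaBar K c₀ c₁ (k + 1 + 1) = alphaBar K c₀ c₁ (k + 1)
      - c₁ * Real.log K / K * alphaBar K c₀ c₁ (k + 1) * (1 - alphaBar K c₀ c₁ (k + 1)) := rfl
    refine le_trans ?_ ((?_ : (1 - alphaBar K c₀ c₁ (k + 1)) / alphaBar K c₀ c₁ (k + 1)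
      * (1 + c₁ * Real.log K / K) ≤ _))
    · rw [pow_succ, ← mul_assoc]
      exact mul_le_mul_of_nonneg_right (ih hk') (by positivity)
    · rw [le_div_iff₀ h0', hrec]
      generalize c₁ * Real.log K / K = h at *
      generalize alphaBar K c₀ c₁ (k + 1) = b at *
      have : (1 - b) / b * (1 + h) * (b - h * b * (1 - b))
          = (1 - b) * (1 + h) * (1 - h * (1 - b)) := by
        field_simp
      rw [this]
      nlinarith [mul_nonneg (mul_nonneg hh hh)
        (mul_nonneg (sub_nonneg.2 h1.le) (sub_nonneg.2 h1.le))]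

/-- Bernoulli's inequality gives `(1 - m/8)⁴ ≥ 1 - m/2`, and `1 - m/2 ≥ 1/(1 + h)` when `m ≤ min(h,
1)`. The auxiliary `m` is there because `h` is not assumed to be at most one. -/
lemma rpow_neg_quarter_le {h m : ℝ} (hm : 0 ≤ m) (hmh : m ≤ h) (hm1 : m ≤ 1) :
    (1 + h) ^ (-(1 / 4) : ℝ) ≤ 1 - m / 8 := by
  have hh : 0 < 1 + h := by linarith
  refine le_of_pow_le_pow_left₀ (n := 4) (by norm_num) (by linarith) ?_
  have h4 : ((1 + h) ^ (-(1 / 4) : ℝ)) ^ 4 = (1 + h)⁻¹ := by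
    rw [← Real.rpow_natCast, ← Real.rpow_mul hh.le]
    norm_num
    exact Real.rpow_neg_one _
  rw [h4]
  have hb := one_add_mul_le_pow (a := -(m / 8)) (by linarith) 4
  have h1 : (1 + h)⁻¹ ≤ 1 - m / 2 := by
    rw [inv_le_iff_one_le_mul₀ hh]
    nlinarith
  calc (1 + h)⁻¹ ≤ 1 - m / 2 := h1
    _ ≤ _ := by
      rw [sub_eq_add_neg 1 (m / 8)]
      refine le_trans (le_of_eq ?_) hb
      push_cast
      ring

/-- The exponents to be used are `d/2` and `d/4` with `d ≥ 1`, so `1/4` is a common lower bound; it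
gives a geometric ratio that does not depend on `d`. -/
lemma time_rpow_neg_le (hc₁ : 0 ≤ c₁) (hτ : 0 ≤ τ) (ha : 1 / 4 ≤ a)
    (hα : ∀ k ∈ Finset.Icc 1 K, 0 < alpha K c₀ c₁ k ∧ alpha K c₀ c₁ k < 1) (hk : k + 1 ≤ K) :
    time τ K c₀ c₁ (k + 1) ^ (-a)
      ≤ (K : ℝ) ^ (c₀ * a) * ((1 + c₁ * Real.log K / K) ^ (-(1 / 4) : ℝ)) ^ k := by
  have hK0 : (0 : ℝ) < K := by exact_mod_cast (by omega : 0 < K)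
  have hh : 0 ≤ c₁ * Real.log K / K := by
    have := Real.log_natCast_nonneg K
    positivity
  have h1 : ((K : ℝ) ^ c₀)⁻¹ * (1 + c₁ * Real.log K / K) ^ k ≤ time τ K c₀ c₁ (k + 1) :=
    (inv_mul_pow_le_noise_ratio hc₁ (by omega) hα hk).trans (by rw [time]; linarith)
  generalize c₁ * Real.log K / K = h at *
  have hpos : 0 < 1 + h := by linarith
  calc time τ K c₀ c₁ (k + 1) ^ (-a) ≤ (((K : ℝ) ^ c₀)⁻¹ * (1 + h) ^ k) ^ (-a) :=
        Real.rpow_le_rpow_of_nonpos (by positivity) h1 (by linarith)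
    _ = (K : ℝ) ^ (c₀ * a) * (1 + h) ^ (-(k * a)) := by
        rw [Real.mul_rpow (by positivity) (by positivity), ← Real.rpow_neg hK0.le,
          ← Real.rpow_mul hK0.le, ← Real.rpow_natCast (1 + h), ← Real.rpow_mul hpos.le]
        congr 2 <;> ring
    _ ≤ _ := by
        rw [← Real.rpow_natCast, ← Real.rpow_mul hpos.le]
        refine mul_le_mul_of_nonneg_left ?_ (by positivity)
        refine Real.rpow_le_rpow_of_exponent_le (by linarith) ?_
        nlinarith [(Nat.cast_nonneg k : (0 : ℝ) ≤ k)]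

lemma average_time_rpow_neg_le {cmin : ℝ} (hcmin : 0 < cmin) (hc : cmin ≤ c₀) (hc₁ : 5 * c₀ ≤ c₁)
    (hK : 2 ≤ K) (hτ : 0 ≤ τ) (ha : 1 / 4 ≤ a)
    (hα : ∀ k ∈ Finset.Icc 1 K, 0 < alpha K c₀ c₁ k ∧ alpha K c₀ c₁ k < 1) :
    (K : ℝ)⁻¹ * ∑ k ∈ Finset.Icc 1 K, time τ K c₀ c₁ k ^ (-a)
      ≤ 8 / min (5 * cmin) 1 * ((K : ℝ) ^ (c₀ * a) / Real.log K) := by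
  have hK0 : (0 : ℝ) < K := by exact_mod_cast (by omega : 0 < K)
  have hlog : 0 < Real.log K := Real.log_pos (by exact_mod_cast (by omega : 1 < K))
  have hlogK : Real.log K ≤ K := (Real.log_le_sub_one_of_pos hK0).trans (by linarith)
  -- Chosen so that `m = e log K / K` is at most both `c₁ log K / K` and `1`; the geometric sum is
  -- then at most `8 / m`, and `8 / e` depends on `cmin` alone.
  set e := min (5 * cmin) 1
  have he : 0 < e := lt_min (by linarith) one_pos
  have he1 : e ≤ 1 := min_le_right _ _
  have he5 : e ≤ c₁ := (min_le_left _ _).trans (by linarith)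
  set m := e * Real.log K / K with hm
  have hm0 : 0 < m := by positivity
  have hm1 : m ≤ 1 := by
    rw [hm, div_le_one hK0]
    nlinarith
  have hmh : m ≤ c₁ * Real.log K / K := by
    rw [hm]
    gcongr
  set r := (1 + c₁ * Real.log K / K) ^ (-(1 / 4) : ℝ) with hr
  have hr0 : 0 ≤ r := Real.rpow_nonneg (by linarith) _
  have hr1 : r ≤ 1 - m / 8 := rpow_neg_quarter_le hm0.le hmh hm1
  have hgeom : ∑ j ∈ Finset.range K, r ^ j ≤ 8 / m := by
    rw [le_div_iff₀ hm0]
    have h1 := geom_sum_mul_neg r K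
    have h2 : 0 ≤ ∑ j ∈ Finset.range K, r ^ j := Finset.sum_nonneg fun _ _ => by positivity
    nlinarith [pow_nonneg hr0 K]
  have hsum : ∑ k ∈ Finset.Icc 1 K, time τ K c₀ c₁ k ^ (-a)
      ≤ (K : ℝ) ^ (c₀ * a) * ∑ j ∈ Finset.range K, r ^ j := by
    have hshift : ∑ k ∈ Finset.Icc 1 K, time τ K c₀ c₁ k ^ (-a)
        = ∑ j ∈ Finset.range K, time τ K c₀ c₁ (j + 1) ^ (-a) := by
      rw [Finset.range_eq_Ico, Finset.sum_Ico_add' (fun k => time τ K c₀ c₁ k ^ (-a)) 0 K 1]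
      rfl
    rw [hshift, Finset.mul_sum]
    refine Finset.sum_le_sum fun j hj => time_rpow_neg_le (by linarith) hτ ha hα ?_
    have := Finset.mem_range.1 hj
    omega
  calc (K : ℝ)⁻¹ * ∑ k ∈ Finset.Icc 1 K, time τ K c₀ c₁ k ^ (-a)
      ≤ (K : ℝ)⁻¹ * ((K : ℝ) ^ (c₀ * a) * (8 / m)) := by gcongr; exact hsum.trans (by gcongr)
    _ = _ := by
      rw [hm]
      field_simp

/-- The factor `d` compensates for the `d` in the denominator of `capRate`. In the other branch
every `t_k` is at least `τ`, and enlarging by `d` is harmless. -/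
lemma average_time_rpow_neg_le_capRate {cmin : ℝ} (hcmin : 0 < cmin) (hc : cmin ≤ c₀)
    (hc₁ : 5 * c₀ ≤ c₁) (hd : 1 ≤ d) (hK : 2 ≤ K) (hτ : 0 ≤ τ) (ha : 1 / 4 ≤ a)
    (hα : ∀ k ∈ Finset.Icc 1 K, 0 < alpha K c₀ c₁ k ∧ alpha K c₀ c₁ k < 1) :
    (K : ℝ)⁻¹ * ∑ k ∈ Finset.Icc 1 K, time τ K c₀ c₁ k ^ (-a)
      ≤ 8 / min (5 * cmin) 1 * d * capRate d K c₀ τ a := by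
  have hd1 : (1 : ℝ) ≤ d := by exact_mod_cast hd
  have hK0 : (0 : ℝ) < K := by exact_mod_cast (by omega : 0 < K)
  have hlog : 0 < Real.log K := Real.log_pos (by exact_mod_cast (by omega : 1 < K))
  have he : 0 < min (5 * cmin) 1 := lt_min (by linarith) one_pos
  have hB : 1 ≤ 8 / min (5 * cmin) 1 := by
    rw [one_le_div he]
    exact (min_le_right _ _).trans (by norm_num)
  have hgeom : (K : ℝ)⁻¹ * ∑ k ∈ Finset.Icc 1 K, time τ K c₀ c₁ k ^ (-a)
      ≤ 8 / min (5 * cmin) 1 * d * ((K : ℝ) ^ (c₀ * a) / (d * Real.log K)) := by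
    refine (average_time_rpow_neg_le hcmin hc hc₁ hK hτ ha hα).trans (le_of_eq ?_)
    field_simp
  rw [capRate]
  split_ifs with h0
  · exact hgeom
  have hτ' : 0 < τ := lt_of_le_of_ne hτ (Ne.symm h0)
  rw [mul_min_of_nonneg _ _ (by positivity)]
  refine le_min ?_ hgeom
  have hle : ∑ k ∈ Finset.Icc 1 K, time τ K c₀ c₁ k ^ (-a) ≤ K * τ ^ (-a) := by
    refine (Finset.sum_le_card_nsmul _ _ (τ ^ (-a)) fun k hk => ?_).trans (le_of_eq (by simp))
    refine Real.rpow_le_rpow_of_nonpos hτ' ?_ (by linarith)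
    have h1 := alphaBar_pos hα (Finset.mem_Icc.1 hk).2
    have h2 := alphaBar_lt_one hα hk
    rw [time]
    have := div_nonneg (sub_nonneg.2 h2.le) h1.le
    linarith
  calc (K : ℝ)⁻¹ * ∑ k ∈ Finset.Icc 1 K, time τ K c₀ c₁ k ^ (-a)
      ≤ (K : ℝ)⁻¹ * (K * τ ^ (-a)) := by gcongr
    _ = 1 * τ ^ (-a) := by field_simp
    _ ≤ _ := by
      gcongr
      exact one_le_mul_of_one_le_of_one_le hB hd1

lemma capRate_nonneg (d K : ℕ) (c₀ : ℝ) (hτ : 0 ≤ τ) (a : ℝ) : 0 ≤ capRate d K c₀ τ a := by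
  have := Real.log_natCast_nonneg K
  rw [capRate]
  split_ifs <;> positivity

end schedule

/-! ### Absorption of dimension factors and conversion to extended nonnegative reals. -/

section constants

/-- Polynomial factors in the dimension are absorbed by the gap between `2 ^ d` and `Cd' d`. -/
lemma exists_sq_mul_two_pow_le : ∃ D : ℝ, 0 < D ∧ ∀ d : ℕ,
    (d : ℝ) ^ 2 * 2 ^ d ≤ D * Cd' d ∧ (d : ℝ) ^ 2 * √(2 ^ d) ≤ D * √(Cd' d) := by
  -- `√(3/2)` is the gap between `√(2^d)` and `√(3^d)`, the tighter of the two requirements; the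
  -- polynomial `d²` is beaten by its powers.
  have hr : 1 < √(3 / 2 : ℝ) := by
    rw [Real.lt_sqrt (by norm_num)]
    norm_num
  obtain ⟨D, hD⟩ := (tendsto_pow_const_div_const_pow_of_one_lt 2 hr).bddAbove_range
  have hD' (d : ℕ) : (d : ℝ) ^ 2 ≤ max D 1 * √(3 / 2) ^ d := by
    have := hD ⟨d, rfl⟩
    simp only at this
    rw [div_le_iff₀ (by positivity)] at this
    exact this.trans (by gcongr; exact le_max_left _ _)
  -- After squaring this is `9 π ≤ 32`.
  have hC : 3 ≤ 4 * √2 / √Real.pi := by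
    rw [le_div_iff₀ (by positivity)]
    refine le_of_pow_le_pow_left₀ (n := 2) (by norm_num) (by positivity) ?_
    rw [mul_pow, mul_pow, Real.sq_sqrt (by positivity), Real.sq_sqrt (by positivity)]
    nlinarith [Real.pi_lt_d2]
  have hCd (d : ℕ) : (3 : ℝ) ^ d ≤ Cd' d := by
    rw [Cd']
    gcongr
  refine ⟨max D 1, by positivity, fun d => ⟨?_, ?_⟩⟩
  · calc (d : ℝ) ^ 2 * 2 ^ d ≤ max D 1 * √(3 / 2) ^ d * 2 ^ d := by gcongr; exact hD' d
      _ ≤ max D 1 * (3 / 2) ^ d * 2 ^ d := by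
        gcongr
        rw [Real.sqrt_le_left (by norm_num)]
        norm_num
      _ = max D 1 * 3 ^ d := by
        rw [mul_assoc, ← mul_pow]
        norm_num
      _ ≤ _ := by gcongr; exact hCd d
  · calc (d : ℝ) ^ 2 * √(2 ^ d) ≤ max D 1 * √(3 / 2) ^ d * √(2 ^ d) := by gcongr; exact hD' d
      _ = max D 1 * √(3 ^ d) := by
        have hp (x : ℝ) (hx : 0 ≤ x) : √(x ^ d) = √x ^ d := by
          rw [Real.sqrt_eq_iff_mul_self_eq (by positivity) (by positivity), ← mul_pow,
            Real.mul_self_sqrt hx]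
        rw [hp _ zero_le_two, hp _ zero_le_three, mul_assoc, ← mul_pow,
          ← Real.sqrt_mul (by norm_num)]
        norm_num
      _ ≤ _ := by gcongr; exact hCd d

lemma average_le_ofReal {K : ℕ} (hK : 0 < K) {e : ℕ → ℝ≥0∞} {f : ℕ → ℝ} {R : ℝ}
    (he : ∀ k ∈ Finset.Icc 1 K, e k ≤ ENNReal.ofReal (f k)) (hf : ∀ k ∈ Finset.Icc 1 K, 0 ≤ f k)
    (hR : (K : ℝ)⁻¹ * ∑ k ∈ Finset.Icc 1 K, f k ≤ R) :
    (K : ℝ≥0∞)⁻¹ * ∑ k ∈ Finset.Icc 1 K, e k ≤ ENNReal.ofReal R := by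
  refine le_trans ?_ (ENNReal.ofReal_le_ofReal hR)
  rw [ENNReal.ofReal_mul (by positivity), ENNReal.ofReal_inv_of_pos (by exact_mod_cast hK),
    ENNReal.ofReal_natCast, ENNReal.ofReal_sum_of_nonneg hf]
  gcongr with k hk
  exact he k hk

lemma div_sqrt_rpow {σ t : ℝ} (hσ : 0 ≤ σ) (ht : 0 ≤ t) (a : ℝ) :
    (σ / √t) ^ a = σ ^ a * t ^ (-(a / 2)) := by
  rw [Real.div_rpow hσ (Real.sqrt_nonneg t), Real.sqrt_eq_rpow, ← Real.rpow_mul ht,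
    Real.rpow_neg ht, div_eq_mul_inv]
  congr 3
  ring

end constants

/-! ### The averaged rates. -/

section rates

lemma ofReal_mul_le_of_mul_le_one {u v : ℝ} {I J : ℝ≥0∞} (hv : 0 ≤ v) (huv : u * v ≤ 1)
    (hI : I ≤ J) : ENNReal.ofReal u * (ENNReal.ofReal v * I) ≤ J := by
  rw [← mul_assoc, ← ENNReal.ofReal_mul' hv]
  exact (mul_le_of_le_one_left (by positivity) (ENNReal.ofReal_le_one.2 huv)).trans hI

lemma exists_epsSc_sq_le {cmin : ℝ} (hcmin : 0 < cmin) :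
    ∃ C : ℝ, 0 < C ∧ ∀ (d n K : ℕ) (c₀ c₁ τ σ : ℝ) (p : Measure (Vec d)),
      1 ≤ d → 2 ≤ n → 2 ≤ K → cmin ≤ c₀ → 5 * c₀ ≤ c₁ →
      (∀ k ∈ Finset.Icc 1 K, 0 < alpha K c₀ c₁ k ∧ alpha K c₀ c₁ k < 1) →
      0 ≤ τ → 0 < σ → IsProbabilityMeasure p → IsSubgaussian σ p →
      epsSc p n τ K c₀ c₁ ^ 2 ≤ ENNReal.ofReal (C * (Cd' d / n
        * (1 + σ ^ d * capRate d K c₀ τ ((d : ℝ) / 2)) * Real.log n ^ ((d : ℝ) / 2 + 1))) := by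
  obtain ⟨A, hA, hrate⟩ := exists_score_rate
  obtain ⟨D, hD, hdim⟩ := exists_sq_mul_two_pow_le
  have he : 0 < min (5 * cmin) 1 := lt_min (by linarith) one_pos
  have hB : 1 ≤ 8 / min (5 * cmin) 1 := by
    rw [one_le_div he]
    exact (min_le_right _ _).trans (by norm_num)
  refine ⟨A * (8 / min (5 * cmin) 1) * D, by positivity, ?_⟩
  intro d n K c₀ c₁ τ σ p hd hn hK hc hc₁ hα hτ hσ hp hsub
  have hd1 : (1 : ℝ) ≤ d := by exact_mod_cast hd
  have hK0 : (0 : ℝ) < K := by exact_mod_cast (by omega : 0 < K)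
  have hL := Real.log_natCast_nonneg n
  have hcap := capRate_nonneg d K c₀ hτ ((d : ℝ) / 2)
  have havg := average_time_rpow_neg_le_capRate (a := (d : ℝ) / 2) hcmin hc hc₁ hd hK hτ
    (by linarith) hα
  generalize 8 / min (5 * cmin) 1 = B at *
  have hstep : ∀ k ∈ Finset.Icc 1 K, ENNReal.ofReal (1 - alphaBar K c₀ c₁ k)
      * scErrSq p n τ K c₀ c₁ k ≤ ENNReal.ofReal (A * (d * 2 ^ d / n
        * (1 + σ ^ d * time τ K c₀ c₁ k ^ (-((d : ℝ) / 2))) * Real.log n ^ ((d : ℝ) / 2 + 1))) := by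
    intro k hk
    have ht := time_pos hτ hα hk
    have : IsProbabilityMeasure (p.map fun y => (√(time τ K c₀ c₁ k))⁻¹ • y) :=
      Measure.isProbabilityMeasure_map (by fun_prop)
    rw [scErrSq_eq p hn hτ hα hk]
    refine ofReal_mul_le_of_mul_le_one (by positivity) (one_sub_alphaBar_mul_le hτ hα hk) ?_
    -- The target scaled by `1/√t_k` is `σ/√t_k`-subgaussian, which is how `σ^d t_k^(-d/2)` enters.
    have h := hrate d n _ _ hd hn (div_pos hσ (Real.sqrt_pos.2 ht)) this
      (isSubgaussian_map (Real.sqrt_pos.2 ht) hsub)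
    rwa [← Real.rpow_natCast (σ / _), div_sqrt_rpow hσ.le ht.le, Real.rpow_natCast] at h
  rw [epsSc, ← ENNReal.rpow_natCast, ← ENNReal.rpow_mul, show (1 / 2 : ℝ) * (2 : ℕ) = 1 by norm_num,
    ENNReal.rpow_one]
  refine average_le_ofReal (by omega) hstep (fun k hk => ?_) ?_
  · have ht := time_pos hτ hα hk
    positivity
  have hlin : (K : ℝ)⁻¹ * ∑ k ∈ Finset.Icc 1 K, A * (d * 2 ^ d / n
        * (1 + σ ^ d * time τ K c₀ c₁ k ^ (-((d : ℝ) / 2))) * Real.log n ^ ((d : ℝ) / 2 + 1))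
      = A * (d * 2 ^ d / n * (1 + σ ^ d * ((K : ℝ)⁻¹
        * ∑ k ∈ Finset.Icc 1 K, time τ K c₀ c₁ k ^ (-((d : ℝ) / 2))))
          * Real.log n ^ ((d : ℝ) / 2 + 1)) := by
    simp only [← Finset.mul_sum, ← Finset.sum_mul, Finset.sum_add_distrib, Finset.sum_const,
      Nat.card_Icc, Nat.add_sub_cancel, nsmul_eq_mul]
    field_simp
  rw [hlin]
  -- The summand `1` is enlarged to `B * d` so that a common factor comes out; the two factors `d`
  -- then meet `2 ^ d` and are absorbed in `Cd' d`.
  calc A * (d * 2 ^ d / n * (1 + σ ^ d * ((K : ℝ)⁻¹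
        * ∑ k ∈ Finset.Icc 1 K, time τ K c₀ c₁ k ^ (-((d : ℝ) / 2))))
          * Real.log n ^ ((d : ℝ) / 2 + 1))
      ≤ A * (d * 2 ^ d / n * (B * d + σ ^ d * (B * d * capRate d K c₀ τ ((d : ℝ) / 2)))
          * Real.log n ^ ((d : ℝ) / 2 + 1)) := by
        gcongr
        exact one_le_mul_of_one_le_of_one_le hB hd1
    _ = A * B * (((d : ℝ) ^ 2 * 2 ^ d) / n * (1 + σ ^ d * capRate d K c₀ τ ((d : ℝ) / 2))
          * Real.log n ^ ((d : ℝ) / 2 + 1)) := by ring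
    _ ≤ A * B * ((D * Cd' d) / n * (1 + σ ^ d * capRate d K c₀ τ ((d : ℝ) / 2))
          * Real.log n ^ ((d : ℝ) / 2 + 1)) := by
        have h1 := (hdim d).1
        generalize (d : ℝ) ^ 2 * 2 ^ d = u, D * Cd' d = v at h1 ⊢
        gcongr
    _ = _ := by ring

lemma exists_epsJcb_le {cmin : ℝ} (hcmin : 0 < cmin) :
    ∃ C : ℝ, 0 < C ∧ ∀ (d n K : ℕ) (c₀ c₁ τ σ : ℝ) (p : Measure (Vec d)),
      1 ≤ d → 2 ≤ n → 2 ≤ K → cmin ≤ c₀ → 5 * c₀ ≤ c₁ →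
      (∀ k ∈ Finset.Icc 1 K, 0 < alpha K c₀ c₁ k ∧ alpha K c₀ c₁ k < 1) →
      0 ≤ τ → 0 < σ → IsProbabilityMeasure p → IsSubgaussian σ p →
      epsJcb p n τ K c₀ c₁ ≤ ENNReal.ofReal (C * (√(Cd' d / n)
          * (1 + σ ^ ((d : ℝ) / 2) * capRate d K c₀ τ ((d : ℝ) / 4))
          * Real.log n ^ ((d : ℝ) / 4 + 1)
        + Cd' d * σ ^ d / n * capRate d K c₀ τ ((d : ℝ) / 2)
          * Real.log n ^ ((d : ℝ) / 2 + 1))) := by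
  obtain ⟨A, hA, hrate⟩ := exists_jacobian_rate
  obtain ⟨D, hD, hdim⟩ := exists_sq_mul_two_pow_le
  have he : 0 < min (5 * cmin) 1 := lt_min (by linarith) one_pos
  have hB : 1 ≤ 8 / min (5 * cmin) 1 := by
    rw [one_le_div he]
    exact (min_le_right _ _).trans (by norm_num)
  refine ⟨A * (8 / min (5 * cmin) 1) * D, by positivity, ?_⟩
  intro d n K c₀ c₁ τ σ p hd hn hK hc hc₁ hα hτ hσ hp hsub
  have hd1 : (1 : ℝ) ≤ d := by exact_mod_cast hd
  have hK0 : (0 : ℝ) < K := by exact_mod_cast (by omega : 0 < K)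
  have hL := Real.log_natCast_nonneg n
  have hcap₂ := capRate_nonneg d K c₀ hτ ((d : ℝ) / 2)
  have hcap₄ := capRate_nonneg d K c₀ hτ ((d : ℝ) / 4)
  have havg₂ := average_time_rpow_neg_le_capRate (a := (d : ℝ) / 2) hcmin hc hc₁ hd hK hτ
    (by linarith) hα
  have havg₄ := average_time_rpow_neg_le_capRate (a := (d : ℝ) / 4) hcmin hc hc₁ hd hK hτ
    (by linarith) hα
  generalize 8 / min (5 * cmin) 1 = B at *
  have hstep : ∀ k ∈ Finset.Icc 1 K, ENNReal.ofReal (1 - alphaBar K c₀ c₁ k)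
      * jcbErr p n τ K c₀ c₁ k ≤ ENNReal.ofReal (A * (d * √(2 ^ d / n)
          * (1 + σ ^ ((d : ℝ) / 2) * time τ K c₀ c₁ k ^ (-((d : ℝ) / 4)))
          * Real.log n ^ ((d : ℝ) / 4 + 1)
        + d * 2 ^ d / n * (σ ^ d * time τ K c₀ c₁ k ^ (-((d : ℝ) / 2)))
          * Real.log n ^ ((d : ℝ) / 2 + 1))) := by
    intro k hk
    have ht := time_pos hτ hα hk
    have : IsProbabilityMeasure (p.map fun y => (√(time τ K c₀ c₁ k))⁻¹ • y) :=
      Measure.isProbabilityMeasure_map (by fun_prop)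
    rw [jcbErr_eq p hn hτ hα hk]
    refine ofReal_mul_le_of_mul_le_one (by positivity) (one_sub_alphaBar_mul_le hτ hα hk) ?_
    have h := hrate d n _ _ hd hn (div_pos hσ (Real.sqrt_pos.2 ht)) this
      (isSubgaussian_map (Real.sqrt_pos.2 ht) hsub)
    rwa [← Real.rpow_natCast (σ / _), div_sqrt_rpow hσ.le ht.le, div_sqrt_rpow hσ.le ht.le,
      Real.rpow_natCast, show (d : ℝ) / 2 / 2 = d / 4 by ring] at h
  rw [epsJcb]
  refine average_le_ofReal (by omega) hstep (fun k hk => ?_) ?_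
  · have ht := time_pos hτ hα hk
    positivity
  have hlin : (K : ℝ)⁻¹ * ∑ k ∈ Finset.Icc 1 K, A * (d * √(2 ^ d / n)
          * (1 + σ ^ ((d : ℝ) / 2) * time τ K c₀ c₁ k ^ (-((d : ℝ) / 4)))
          * Real.log n ^ ((d : ℝ) / 4 + 1)
        + d * 2 ^ d / n * (σ ^ d * time τ K c₀ c₁ k ^ (-((d : ℝ) / 2)))
          * Real.log n ^ ((d : ℝ) / 2 + 1))
      = A * (d * √(2 ^ d / n) * (1 + σ ^ ((d : ℝ) / 2) * ((K : ℝ)⁻¹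
          * ∑ k ∈ Finset.Icc 1 K, time τ K c₀ c₁ k ^ (-((d : ℝ) / 4))))
          * Real.log n ^ ((d : ℝ) / 4 + 1)
        + d * 2 ^ d / n * (σ ^ d * ((K : ℝ)⁻¹
          * ∑ k ∈ Finset.Icc 1 K, time τ K c₀ c₁ k ^ (-((d : ℝ) / 2))))
          * Real.log n ^ ((d : ℝ) / 2 + 1)) := by
    simp only [← Finset.mul_sum, ← Finset.sum_mul, Finset.sum_add_distrib, Finset.sum_const,
      Nat.card_Icc, Nat.add_sub_cancel, nsmul_eq_mul]
    field_simp
  -- The square roots are split so that `d² √(2^d)` appears explicitly and can be compared with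
  -- `√(Cd' d)`.
  rw [hlin, Real.sqrt_div (by positivity), Real.sqrt_div (by rw [Cd']; positivity)]
  calc A * (d * (√(2 ^ d) / √n) * (1 + σ ^ ((d : ℝ) / 2) * ((K : ℝ)⁻¹
          * ∑ k ∈ Finset.Icc 1 K, time τ K c₀ c₁ k ^ (-((d : ℝ) / 4))))
          * Real.log n ^ ((d : ℝ) / 4 + 1)
        + d * 2 ^ d / n * (σ ^ d * ((K : ℝ)⁻¹
          * ∑ k ∈ Finset.Icc 1 K, time τ K c₀ c₁ k ^ (-((d : ℝ) / 2))))
          * Real.log n ^ ((d : ℝ) / 2 + 1))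
      ≤ A * (d * (√(2 ^ d) / √n)
          * (B * d + σ ^ ((d : ℝ) / 2) * (B * d * capRate d K c₀ τ ((d : ℝ) / 4)))
          * Real.log n ^ ((d : ℝ) / 4 + 1)
        + d * 2 ^ d / n * (σ ^ d * (B * d * capRate d K c₀ τ ((d : ℝ) / 2)))
          * Real.log n ^ ((d : ℝ) / 2 + 1)) := by
        gcongr
        exact one_le_mul_of_one_le_of_one_le hB hd1
    _ = A * B * ((((d : ℝ) ^ 2 * √(2 ^ d)) / √n)
          * (1 + σ ^ ((d : ℝ) / 2) * capRate d K c₀ τ ((d : ℝ) / 4))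
          * Real.log n ^ ((d : ℝ) / 4 + 1)
        + ((d : ℝ) ^ 2 * 2 ^ d) / n * (σ ^ d * capRate d K c₀ τ ((d : ℝ) / 2))
          * Real.log n ^ ((d : ℝ) / 2 + 1)) := by ring
    _ ≤ A * B * (((D * √(Cd' d)) / √n)
          * (1 + σ ^ ((d : ℝ) / 2) * capRate d K c₀ τ ((d : ℝ) / 4))
          * Real.log n ^ ((d : ℝ) / 4 + 1)
        + (D * Cd' d) / n * (σ ^ d * capRate d K c₀ τ ((d : ℝ) / 2))
          * Real.log n ^ ((d : ℝ) / 2 + 1)) := by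
        have h1 := (hdim d).1
        have h2 := (hdim d).2
        generalize (d : ℝ) ^ 2 * 2 ^ d = u₁, D * Cd' d = v₁ at h1 ⊢
        generalize (d : ℝ) ^ 2 * √(2 ^ d) = u₂, D * √(Cd' d) = v₂ at h2 ⊢
        gcongr
    _ = _ := by ring

end rates

end ScoreEst

end

/-- The constant `C` depends only on a positive lower bound `cmin` for `c₀`; in particular it does
not depend on `d`, `n`, `K`, `τ`, `σ` or the target distribution `p`. -/
theorem theorem3 (cmin : ℝ) (hcmin : 0 < cmin) :
    ∃ C : ℝ, 0 < C ∧
      ∀ (d n K : ℕ) (c₀ c₁ τ σ : ℝ) (p : MeasureTheory.Measure (ScoreEst.Vec d)),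
        1 ≤ d → 2 ≤ n → 2 ≤ K → cmin ≤ c₀ → 5 * c₀ ≤ c₁ →
        (∀ k ∈ Finset.Icc 1 K,
          0 < ScoreEst.alpha K c₀ c₁ k ∧ ScoreEst.alpha K c₀ c₁ k < 1) →
        0 ≤ τ → 0 < σ →
        MeasureTheory.IsProbabilityMeasure p → ScoreEst.IsSubgaussian σ p →
        -- the score functions, their estimators and the Jacobians of both are well defined
        (∀ k ∈ Finset.Icc 1 K,
          ScoreEst.IsContDensity (ScoreEst.forwardLaw p τ K c₀ c₁ k)
            (ScoreEst.density (ScoreEst.forwardLaw p τ K c₀ c₁ k)) ∧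
          (∀ x, 0 < ScoreEst.density (ScoreEst.forwardLaw p τ K c₀ c₁ k) x) ∧
          Differentiable ℝ (ScoreEst.density (ScoreEst.forwardLaw p τ K c₀ c₁ k)) ∧
          Differentiable ℝ (ScoreEst.score (ScoreEst.forwardLaw p τ K c₀ c₁ k)) ∧
          ∀ data : Fin n → ScoreEst.Vec d,
            Differentiable ℝ (ScoreEst.scoreHatX data τ K c₀ c₁ k)) ∧
        -- the bound on the score error
        ScoreEst.epsSc p n τ K c₀ c₁ ^ 2 ≤ ENNReal.ofReal
          (C * (ScoreEst.Cd' d / n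
            * (1 + σ ^ d * ScoreEst.capRate d K c₀ τ ((d : ℝ) / 2))
            * Real.log n ^ ((d : ℝ) / 2 + 1))) ∧
        -- the bound on the mean Jacobian error
        ScoreEst.epsJcb p n τ K c₀ c₁ ≤ ENNReal.ofReal
          (C * (√(ScoreEst.Cd' d / n)
              * (1 + σ ^ ((d : ℝ) / 2) * ScoreEst.capRate d K c₀ τ ((d : ℝ) / 4))
              * Real.log n ^ ((d : ℝ) / 4 + 1)
            + ScoreEst.Cd' d * σ ^ d / n * ScoreEst.capRate d K c₀ τ ((d : ℝ) / 2)
              * Real.log n ^ ((d : ℝ) / 2 + 1))) ∧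
        -- the Jacobian of the estimator, for every realization of the training data
        (∀ k ∈ Finset.Icc 1 K, ∀ (data : Fin n → ScoreEst.Vec d) (x : ScoreEst.Vec d),
          (fderiv ℝ (ScoreEst.scoreHatX data τ K c₀ c₁ k) x
            + (1 / (1 - ScoreEst.alphaBar K c₀ c₁ k))
              • ContinuousLinearMap.id ℝ (ScoreEst.Vec d)).IsPositive) := by
  obtain ⟨C₁, hC₁, hsc⟩ := ScoreEst.exists_epsSc_sq_le hcmin
  obtain ⟨C₂, hC₂, hjcb⟩ := ScoreEst.exists_epsJcb_le hcmin
  refine ⟨max C₁ C₂, lt_max_of_lt_left hC₁, ?_⟩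
  intro d n K c₀ c₁ τ σ p hd hn hK hc hc₁ hα hτ hσ hp hsub
  have hL := Real.log_natCast_nonneg n
  have hCd : 0 ≤ ScoreEst.Cd' d := by
    rw [ScoreEst.Cd']
    positivity
  have hcap₂ := ScoreEst.capRate_nonneg d K c₀ hτ ((d : ℝ) / 2)
  have hcap₄ := ScoreEst.capRate_nonneg d K c₀ hτ ((d : ℝ) / 4)
  refine ⟨fun k hk => ScoreEst.regularity_forwardLaw p hn hτ hα hk,
    (hsc d n K c₀ c₁ τ σ p hd hn hK hc hc₁ hα hτ hσ hp hsub).trans (ENNReal.ofReal_le_ofReal ?_),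
    (hjcb d n K c₀ c₁ τ σ p hd hn hK hc hc₁ hα hτ hσ hp hsub).trans (ENNReal.ofReal_le_ofReal ?_),
    fun k hk data x => ScoreEst.isPositive_fderiv_scoreHatX hn hτ hα hk data x⟩
  · gcongr
    exact le_max_left _ _
  · gcongr
    exact le_max_right _ _
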